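/- Let $k$ be a field of characteristic $0$. A curve over $k$ is a smooth irreducible projective curve over $k$ (possibly geometrically reducible), and a covering is a nonconstant (hence finite surjective) $k$-morphism of curves. A covering $f:X\to Y$ gives a finite field extension $k(X)/k(Y)$; its monodromy group $\mathrm{Mon}(f)$ is the Galois group over $k(Y)$ of the Galois closure of $k(X)/k(Y)$, and its Galois closure $\tilde f:\tilde X\to Y$ is the covering corresponding to that field (unique up to equivalence). A covering $h:Z\to Y$ is a subcover of $f$ if $f=h\circ h'$ for some covering $h'$; it is a proper subcover if $h'$ is not an isomorphism. A covering is indecomposable if it has degree $>1$ and is not a composition of two coverings of degree $>1$. The pullback of $f:X\to Y$ along $g:Z\to Y$, when the fiber product $X\times_Y Z$ is irreducible, is the projection to $Z$ from the normalization of $X\times_Y Z$. Call a covering $h$ *minimal nonsolvable* if $\mathrm{Mon}(h)$ is nonsolvable and every proper subcover of $h$ has solvable monodromy group. All quotients and isomorphisms of monodromy groups are those of abstract groups. Let $X_0$ be a curve over $k$ (for instance $X_0=\mathbb P^1_k$), and let $f=f_1\circ\cdots\circ f_r:X_r\to X_0$, where $f_i:X_i\to X_{i-1}$ $(i=1,\dots,r)$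 are indecomposable coverings such that each $\Gamma_i=\mathrm{Mon}(f_i)$ has a unique minimal normal subgroup, and the quotient of $\Gamma_i$ by it is solvable. **Theorem.** Let $h:Y\to X_0$ be a minimal nonsolvable subcover of $\tilde f$ such that all proper quotients of $\mathrm{Mon}(h)$ are solvable. Then: 1. There is a subcover $f'$ of $f$ that has the same Galois closure as $h$, and $f'=f_1'\circ f_2'$ for coverings $f_1',f_2'$ with $\mathrm{Mon}(f_1')$ solvable and $f_2'$ indecomposable. 2. If moreover $\Gamma_1,\dots,\Gamma_r$ are all nonsolvable, then in (1) $f_1'$ is an isomorphism and $f'$ is indecomposable. **Addendum.** Assume that $\Gamma_1,\dots,\Gamma_r$ are all nonsolvable. (a) Let $h$ be as in the theorem and let $i\in\{1,\dots,r\}$ be minimal such that $h$ is a subcover of the Galois closure of $f_1\circ\cdots\circ f_i$. Then $\mathrm{Mon}(f_1\circ\cdots\circ f_i)$ embeds into $\mathrm{Mon}(f_1\circ\cdots\circ f_{i-1})\times\mathrm{Mon}(f_i)$ (the empty composition being $\mathrm{id}_{X_0}$). (b) Let $i\in\{1,\dots,r\}$, and let $\tilde g_j$ denote the Galois closure of $f_1\circ\cdots\circ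 f_j$. All minimal nonsolvable coverings $h$ of $X_0$ such that all proper quotients of $\mathrm{Mon}(h)$ are solvable and such that $h$ is a subcover of $\tilde g_i$ but not of $\tilde g_{i-1}$ have the same Galois closure, and their monodromy group is isomorphic to $\mathrm{Mon}(f_i)$. (c) With $h$ and $i$ as in (a), there is a subcover $u$ of the Galois closure $\tilde h$ of $h$ such that the fiber product of $u$ and $f_1\circ\cdots\circ f_{i-1}$ is irreducible and $f_i$ is equivalent to the pullback of $u$ along $f_1\circ\cdots\circ f_{i-1}$. -/

import Mathlib

open CategoryTheory CategoryTheory.Limits AlgebraicGeometry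

universe u

/-! ### Group theory -/

/-- `N` is a minimal normal subgroup of `G`: a minimal element among the nontrivial normal
subgroups. -/
def IsMinimalNormalSubgroup {G : Type*} [Group G] (N : Subgroup G) : Prop :=
  Minimal (fun M : Subgroup G => M.Normal ∧ M ≠ ⊥) N

/-- `G` has a unique minimal normal subgroup, and the quotient by it is solvable. -/
def HasUniqueMinimalNormalWithSolvableQuotient (G : Type*) [Group G] : Prop :=
  ∃ (N : Subgroup G) (_ : N.Normal), IsMinimalNormalSubgroup N ∧
    (∀ M : Subgroup G, IsMinimalNormalSubgroup M → M = N) ∧ Group.IsSolvable (G ⧸ N)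

/-- Every proper quotient of `G` is solvable. -/
def ProperQuotientsSolvable (G : Type*) [Group G] : Prop :=
  ∀ (N : Subgroup G) [N.Normal], N ≠ ⊥ → Group.IsSolvable (G ⧸ N)

/-! ### Curves and coverings -/

/-- A nonsingular irreducible projective curve over the field `k`: an integral proper `k`-scheme
all of whose local rings at closed points are discrete valuation rings (so it has dimension one
and is regular). Over a field of characteristic `0`, regular is the same as smooth, and proper
curves over a field are projective. The curve may be geometrically reducible. -/
structure CurveOver (k : Type u) [Field k] where
  /-- the underlying scheme -/
  scheme : Scheme.{u}
  /-- the structure morphism -/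
  str : scheme ⟶ Spec (.of k)
  isIntegral : IsIntegral scheme
  isProper : IsProper str
  isDVR : ∀ x : scheme, IsClosed ({x} : Set scheme) →
    IsDiscreteValuationRing (scheme.presheaf.stalk x)

attribute [instance] CurveOver.isIntegral CurveOver.isProper

/-- A (branched) covering `X → Y` over `k`: a finite surjective `k`-morphism of curves
(equivalently, a nonconstant `k`-morphism). -/
@[ext]
structure BranchedCovering {k : Type u} [Field k] (X Y : CurveOver k) where
  /-- the underlying morphism of schemes -/
  hom : X.scheme ⟶ Y.scheme
  hom_str : hom ≫ Y.str = X.str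
  isFinite : IsFinite hom
  surjective : Surjective hom

attribute [instance] BranchedCovering.isFinite BranchedCovering.surjective

namespace BranchedCovering

variable {k : Type u} [Field k]

/-- The identity covering. -/
def refl (X : CurveOver k) : BranchedCovering X X where
  hom := 𝟙 _
  hom_str := Category.id_comp _
  isFinite := inferInstance
  surjective := inferInstance

/-- `f.comp g` is the composition `f ∘ g` of coverings. -/
def comp {X Y Z : CurveOver k} (f : BranchedCovering Y Z) (g : BranchedCovering X Y) :
    BranchedCovering X Z where
  hom := g.hom ≫ f.hom
  hom_str := by rw [Category.assoc, f.hom_str, g.hom_str]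
  isFinite := inferInstance
  surjective := inferInstance

lemma map_genericPoint {X Y : CurveOver k} (f : BranchedCovering X Y) :
    f.hom (genericPoint X.scheme) = genericPoint Y.scheme := by
  apply ((genericPoint_spec Y.scheme).eq _).symm
  have h := (genericPoint_spec X.scheme).image f.hom.continuous
  rwa [Set.image_univ, f.hom.surjective.range_eq, closure_univ] at h

/-- The map `f^* : k(Y) → k(X)` of function fields given by a covering `f : X → Y`. -/
noncomputable def functionFieldMap {X Y : CurveOver k} (f : BranchedCovering X Y) :
    Y.scheme.functionField →+* X.scheme.functionField :=
  (Y.scheme.presheaf.stalkSpecializes (specializes_of_eq f.map_genericPoint) ≫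
    f.hom.stalkMap (genericPoint X.scheme)).hom

/-- The (arithmetic) monodromy group of `f : X → Y`: the Galois group over `k(Y)` of the
Galois closure of `k(X) / k(Y)` (taken inside an algebraic closure of `k(X)`). -/
def Mon {X Y : CurveOver k} (f : BranchedCovering X Y) : Type u :=
  letI : Algebra Y.scheme.functionField X.scheme.functionField := f.functionFieldMap.toAlgebra
  Gal(IntermediateField.normalClosure Y.scheme.functionField X.scheme.functionField
    (AlgebraicClosure X.scheme.functionField) / Y.scheme.functionField)

noncomputable instance {X Y : CurveOver k} (f : BranchedCovering X Y) : Group f.Mon :=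
  letI : Algebra Y.scheme.functionField X.scheme.functionField := f.functionFieldMap.toAlgebra
  inferInstanceAs (Group Gal(IntermediateField.normalClosure Y.scheme.functionField
    X.scheme.functionField (AlgebraicClosure X.scheme.functionField) / Y.scheme.functionField))

/-- `f'` (a covering of `Y`) is the Galois closure of `f : X → Y`, i.e. the extension
`k(X') / k(Y)` given by `f'` is a Galois (= normal) closure of `k(X) / k(Y)`. -/
def IsGaloisClosure {X X' Y : CurveOver k} (f' : BranchedCovering X' Y)
    (f : BranchedCovering X Y) : Prop :=
  letI : Algebra Y.scheme.functionField X.scheme.functionField := f.functionFieldMap.toAlgebra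
  letI : Algebra Y.scheme.functionField X'.scheme.functionField := f'.functionFieldMap.toAlgebra
  IsNormalClosure Y.scheme.functionField X.scheme.functionField X'.scheme.functionField

/-- `h` is a subcover of `f`: `f = h ∘ h'` for some covering `h'`. -/
def IsSubcover {X Z Y : CurveOver k} (h : BranchedCovering Z Y) (f : BranchedCovering X Y) :
    Prop :=
  ∃ h' : BranchedCovering X Z, f = h.comp h'

/-- `h` is a subcover of the Galois closure of `f`. -/
def IsSubcoverOfGaloisClosure {X Z Y : CurveOver k} (h : BranchedCovering Z Y)
    (f : BranchedCovering X Y) : Prop :=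
  ∃ (X' : CurveOver k) (f' : BranchedCovering X' Y), f'.IsGaloisClosure f ∧ h.IsSubcover f'

/-- `f` and `h` have the same Galois closure. -/
def SameGaloisClosure {X Z Y : CurveOver k} (f : BranchedCovering X Y)
    (h : BranchedCovering Z Y) : Prop :=
  ∃ (W : CurveOver k) (g : BranchedCovering W Y), g.IsGaloisClosure f ∧ g.IsGaloisClosure h

/-- `f` is indecomposable: it has degree greater than one (it is not an isomorphism), and it is
not the composition of two coverings of degree greater than one. -/
def Indecomposable {X Y : CurveOver k} (f : BranchedCovering X Y) : Prop :=
  ¬ IsIso f.hom ∧ ∀ (Z : CurveOver k) (g : BranchedCovering Z Y) (h : BranchedCovering X Z),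
    f = g.comp h → IsIso g.hom ∨ IsIso h.hom

/-- `h` is minimal with nonsolvable monodromy group: `Mon h` is nonsolvable, and every proper
subcover of `h` has solvable monodromy group. -/
def IsMinimalNonsolvable {X Y : CurveOver k} (h : BranchedCovering X Y) : Prop :=
  ¬ Group.IsSolvable h.Mon ∧
    ∀ (Z : CurveOver k) (h₁ : BranchedCovering Z Y) (h₂ : BranchedCovering X Z),
      h = h₁.comp h₂ → ¬ IsIso h₂.hom → Group.IsSolvable h₁.Mon

/-- The covering `w : W → Z` is (equivalent to) the pullback of `f : X → Y` along `g : Z → Y`,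
that is, to the projection to `Z` of the normalization of the fiber product `X ×_Y Z`. Here `W`
is normal, so it is the normalization of the fiber product as soon as the map to the fiber
product is integral and an isomorphism over a dense open subscheme. In particular the fiber
product is irreducible. -/
def IsPullbackAlong {W X Y Z : CurveOver k} (w : BranchedCovering W Z)
    (f : BranchedCovering X Y) (g : BranchedCovering Z Y) : Prop :=
  ∃ (p : W.scheme ⟶ X.scheme) (comm : p ≫ f.hom = w.hom ≫ g.hom),
    IsIntegralHom (pullback.lift p w.hom comm) ∧
    ∃ V : (pullback f.hom g.hom).Opens, Dense (V : Set ↥(pullback f.hom g.hom)) ∧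
      IsIso (pullback.lift p w.hom comm ∣_ V)

/-- For a tower of coverings `f₁ : X₁ → X₀, …, f_r : X_r → X_{r-1}` (where `f i` is `f_{i+1}`),
`composite f i` is the composition `f₁ ∘ ⋯ ∘ f_i : X_i → X₀`. -/
def composite {r : ℕ} {X : Fin (r + 1) → CurveOver k}
    (f : ∀ i : Fin r, BranchedCovering (X i.succ) (X i.castSucc)) (i : Fin (r + 1)) :
    BranchedCovering (X i) (X 0) :=
  Fin.induction (motive := fun i => BranchedCovering (X i) (X 0)) (refl (X 0))
    (fun j g => g.comp (f j)) i

end BranchedCovering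

/-! The theorem is a statement about finite groups. Embed the function fields of the tower
compatibly in one finite Galois extension `Ω` of the function field of the base, with group `G`. The
tower becomes a chain of stabilizers `G = H 0 ⋗ H 1 ⋗ ⋯ ⋗ H r`, each maximal in the preceding one,
and the monodromy group of a step `B ⋖ A` is `A` modulo the largest normal subgroup `relCore A B` of
`A` inside `B`. A covering `h` as in the theorem gives a normal subgroup `K` with `G ⧸ K` isomorphic
to `Mon h`: nonsolvable, with all proper quotients solvable. Solvability is handled through the
solvable residual `R(A)`, which is the largest perfect subgroup of `A`, commutes with homomorphic
images, and lies in a normal subgroup exactly when the quotient by it is solvable.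

The heart is `inf_normalCore_le_and_not_le_sup`, about the step `B ⋖ A` at which the normal core in
`G` falls into `K`. Let `Q` be the core of `A` and `X = R(Q)`; then `X` covers `R(G)` modulo `K`. If
`K ⊓ Q` were not inside `B`, it would cover `R(A)` modulo `relCore A B`. Intersecting over all
conjugates, which is possible because `X` is perfect, would put `X` in `K`. So `K ⊓ Q` lies in the
core of `B`. If moreover `R(G) ≤ B ⊔ K`, then `X ⊓ B` would be normal in `A`, so modulo `relCore A
B` the image of `X` would be a regular normal subgroup with a solvable maximal complement. Such a
subgroup is solvable (`isSolvable_of_inf_eq_bot`, by a coprime action on Sylow subgroups),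
contradicting that `X` is perfect and not in `B`.

Hence there is a step at which `H j ⊔ K` contains `R(G)` and `H (j+1) ⊔ K` does not. The second
group has core `K` and is maximal in the first; these two groups define `f'` and `f₁'`. If all steps
are nonsolvable, a group `H j ⊔ K` containing `R(G)` must be all of `G`
(`sup_eq_top_of_residual_le`), which gives part (2). At the critical step `A ⊔ K = G` and `relCore A
B = A ⊓ K`, so `G ⧸ K` is the monodromy group of the step. The inclusion of `K ⊓ A.normalCore` in
`B.normalCore` gives the embedding in (a) and, by a commutator argument, the uniqueness of `K` in
(b). Finally `(B ⊔ K) ⊓ A = B` together with `A ⊔ K = G` is linear disjointness, which gives the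
pullback in (c).

The translation needs three geometric facts: embeddings of function fields come from coverings
(`BranchedCovering.exists_comp_eq`), finite extensions come from coverings
(`CurveOver.exists_covering`), and a pushout of function fields gives a pullback of coverings
(`isPullbackAlong_of_isPushout_functionFieldMap`). -/

/-! ### The solvable residual of a subgroup -/

section SolvableResidual

variable {G G' : Type*} [Group G] [Group G']

/-- The solvable residual of a subgroup of a finite group: the intersection of its derived series. -/
def solvableResidual (A : Subgroup G) : Subgroup G :=
  ⨅ n : ℕ, (fun B : Subgroup G => ⁅B, B⁆)^[n] A

lemma iterate_commutator_succ_le (A : Subgroup G) (n : ℕ) :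
    (fun B : Subgroup G => ⁅B, B⁆)^[n + 1] A ≤ (fun B : Subgroup G => ⁅B, B⁆)^[n] A := by
  rw [Function.iterate_succ_apply']
  exact Subgroup.commutator_le_self _

lemma iterate_commutator_antitone (A : Subgroup G) :
    Antitone fun n : ℕ => (fun B : Subgroup G => ⁅B, B⁆)^[n] A :=
  antitone_nat_of_succ_le (iterate_commutator_succ_le A)

lemma map_iterate_commutator (φ : G →* G') (A : Subgroup G) (n : ℕ) :
    ((fun B : Subgroup G => ⁅B, B⁆)^[n] A).map φ =
      (fun B : Subgroup G' => ⁅B, B⁆)^[n] (A.map φ) := by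
  induction n with
  | zero => rfl
  | succ n ih => rw [Function.iterate_succ_apply', Function.iterate_succ_apply',
      Subgroup.map_commutator, ih]

lemma iterate_commutator_top (n : ℕ) :
    (fun B : Subgroup G => ⁅B, B⁆)^[n] ⊤ = derivedSeries G n := by
  induction n with
  | zero => rfl
  | succ n ih => rw [Function.iterate_succ_apply', ih, derivedSeries_succ]

lemma iterate_commutator_mono {A B : Subgroup G} (h : A ≤ B) (n : ℕ) :
    (fun B : Subgroup G => ⁅B, B⁆)^[n] A ≤ (fun B : Subgroup G => ⁅B, B⁆)^[n] B := by
  induction n with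
  | zero => exact h
  | succ n ih =>
    rw [Function.iterate_succ_apply', Function.iterate_succ_apply']
    exact Subgroup.commutator_mono ih ih

lemma solvableResidual_le (A : Subgroup G) : solvableResidual A ≤ A := iInf_le _ 0

lemma solvableResidual_mono {A B : Subgroup G} (h : A ≤ B) :
    solvableResidual A ≤ solvableResidual B :=
  iInf_mono fun n => iterate_commutator_mono h n

/-- Commutation fixes a perfect subgroup, which therefore survives in every term of the series. With
`solvableResidual_perfect`, the residual of a subgroup of a finite group is its largest perfect
subgroup. -/
lemma le_solvableResidual_of_perfect {A X : Subgroup G} (hX : ⁅X, X⁆ = X) (h : X ≤ A) :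
    X ≤ solvableResidual A := by
  refine le_iInf fun n => (le_of_eq ?_).trans (iterate_commutator_mono h n)
  exact (Function.iterate_fixed (f := fun B : Subgroup G => ⁅B, B⁆) hX n).symm

variable [Finite G]

/-- A descending chain in a finite group is stationary, so the intersection is itself a term. This
is what makes the residual perfect and compatible with images, which need not commute with
intersections. -/
lemma exists_solvableResidual_eq (A : Subgroup G) :
    ∃ N, ∀ n, N ≤ n → solvableResidual A = (fun B : Subgroup G => ⁅B, B⁆)^[n] A := by
  obtain ⟨N, hN⟩ := WellFoundedGT.monotone_chain_condition (α := (Subgroup G)ᵒᵈ)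
    ⟨fun n => OrderDual.toDual ((fun B : Subgroup G => ⁅B, B⁆)^[n] A),
      fun m n h => iterate_commutator_antitone A h⟩
  have hN' : ∀ n, N ≤ n → (fun B : Subgroup G => ⁅B, B⁆)^[N] A =
    (fun B : Subgroup G => ⁅B, B⁆)^[n] A := hN
  have key : solvableResidual A = (fun B : Subgroup G => ⁅B, B⁆)^[N] A := by
    refine le_antisymm (iInf_le _ N) (le_iInf fun n => ?_)
    rcases le_total N n with h | h
    · exact (hN' n h).le
    · exact iterate_commutator_antitone A h
  exact ⟨N, fun n hn => key.trans (hN' n hn)⟩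

lemma solvableResidual_perfect (A : Subgroup G) :
    ⁅solvableResidual A, solvableResidual A⁆ = solvableResidual A := by
  obtain ⟨N, hN⟩ := exists_solvableResidual_eq A
  conv_rhs => rw [hN (N + 1) (Nat.le_succ N), Function.iterate_succ_apply', ← hN N le_rfl]

/-- The image of a perfect subgroup is perfect, which gives one inclusion; for the other, the
residual is a term of the series, and the series of `A` maps onto that of its image. -/
lemma map_solvableResidual (φ : G →* G') (A : Subgroup G) :
    (solvableResidual A).map φ = solvableResidual (A.map φ) := by
  obtain ⟨N, hN⟩ := exists_solvableResidual_eq A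
  apply le_antisymm
  · refine le_solvableResidual_of_perfect ?_ (Subgroup.map_mono (solvableResidual_le A))
    rw [← Subgroup.map_commutator, solvableResidual_perfect]
  · rw [hN N le_rfl, map_iterate_commutator]
    exact iInf_le _ N

lemma isSolvable_iff_solvableResidual_top :
    Group.IsSolvable G ↔ solvableResidual (⊤ : Subgroup G) = ⊥ := by
  rw [Group.isSolvable_def]
  obtain ⟨N, hN⟩ := exists_solvableResidual_eq (⊤ : Subgroup G)
  constructor
  · rintro ⟨n, hn⟩
    rw [← iterate_commutator_top] at hn
    exact le_bot_iff.mp (hn ▸ iInf_le _ n)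
  · intro h
    exact ⟨N, by rw [← iterate_commutator_top, ← hN N le_rfl, h]⟩

lemma isSolvable_iff_solvableResidual (A : Subgroup G) :
    Group.IsSolvable A ↔ solvableResidual A = ⊥ := by
  rw [isSolvable_iff_solvableResidual_top, ← (Subgroup.map_injective A.subtype_injective).eq_iff,
    map_solvableResidual, ← MonoidHom.range_eq_map, Subgroup.range_subtype, Subgroup.map_bot]

lemma isSolvable_map_iff (A : Subgroup G) (φ : G →* G') [Finite G'] :
    Group.IsSolvable (A.map φ) ↔ solvableResidual A ≤ φ.ker := by
  rw [isSolvable_iff_solvableResidual, ← map_solvableResidual, Subgroup.map_eq_bot_iff]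

lemma isSolvable_quotient_iff (N : Subgroup G) [N.Normal] :
    Group.IsSolvable (G ⧸ N) ↔ solvableResidual (⊤ : Subgroup G) ≤ N := by
  rw [isSolvable_iff_solvableResidual_top,
    ← Subgroup.map_top_of_surjective (QuotientGroup.mk' N) (QuotientGroup.mk'_surjective N),
    ← map_solvableResidual, Subgroup.map_eq_bot_iff, QuotientGroup.ker_mk']

/-- Modulo `N`, the image of `X` is a perfect subgroup of the image of `A`. -/
lemma solvableResidual_le_sup {X A N : Subgroup G} [N.Normal] (hX : ⁅X, X⁆ = X)
    (h : X ≤ A ⊔ N) : X ≤ solvableResidual A ⊔ N := by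
  rw [sup_comm, ← QuotientGroup.comap_map_mk', ← Subgroup.map_le_iff_le_comap] at h ⊢
  rw [map_solvableResidual]
  exact le_solvableResidual_of_perfect (by rw [← Subgroup.map_commutator, hX]) h

lemma le_normalizer_solvableResidual {A L : Subgroup G} (h : L ≤ Subgroup.normalizer (A : Set G)) :
    L ≤ Subgroup.normalizer (solvableResidual A : Set G) := by
  intro g hg
  have key : ∀ {g : G}, g ∈ Subgroup.normalizer (A : Set G) →
      ∀ {x : G}, x ∈ solvableResidual A → g * x * g⁻¹ ∈ solvableResidual A := by
    intro g hg x hx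
    have h1 : A.map (MulAut.conj g).toMonoidHom = A := by
      ext x
      rw [Subgroup.mem_map_equiv, Subgroup.mem_normalizer_iff.mp hg]
      simp [mul_assoc]
    rw [← h1, ← map_solvableResidual]
    exact ⟨x, hx, by simp⟩
  rw [Subgroup.mem_normalizer_iff]
  intro x
  refine ⟨key (h hg), fun hx => ?_⟩
  have := key (inv_mem (h hg)) hx
  simpa [mul_assoc] using this

instance solvableResidual_normal (A : Subgroup G) [A.Normal] : (solvableResidual A).Normal := by
  rw [← Subgroup.normalizer_eq_top_iff, ← top_le_iff]
  exact le_normalizer_solvableResidual (Subgroup.normalizer_eq_top_iff.mpr ‹_›).ge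

end SolvableResidual

/-! ### Regular normal subgroups with solvable complement -/

section Regular

variable {G : Type*} [Group G] [Finite G]

/-- A nontrivial finite solvable group has a nontrivial characteristic elementary abelian subgroup. -/
lemma exists_characteristic_isPGroup [Nontrivial G] [hG : Group.IsSolvable G] :
    ∃ (p : ℕ) (_ : p.Prime) (Q : Subgroup G), Q.Characteristic ∧ IsPGroup p Q ∧ Q ≠ ⊥ := by
  classical
  have hex : ∃ n, derivedSeries G n = ⊥ := hG.solvable
  -- The last nontrivial term of the derived series is abelian and characteristic.
  obtain ⟨m, hm⟩ : ∃ m, Nat.find hex = m + 1 := by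
    refine Nat.exists_eq_succ_of_ne_zero fun h0 => ?_
    have := Nat.find_spec hex
    rw [h0, derivedSeries_zero] at this
    exact top_ne_bot this
  have hE : derivedSeries G m ≠ ⊥ := Nat.find_min hex (by omega)
  have hE' : ⁅derivedSeries G m, derivedSeries G m⁆ = ⊥ := by
    rw [← derivedSeries_succ, ← hm]; exact Nat.find_spec hex
  have hcomm : ∀ x ∈ derivedSeries G m, ∀ y ∈ derivedSeries G m, x * y = y * x := by
    intro x hx y hy
    have := Subgroup.commutator_eq_bot_iff_le_centralizer.mp hE' hx
    exact (Subgroup.mem_centralizer_iff.mp this y hy).symm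
  have : Nontrivial (derivedSeries G m) := (Subgroup.nontrivial_iff_ne_bot _).mpr hE
  obtain ⟨p, hp, hdvd⟩ := Nat.exists_prime_and_dvd (n := Nat.card (derivedSeries G m))
    (Finite.one_lt_card).ne'
  have := Fact.mk hp
  obtain ⟨x, hx⟩ := exists_prime_orderOf_dvd_card' p hdvd
  -- The elements killed by `p` in that abelian term; `p` divides its order, so by Cauchy there are
  -- nontrivial ones.
  let Q : Subgroup G :=
    { carrier := {y | y ∈ derivedSeries G m ∧ y ^ p = 1}
      mul_mem' := by
        rintro a b ⟨ha, ha'⟩ ⟨hb, hb'⟩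
        refine ⟨mul_mem ha hb, ?_⟩
        rw [Commute.mul_pow (hcomm a ha b hb), ha', hb', one_mul]
      one_mem' := ⟨one_mem _, one_pow p⟩
      inv_mem' := by
        rintro a ⟨ha, ha'⟩
        exact ⟨inv_mem ha, by rw [inv_pow, ha', inv_one]⟩ }
  refine ⟨p, hp, Q, ?_, ?_, ?_⟩
  · rw [Subgroup.characteristic_iff_le_comap]
    rintro φ y ⟨hy, hy'⟩
    refine ⟨?_, ?_⟩
    · have := Subgroup.characteristic_iff_le_comap.mp
        (inferInstance : (derivedSeries G m).Characteristic) φ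
      exact this hy
    · change φ y ^ p = 1
      rw [← map_pow, hy', map_one]
  · rintro ⟨y, hy, hy'⟩
    exact ⟨1, by ext; simpa using hy'⟩
  · intro h
    have hxQ : (x : G) ∈ Q := ⟨x.2, by
      have := pow_orderOf_eq_one x
      rw [hx] at this
      exact_mod_cast congrArg Subtype.val this⟩
    rw [h, Subgroup.mem_bot] at hxQ
    have : x = 1 := Subtype.ext hxQ
    rw [this, orderOf_one] at hx
    exact hp.one_lt.ne hx

open Pointwise in
/-- If a maximal subgroup `A` with trivial core is solvable and meets a normal subgroup `N`
trivially, then `N` is solvable. -/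
lemma isSolvable_of_inf_eq_bot {A N : Subgroup G} [N.Normal] (hA : IsCoatom A)
    (hcore : A.normalCore = ⊥) (hsol : Group.IsSolvable A) (hNA : N ⊓ A = ⊥) :
    Group.IsSolvable N := by
  -- If the trivial subgroup is maximal, every nontrivial element generates `G`, so `N` is
  -- commutative.
  by_cases hAbot : A = ⊥
  · subst hAbot
    refine Group.isSolvable_of_comm fun a b => ?_
    by_cases ha : a = 1
    · simp [ha]
    have hz : Subgroup.zpowers (a : G) = ⊤ := by
      refine hA.2 _ (bot_lt_iff_ne_bot.mpr ?_)
      rw [Ne, Subgroup.zpowers_eq_bot]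
      simpa using ha
    obtain ⟨n, hn⟩ := Subgroup.mem_zpowers_iff.mp (hz ▸ Subgroup.mem_top (b : G))
    ext
    change (a : G) * b = b * a
    rw [← hn]
    exact ((Commute.refl (a : G)).zpow_right n)
  by_cases hNbot : N = ⊥
  · subst hNbot; infer_instance
  have : Nontrivial A := (Subgroup.nontrivial_iff_ne_bot _).mpr hAbot
  obtain ⟨p, hp, Q₀, hQ₀, hpQ₀, hQ₀bot⟩ := exists_characteristic_isPGroup (G := A)
  have := Fact.mk hp
  obtain ⟨Q, hQdef⟩ : ∃ Q : Subgroup G, Q = Q₀.map A.subtype := ⟨_, rfl⟩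
  have hpQ : IsPGroup p Q := hQdef ▸ hpQ₀.map _
  have hQA : Q ≤ A := hQdef ▸ Subgroup.map_subtype_le _
  have hQbot : Q ≠ ⊥ := by
    rwa [hQdef, Ne, Subgroup.map_eq_bot_iff_of_injective _ A.subtype_injective]
  have hQconj : ∀ a ∈ A, ∀ q ∈ Q, a * q * a⁻¹ ∈ Q := by
    rintro a ha q hq
    rw [hQdef] at hq ⊢
    obtain ⟨q, hq, rfl⟩ := hq
    exact ⟨⟨a, ha⟩ * q * ⟨a, ha⟩⁻¹, (inferInstance : Q₀.Normal).conj_mem q hq ⟨a, ha⟩, rfl⟩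
  have hAQ : A ≤ Subgroup.normalizer (Q : Set G) := by
    intro a ha
    rw [Subgroup.mem_normalizer_iff]
    refine fun q => ⟨hQconj a ha q, fun hq => ?_⟩
    simpa [mul_assoc] using hQconj a⁻¹ (inv_mem ha) _ hq
  -- The normalizer contains the maximal subgroup `A`. It is not `G`, since otherwise `Q` would be a
  -- nontrivial normal subgroup inside the core of `A`.
  have hnorm : Subgroup.normalizer (Q : Set G) = A := by
    rcases hA.le_iff.mp hAQ with h | h
    · have : Q.Normal := Subgroup.normalizer_eq_top_iff.mp h
      exact absurd (le_bot_iff.mp (hcore ▸ Subgroup.normal_le_normalCore.mpr hQA)) hQbot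
    · exact h
  let c : G →* MulAut N := MulAut.conjNormal
  have hc : ∀ (g : G) (n : N), ((c g n : N) : G) = g * n * g⁻¹ := fun g n =>
    MulAut.conjNormal_apply g n
  have hcN : ∀ n : N, c (n : G) = MulAut.conj n := fun n => MulAut.conjNormal_val
  -- The centralizer of `Q` in `N` lies in `N ⊓ A`, because the normalizer of `Q` is `A`.
  have hcent : ∀ n : N, (∀ q ∈ Q, c q n = n) → n = 1 := by
    intro n hn
    have hnA : (n : G) ∈ A := by
      rw [← hnorm]
      refine Subgroup.centralizer_le_normalizer _ ?_
      rw [Subgroup.mem_centralizer_iff]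
      intro q hq
      have h1 := congrArg Subtype.val (hn q hq)
      rwa [hc, mul_inv_eq_iff_eq_mul] at h1
    have : (n : G) ∈ N ⊓ A := ⟨n.2, hnA⟩
    rw [hNA, Subgroup.mem_bot] at this
    exact Subtype.ext this
  let actN : MulAction Q N := MulAction.compHom N (c.comp Q.subtype)
  have hactN : ∀ (q : Q) (n : N), q • n = c q n := fun _ _ => rfl
  -- The `p`-group `Q` acts on `N` with a single fixed point, so the order of `N` is congruent to
  -- `1` modulo `p`.
  have hpN : ¬ p ∣ Nat.card N := by
    have h1 := hpQ.card_modEq_card_fixedPoints N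
    have h2 : MulAction.fixedPoints Q N = {1} := by
      ext n
      rw [MulAction.mem_fixedPoints, Set.mem_singleton_iff]
      refine ⟨fun h => hcent n fun q hq => h ⟨q, hq⟩, ?_⟩
      rintro rfl q
      rw [hactN, map_one]
    rw [h2, Nat.card_unique (α := ({1} : Set N))] at h1
    rw [Nat.dvd_iff_mod_eq_zero, h1, Nat.mod_eq_of_lt hp.one_lt]
    exact one_ne_zero
  have : Nontrivial N := (Subgroup.nontrivial_iff_ne_bot _).mpr hNbot
  obtain ⟨l, hl, hlN⟩ := Nat.exists_prime_and_dvd (n := Nat.card N) Finite.one_lt_card.ne'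
  have := Fact.mk hl
  -- The number of Sylow `l`-subgroups divides the order of `N`, hence is prime to `p`, and `Q`
  -- fixes one of them.
  obtain ⟨L, hL⟩ : ∃ L : Sylow l N, ∀ q ∈ Q, c q • L = L := by
    let actS : MulAction Q (Sylow l N) := MulAction.compHom (Sylow l N) (c.comp Q.subtype)
    have hdvd : ¬ p ∣ Nat.card (Sylow l N) := fun h =>
      hpN (h.trans ((default : Sylow l N).card_dvd_index.trans (Subgroup.index_dvd_card _)))
    obtain ⟨L, hL⟩ := hpQ.nonempty_fixed_point_of_prime_not_dvd_card (Sylow l N) hdvd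
    exact ⟨L, fun q hq => hL ⟨q, hq⟩⟩
  -- The elements of `N` carrying `L` to another `Q`-fixed `L'` form a `Q`-stable coset of the
  -- normalizer of `L`, of order prime to `p`. So `Q` fixes one of them, and it must be `1` by
  -- `hcent`.
  have huniq : ∀ L' : Sylow l N, (∀ q ∈ Q, c q • L' = L') → L' = L := by
    intro L' hL'
    let S : SubMulAction Q N :=
      { carrier := {n | n • L = L'}
        smul_mem' := by
          intro q n hn
          change (c q n) • L = L'
          change n • L = L' at hn
          rw [Sylow.smul_def] at hn ⊢
          have h1 : MulAut.conj (c q n) = c q * MulAut.conj n * (c q)⁻¹ := by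
            ext x
            simp
          have h2 : (c q)⁻¹ • L = L := by rw [inv_smul_eq_iff, hL q q.2]
          rw [h1, mul_smul, mul_smul, h2, hn, hL' q q.2] }
    obtain ⟨n₀, hn₀⟩ := MulAction.exists_smul_eq N L L'
    have hcard : Nat.card S = Nat.card (MulAction.stabilizer N L) :=
      Nat.card_congr
        { toFun := fun s => ⟨n₀⁻¹ * s.1, by
            rw [MulAction.mem_stabilizer_iff, mul_smul, inv_smul_eq_iff, hn₀]; exact s.2⟩
          invFun := fun t => ⟨n₀ * t.1, by
            change (n₀ * t.1) • L = L'
            rw [mul_smul, t.2, hn₀]⟩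
          left_inv := fun s => by simp
          right_inv := fun t => by simp }
    have hpS : ¬ p ∣ Nat.card S := fun h =>
      hpN (h.trans (hcard ▸ Subgroup.card_subgroup_dvd_card _))
    obtain ⟨s, hs⟩ := hpQ.nonempty_fixed_point_of_prime_not_dvd_card S hpS
    have h1 : (s : N) = 1 := hcent s fun q hq => congrArg Subtype.val (hs ⟨q, hq⟩)
    have h2 : (s : N) • L = L' := s.2
    rw [← h2, h1, one_smul]
  -- As `A` normalizes `Q`, it permutes the `Q`-fixed Sylow subgroups, and there is only one.
  have hAL : ∀ a ∈ A, c a • L = L := by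
    intro a ha
    refine huniq _ fun q hq => ?_
    have h1 : c q * c a = c a * c (a⁻¹ * q * a) := by
      rw [← map_mul, ← map_mul]; congr 1; group
    have h2 : a⁻¹ * q * a ∈ Q := by simpa using hQconj a⁻¹ (inv_mem ha) q hq
    rw [← mul_smul, h1, mul_smul, hL _ h2]
  have hLbot : (L : Subgroup N) ≠ ⊥ := L.ne_bot_of_dvd_card hlN
  -- The stabilizer of `L` contains `A`. If it were equal to `A`, then `L`, which stabilizes itself,
  -- would lie in `N ⊓ A` and be trivial.
  have hLG : ∀ g : G, c g • L = L := by
    let actS : MulAction G (Sylow l N) := MulAction.compHom (Sylow l N) c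
    have hSt : A ≤ MulAction.stabilizer G L := hAL
    rcases hA.le_iff.mp hSt with h | h
    · exact fun g => (h ▸ Subgroup.mem_top g : g ∈ MulAction.stabilizer G L)
    · refine absurd ((Subgroup.eq_bot_iff_forall _).mpr fun x hx => ?_) hLbot
      have hxS : (x : G) ∈ MulAction.stabilizer G L := by
        change c (x : G) • L = L
        rw [hcN, ← Sylow.smul_def, Sylow.smul_eq_iff_mem_normalizer]
        exact Subgroup.le_normalizer hx
      rw [h] at hxS
      have : (x : G) ∈ N ⊓ A := ⟨x.2, hxS⟩
      rw [hNA, Subgroup.mem_bot] at this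
      exact Subtype.ext this
  let L' : Subgroup G := (L : Subgroup N).map N.subtype
  have hL'normal : L'.Normal := by
    refine ⟨?_⟩
    rintro _ ⟨x, hx, rfl⟩ g
    refine ⟨c g x, ?_, hc g x⟩
    have h1 := congrArg (fun P : Sylow l N => (P : Subgroup N)) (hLG g)
    change c g • (L : Subgroup N) = L at h1
    change c g x ∈ (L : Subgroup N)
    rw [← h1]
    exact Subgroup.smul_mem_pointwise_smul x (c g) _ hx
  have hL'bot : L' ≠ ⊥ := by
    rwa [Ne, Subgroup.map_eq_bot_iff_of_injective _ N.subtype_injective]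
  have hL'A : L' ⊔ A = ⊤ := by
    refine hA.2 _ (lt_of_le_of_ne le_sup_right fun h => hL'bot ?_)
    have : L' ≤ A := h ▸ le_sup_left
    exact le_bot_iff.mp (hNA ▸ le_inf (Subgroup.map_subtype_le _) this)
  -- From `L' ⊔ A = ⊤` and `N ⊓ A = ⊥`, the modular law forces `N = L`; so `N` is an `l`-group.
  have hLtop : (L : Subgroup N) = ⊤ := by
    refine eq_top_iff.mpr fun n _ => ?_
    obtain ⟨y, hy, a, ha, hya⟩ := Subgroup.mem_sup_of_normal_left.mp
      (hL'A ▸ Subgroup.mem_top (n : G))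
    obtain ⟨y, hy, rfl⟩ := hy
    have haN : a ∈ N ⊓ A := by
      refine ⟨?_, ha⟩
      have : a = (y : G)⁻¹ * n := by rw [← hya]; simp
      rw [this]
      exact N.mul_mem (N.inv_mem y.2) n.2
    rw [hNA, Subgroup.mem_bot] at haN
    rw [haN, mul_one] at hya
    have : y = n := Subtype.ext hya
    exact this ▸ hy
  have hlN' : IsPGroup l N := by
    have := L.isPGroup'
    rw [hLtop] at this
    exact this.of_equiv Subgroup.topEquiv
  have := hlN'.isNilpotent
  infer_instance

end Regular

/-! ### Chains of maximal subgroups -/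

section Chains

variable {G : Type*} [Group G]

/-- The largest subgroup of `B` that is a normal subgroup of `A`. -/
def relCore (A B : Subgroup G) : Subgroup G :=
  (B.subgroupOf A).normalCore.map A.subtype

lemma relCore_le_left (A B : Subgroup G) : relCore A B ≤ A := Subgroup.map_subtype_le _

lemma relCore_le_right (A B : Subgroup G) : relCore A B ≤ B := by
  rw [relCore, Subgroup.map_le_iff_le_comap]
  exact Subgroup.normalCore_le _

lemma le_normalizer_relCore (A B : Subgroup G) :
    A ≤ Subgroup.normalizer (relCore A B : Set G) := by
  have key : ∀ a ∈ A, ∀ x ∈ relCore A B, a * x * a⁻¹ ∈ relCore A B := by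
    rintro a ha _ ⟨x, hx, rfl⟩
    exact ⟨⟨a, ha⟩ * x * ⟨a, ha⟩⁻¹, (Subgroup.normalCore_normal _).conj_mem x hx ⟨a, ha⟩, rfl⟩
  intro a ha
  rw [Subgroup.mem_normalizer_iff]
  refine fun x => ⟨key a ha x, fun hx => ?_⟩
  simpa [mul_assoc] using key a⁻¹ (inv_mem ha) _ hx

lemma le_relCore {A B L : Subgroup G} (hA : L ≤ A) (hB : L ≤ B)
    (h : A ≤ Subgroup.normalizer (L : Set G)) : L ≤ relCore A B := by
  have h1 : (L.subgroupOf A).Normal := (Subgroup.normal_subgroupOf_iff_le_normalizer hA).mpr h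
  have h2 : L.subgroupOf A ≤ (B.subgroupOf A).normalCore :=
    Subgroup.normal_le_normalCore.mpr (Subgroup.comap_mono hB)
  have h3 := Subgroup.map_mono (f := A.subtype) h2
  rwa [Subgroup.map_subgroupOf_eq_of_le hA] at h3

/-- Modulo `C`, every normal subgroup of `A` is trivial or has a solvable quotient. -/
def ProperQuotientsSolvableMod (A C : Subgroup G) : Prop :=
  ∀ L : Subgroup G, L ≤ A → A ≤ Subgroup.normalizer (L : Set G) →
    L ≤ C ∨ solvableResidual A ≤ L ⊔ C

lemma ProperQuotientsSolvableMod.of_normal {C N : Subgroup G} [N.Normal]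
    (h : ProperQuotientsSolvableMod ⊤ C) : N ≤ C ∨ solvableResidual ⊤ ≤ N ⊔ C :=
  h N le_top (Subgroup.normalizer_eq_top_iff.mpr ‹_›).ge

/-- Dedekind's modular law. Subgroup lattices are not modular, but normality of `N` makes the join a
product set. The next lemma is the companion form, in which `V` rather than `N` lies in `Q`. -/
lemma sup_inf_le_of_normal_left {N V Q : Subgroup G} [N.Normal] (h : N ≤ Q) :
    (N ⊔ V) ⊓ Q ≤ N ⊔ (V ⊓ Q) := by
  rintro x ⟨hx, hxQ⟩
  obtain ⟨y, hy, z, hz, rfl⟩ := Subgroup.mem_sup_of_normal_left.mp hx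
  refine mul_mem (Subgroup.mem_sup_left hy) (Subgroup.mem_sup_right ⟨hz, ?_⟩)
  exact (Subgroup.mul_mem_cancel_left Q (h hy)).mp hxQ

lemma sup_inf_le_of_normal_right {N V Q : Subgroup G} [N.Normal] (h : V ≤ Q) :
    (N ⊔ V) ⊓ Q ≤ (N ⊓ Q) ⊔ V := by
  rintro x ⟨hx, hxQ⟩
  obtain ⟨y, hy, z, hz, rfl⟩ := Subgroup.mem_sup_of_normal_left.mp hx
  refine mul_mem (Subgroup.mem_sup_left ⟨hy, ?_⟩) (Subgroup.mem_sup_right hz)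
  exact (Subgroup.mul_mem_cancel_right Q (h hz)).mp hxQ

lemma commutator_le_inf_of_le_normalizer {U V : Subgroup G}
    (hU : U ≤ Subgroup.normalizer (V : Set G)) (hV : V ≤ Subgroup.normalizer (U : Set G)) :
    ⁅U, V⁆ ≤ U ⊓ V := by
  rw [Subgroup.commutator_le]
  intro a ha b hb
  rw [commutatorElement_def]
  refine ⟨?_, ?_⟩
  · have := (Subgroup.mem_normalizer_iff.mp (hV hb) a⁻¹).mp (inv_mem ha)
    have := U.mul_mem ha this
    simpa [mul_assoc] using this
  · have := (Subgroup.mem_normalizer_iff.mp (hU ha) b).mp hb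
    exact V.mul_mem this (inv_mem hb)

/-- In the quotient by `J` both sides become the commutator of the images of `U` and `V`. -/
lemma commutator_sup_le {J : Subgroup G} [J.Normal] (U V : Subgroup G) :
    ⁅J ⊔ U, J ⊔ V⁆ ≤ J ⊔ ⁅U, V⁆ := by
  have hJ : J.map (QuotientGroup.mk' J) = ⊥ := by
    rw [Subgroup.map_eq_bot_iff, QuotientGroup.ker_mk']
  rw [← QuotientGroup.comap_map_mk' J ⁅U, V⁆, ← Subgroup.map_le_iff_le_comap,
    Subgroup.map_commutator, Subgroup.map_commutator, Subgroup.map_sup, Subgroup.map_sup, hJ,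
    bot_sup_eq, bot_sup_eq]

lemma inf_le_normalizer {L U V : Subgroup G} (hU : L ≤ Subgroup.normalizer (U : Set G))
    (hV : L ≤ Subgroup.normalizer (V : Set G)) :
    L ≤ Subgroup.normalizer ((U ⊓ V : Subgroup G) : Set G) := by
  intro g hg
  rw [Subgroup.mem_normalizer_iff]
  intro x
  rw [Subgroup.mem_inf, Subgroup.mem_inf, Subgroup.mem_normalizer_iff.mp (hU hg),
    Subgroup.mem_normalizer_iff.mp (hV hg)]

lemma le_normalizer_of_normal {L N : Subgroup G} [N.Normal] :
    L ≤ Subgroup.normalizer (N : Set G) := by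
  rw [Subgroup.normalizer_eq_top_iff.mpr ‹_›]; exact le_top

lemma le_normalizer_normalCore_sup_inf {L Q C : Subgroup G}
    (h : ∀ a ∈ L, ∀ x ∈ Q, x ∈ C → a * x * a⁻¹ ∈ C) [Q.Normal] :
    L ≤ Subgroup.normalizer ((Q ⊓ C : Subgroup G) : Set G) := by
  intro a ha
  rw [Subgroup.mem_normalizer_iff]
  refine fun x => ⟨fun hx => ⟨‹Q.Normal›.conj_mem _ hx.1 a, h a ha x hx.1 hx.2⟩, fun hx => ?_⟩
  have h1 := ‹Q.Normal›.conj_mem _ hx.1 a⁻¹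
  have h2 := h a⁻¹ (inv_mem ha) _ hx.1 hx.2
  exact ⟨by simpa [mul_assoc] using h1, by simpa [mul_assoc] using h2⟩

open Pointwise in
lemma iInf_conj_smul_le_normalCore {B C : Subgroup G} (hCB : C ≤ B) :
    ⨅ g : G, MulAut.conj g • C ≤ B.normalCore := by
  intro x hx b
  rw [Subgroup.mem_iInf] at hx
  have := hx b⁻¹
  rw [Subgroup.mem_pointwise_smul_iff_inv_smul_mem, ← map_inv, inv_inv] at this
  exact hCB (by simpa using this)

open Pointwise in
/-- If a perfect subgroup lies in `J ⊔ C` for all conjugates `C` of a normal subgroup of `A`,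
then it lies in `J ⊔ D`, where `D` is the intersection of the conjugates. -/
lemma le_sup_normalCore_of_perfect [Finite G] {A B C J X : Subgroup G} [J.Normal] [X.Normal]
    (hCB : C ≤ B) (hAC : A ≤ Subgroup.normalizer (C : Set G))
    (hJ : J ≤ A.normalCore) (hX : ⁅X, X⁆ = X) (hXA : X ≤ A.normalCore) (h : X ≤ J ⊔ C) :
    X ≤ J ⊔ B.normalCore := by
  classical
  have := Fintype.ofFinite G
  -- An element of the core of `A` stays in `A` after conjugation, so it normalizes every conjugate
  -- of `C`.
  have hnorm : ∀ g : G, A.normalCore ≤ Subgroup.normalizer ((MulAut.conj g • C : Subgroup G) : Set G) := by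
    intro g a ha
    have ha' : g⁻¹ * a * g ∈ Subgroup.normalizer (C : Set G) :=
      hAC (by simpa using ha g⁻¹)
    rw [Subgroup.mem_normalizer_iff] at ha' ⊢
    intro x
    rw [Subgroup.mem_pointwise_smul_iff_inv_smul_mem, Subgroup.mem_pointwise_smul_iff_inv_smul_mem,
      ← map_inv, MulAut.smul_def, MulAut.smul_def, MulAut.conj_apply, MulAut.conj_apply, ha']
    simp [mul_assoc]
  -- Both `J` and `X` are normal, so the hypothesis holds for each conjugate of `C`; the modular law
  -- then cuts this conjugate down to the core of `A`.
  have hconj : ∀ g : G, X ≤ J ⊔ (A.normalCore ⊓ MulAut.conj g • C) := by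
    intro g
    have h1 : X ≤ J ⊔ MulAut.conj g • C := by
      have h2 := Subgroup.pointwise_smul_le_pointwise_smul_iff (a := MulAut.conj g) |>.mpr h
      rwa [Subgroup.smul_sup, Subgroup.Normal.conj_smul_eq_self g J, Subgroup.Normal.conj_smul_eq_self g X] at h2
    rw [inf_comm]
    exact (le_inf h1 hXA).trans (sup_inf_le_of_normal_left hJ)
  -- Conjugates are intersected one at a time. The two subgroups being intersected normalize each
  -- other, so their commutator lies in their intersection, and `X` equals its own commutator.
  have key : ∀ s : Finset G, X ≤ J ⊔ (A.normalCore ⊓ s.inf fun g => MulAut.conj g • C) ∧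
      A.normalCore ≤ Subgroup.normalizer
        ((A.normalCore ⊓ s.inf fun g => MulAut.conj g • C : Subgroup G) : Set G) := by
    intro s
    induction s using Finset.induction_on with
    | empty =>
      rw [Finset.inf_empty, inf_top_eq]
      exact ⟨hXA.trans le_sup_right, le_normalizer_of_normal⟩
    | insert g s _ ih =>
      have heq : (A.normalCore ⊓ (insert g s).inf fun g => MulAut.conj g • C) =
          (A.normalCore ⊓ MulAut.conj g • C) ⊓ (A.normalCore ⊓ s.inf fun g => MulAut.conj g • C) := by
        rw [Finset.inf_insert, ← inf_inf_distrib_left]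
      have hn := inf_le_normalizer (le_normalizer_of_normal (L := A.normalCore)
        (N := A.normalCore)) (hnorm g)
      rw [heq]
      refine ⟨?_, inf_le_normalizer hn ih.2⟩
      calc X = ⁅X, X⁆ := hX.symm
        _ ≤ _ := Subgroup.commutator_mono (hconj g) ih.1
        _ ≤ _ := commutator_sup_le _ _
        _ ≤ _ := sup_le_sup_left (commutator_le_inf_of_le_normalizer
          (inf_le_left.trans ih.2) (inf_le_left.trans hn)) _
  refine (key Finset.univ).1.trans (sup_le_sup_left (inf_le_right.trans ?_) _)
  rw [Finset.inf_univ_eq_iInf]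
  exact iInf_conj_smul_le_normalCore hCB

/-- In the quotient of `A` by `relCore A B`, the image of `B` is maximal with trivial core, solvable
by `hB`, and meets the image of `X` trivially by `hXB`. So `isSolvable_of_inf_eq_bot` applies to the
image of `X`. -/
lemma solvableResidual_le_relCore_of_regular [Finite G] {A B X : Subgroup G} (hAB : B ⋖ A)
    (hXA : X ≤ A) (hX : A ≤ Subgroup.normalizer (X : Set G)) (hXB : X ⊓ B ≤ relCore A B)
    (hB : solvableResidual B ≤ relCore A B) : solvableResidual X ≤ relCore A B := by
  obtain ⟨B', hB'⟩ : ∃ B', B' = B.subgroupOf A := ⟨_, rfl⟩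
  obtain ⟨X', hX'⟩ : ∃ X', X' = X.subgroupOf A := ⟨_, rfl⟩
  have hBmap : B'.map A.subtype = B := hB' ▸ Subgroup.map_subgroupOf_eq_of_le hAB.le
  have hXmap : X'.map A.subtype = X := hX' ▸ Subgroup.map_subgroupOf_eq_of_le hXA
  have hinj := A.subtype_injective
  have hcore : relCore A B = B'.normalCore.map A.subtype := by rw [hB']; rfl
  obtain ⟨C, hC⟩ : ∃ C, C = B'.normalCore := ⟨_, rfl⟩
  have hCn : C.Normal := hC ▸ Subgroup.normalCore_normal _
  have hCB : C ≤ B' := hC ▸ Subgroup.normalCore_le _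
  rw [← hC] at hcore
  have hX'n : X'.Normal := hX' ▸ (Subgroup.normal_subgroupOf_iff_le_normalizer hXA).mpr hX
  have hcoatom : IsCoatom B' := by
    refine ⟨fun h => hAB.ne ?_, fun D hD => ?_⟩
    · rw [← hBmap, h, ← MonoidHom.range_eq_map, Subgroup.range_subtype]
    · have h1 : B < D.map A.subtype := by
        rw [← hBmap]; exact Subgroup.map_lt_map_iff_of_injective hinj |>.mpr hD
      have h2 : D.map A.subtype = A := by
        by_contra hne
        exact hAB.2 h1 (lt_of_le_of_ne (Subgroup.map_subtype_le D) hne)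
      refine Subgroup.map_injective hinj ?_
      rw [h2, ← MonoidHom.range_eq_map, Subgroup.range_subtype]
  have hcomap : ∀ D : Subgroup A, C ≤ D →
      (D.map (QuotientGroup.mk' C)).comap (QuotientGroup.mk' C) = D := fun D hD => by
    rw [QuotientGroup.comap_map_mk', sup_eq_right.mpr hD]
  have hmap : ∀ D : Subgroup (A ⧸ C),
      (D.comap (QuotientGroup.mk' C)).map (QuotientGroup.mk' C) = D := fun D =>
    Subgroup.map_comap_eq_self_of_surjective (QuotientGroup.mk'_surjective C) D
  have hNn : (X'.map (QuotientGroup.mk' C)).Normal :=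
    hX'n.map _ (QuotientGroup.mk'_surjective C)
  have hker : (QuotientGroup.mk' C).ker = C := QuotientGroup.ker_mk' C
  have hsol : Group.IsSolvable (X'.map (QuotientGroup.mk' C)) := by
    apply isSolvable_of_inf_eq_bot (A := B'.map (QuotientGroup.mk' C))
    · refine ⟨fun h => hcoatom.1 ?_, fun D hD => ?_⟩
      · rw [← hcomap B' hCB, h, Subgroup.comap_top]
      · have h1 : B' < D.comap (QuotientGroup.mk' C) := by
          refine lt_of_le_of_ne (Subgroup.map_le_iff_le_comap.mp hD.le) fun h => hD.ne ?_
          rw [h, hmap]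
        rw [← hmap D, hcoatom.2 _ h1, Subgroup.map_top_of_surjective _
          (QuotientGroup.mk'_surjective C)]
    · rw [← hmap (Subgroup.normalCore _), Subgroup.map_eq_bot_iff, hker]
      refine le_of_le_of_eq (Subgroup.normal_le_normalCore.mpr ?_) hC.symm
      exact (Subgroup.comap_mono (Subgroup.normalCore_le _)).trans (hcomap B' hCB).le
    · rw [isSolvable_map_iff, hker, ← Subgroup.map_le_map_iff_of_injective hinj,
        map_solvableResidual, hBmap, ← hcore]
      exact hB
    · rw [← hmap (_ ⊓ _), Subgroup.map_eq_bot_iff, hker, Subgroup.comap_inf, hcomap B' hCB,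
        QuotientGroup.comap_map_mk']
      refine (sup_inf_le_of_normal_left hCB).trans (sup_le le_rfl ?_)
      rw [← Subgroup.map_le_map_iff_of_injective hinj, ← hcore, Subgroup.map_inf _ _ _ hinj, hBmap,
        hXmap]
      exact hXB
  rwa [isSolvable_map_iff, hker, ← Subgroup.map_le_map_iff_of_injective hinj,
    map_solvableResidual, hXmap, ← hcore] at hsol

/-- The key step: let `B` be a maximal subgroup of `A`, and let `K` be a normal subgroup of `G`
with nonsolvable quotient all of whose proper quotients are solvable. If `K` contains the core of
`B` but not the core of `A`, then the image of `B` in `G ⧸ K` has trivial core, and the image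
of `A` has a nontrivial one. -/
lemma inf_normalCore_le_and_not_le_sup [Finite G] {A B K : Subgroup G} [K.Normal]
    (hK : ProperQuotientsSolvableMod ⊤ K) (hKns : ¬ solvableResidual ⊤ ≤ K) (hAB : B ⋖ A)
    (hΓ : ProperQuotientsSolvableMod A (relCore A B)) (hB : B.normalCore ≤ K)
    (hA : ¬ A.normalCore ≤ K) :
    K ⊓ A.normalCore ≤ B.normalCore ∧ ¬ solvableResidual ⊤ ≤ B ⊔ K := by
  obtain ⟨Q, hQ⟩ : ∃ Q, Q = A.normalCore := ⟨_, rfl⟩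
  have hQn : Q.Normal := hQ ▸ Subgroup.normalCore_normal _
  have hQA : Q ≤ A := hQ ▸ Subgroup.normalCore_le _
  have hPQ : solvableResidual ⊤ ≤ Q ⊔ K := (hK.of_normal (N := Q)).resolve_left (hQ ▸ hA)
  -- The subgroup called `X` in the overview is `solvableResidual Q`: it still covers the residual
  -- of `G` modulo `K`, and it is perfect and normal in `G`.
  have hPX : solvableResidual ⊤ ≤ solvableResidual Q ⊔ K :=
    solvableResidual_le_sup (solvableResidual_perfect _) hPQ
  have hXK : ¬ solvableResidual Q ≤ K := fun h => hKns (hPX.trans (sup_le h le_rfl))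
  have hXQ := solvableResidual_le Q
  have hX := solvableResidual_perfect Q
  have hXB : ¬ solvableResidual Q ≤ B := fun h =>
    hXK ((Subgroup.normal_le_normalCore.mpr h).trans hB)
  -- Otherwise `K ⊓ Q` covers the residual of `A` modulo `relCore A B`, and passing to the
  -- intersection of conjugates puts `solvableResidual Q` inside `(K ⊓ Q) ⊔ B.normalCore ≤ K`.
  have hJ : K ⊓ Q ≤ B.normalCore := by
    by_contra hJ
    have hJC : ¬ K ⊓ Q ≤ relCore A B := fun h =>
      hJ (Subgroup.normal_le_normalCore.mpr (h.trans (relCore_le_right A B)))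
    have h1 := (hΓ (K ⊓ Q) (inf_le_right.trans hQA) le_normalizer_of_normal).resolve_left hJC
    have h2 : solvableResidual Q ≤ K ⊓ Q ⊔ B.normalCore :=
      le_sup_normalCore_of_perfect (relCore_le_right A B) (le_normalizer_relCore A B)
        (inf_le_right.trans hQ.le) hX (hXQ.trans hQ.le) ((solvableResidual_mono hQA).trans h1)
    exact hXK (h2.trans (sup_le inf_le_left hB))
  refine ⟨hQ ▸ hJ, fun hP => hXB ?_⟩
  -- Commutators of `K` with `solvableResidual Q` lie in `K ⊓ Q`, hence in `B` by `hJ`; this is why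
  -- `K` normalizes the intersection with `B`.
  have hBK : B ⊔ K ≤ Subgroup.normalizer ((solvableResidual Q ⊓ B : Subgroup G) : Set G) := by
    refine sup_le (inf_le_normalizer le_normalizer_of_normal Subgroup.le_normalizer) ?_
    refine le_normalizer_normalCore_sup_inf fun b hb x hxQ hxB => ?_
    have h1 : b * x * b⁻¹ * x⁻¹ ∈ K ⊓ Q := by
      refine ⟨?_, ?_⟩
      · rw [mul_assoc, mul_assoc, ← mul_assoc x]
        exact K.mul_mem hb (‹K.Normal›.conj_mem _ (inv_mem hb) x)
      · exact Q.mul_mem (hQn.conj_mem _ (hXQ hxQ) b) (inv_mem (hXQ hxQ))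
    have h2 := B.mul_mem (Subgroup.normalCore_le B (hJ h1)) hxB
    simpa using h2
  have hXA : solvableResidual Q ⊔ B = A := by
    by_contra hne
    refine hAB.2 (lt_of_le_of_ne le_sup_right fun h => hXB ?_)
      (lt_of_le_of_ne (sup_le (hXQ.trans hQA) hAB.le) hne)
    rw [h]; exact le_sup_left
  -- Under the assumption `hP`, `solvableResidual Q` lies in `B ⊔ K`, so it normalizes the
  -- intersection; together with `B` it generates `A`.
  have hXBC : solvableResidual Q ⊓ B ≤ relCore A B := by
    refine le_relCore (inf_le_right.trans hAB.le) inf_le_right ?_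
    rw [← hXA]
    exact sup_le ((solvableResidual_mono le_top).trans (hP.trans hBK)) (le_sup_left.trans hBK)
  have hRA : solvableResidual A ≤ solvableResidual Q ⊔ relCore A B :=
    (hΓ _ (hXQ.trans hQA) le_normalizer_of_normal).resolve_left fun h =>
      hXB (h.trans (relCore_le_right A B))
  -- `B` is solvable modulo `relCore A B`: by `hRA` its residual lies in `solvableResidual Q ⊔
  -- relCore A B`, whose part in `B` is in `relCore A B`.
  have hRB : solvableResidual B ≤ relCore A B :=
    calc solvableResidual B ≤ (solvableResidual Q ⊔ relCore A B) ⊓ B :=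
          le_inf ((solvableResidual_mono hAB.le).trans hRA) (solvableResidual_le B)
      _ ≤ solvableResidual Q ⊓ B ⊔ relCore A B :=
          sup_inf_le_of_normal_right (relCore_le_right A B)
      _ ≤ relCore A B := sup_le hXBC le_rfl
  have h := solvableResidual_le_relCore_of_regular hAB (hXQ.trans hQA) le_normalizer_of_normal
    hXBC hRB
  exact (le_solvableResidual_of_perfect hX le_rfl).trans (h.trans (relCore_le_right A B))

end Chains

/-! ### Solvable quotients in terms of residuals -/

section Quotients

variable {G : Type*} [Group G] [Finite G]

lemma ProperQuotientsSolvable.of_equiv {G G' : Type*} [Group G] [Group G'] (e : G ≃* G')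
    (h : ProperQuotientsSolvable G) : ProperQuotientsSolvable G' := by
  intro N _ hN
  have hne : N.comap e.toMonoidHom ≠ ⊥ := by
    intro h0
    refine hN ((Subgroup.eq_bot_iff_forall _).mpr fun x hx => ?_)
    have : e.symm x ∈ N.comap e.toMonoidHom := by
      change e (e.symm x) ∈ N
      simpa using hx
    rw [h0, Subgroup.mem_bot] at this
    simpa using this
  have := h (N.comap e.toMonoidHom) hne
  exact Group.isSolvable_of_surjective
    (f := QuotientGroup.map (N.comap e.toMonoidHom) N e.toMonoidHom le_rfl)
    (QuotientGroup.map_surjective_of_surjective _ _ _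
      ((QuotientGroup.mk'_surjective N).comp e.surjective) _)

/-- In a finite group each nontrivial normal subgroup contains a minimal one, which is `N` by
uniqueness. This is the only consequence of the hypothesis on the groups of the steps that the proof
needs. -/
lemma HasUniqueMinimalNormalWithSolvableQuotient.properQuotientsSolvable
    (h : HasUniqueMinimalNormalWithSolvableQuotient G) : ProperQuotientsSolvable G := by
  obtain ⟨N, hN, -, huniq, hsol⟩ := h
  intro M hM hMbot
  obtain ⟨L, hLM, hL⟩ := exists_minimal_le_of_wellFoundedLT
    (fun M : Subgroup G => M.Normal ∧ M ≠ ⊥) M ⟨hM, hMbot⟩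
  rw [isSolvable_quotient_iff] at hsol ⊢
  exact hsol.trans (huniq L hL ▸ hLM)

lemma ProperQuotientsSolvable.le_or_le_sup {K N : Subgroup G} [K.Normal] [N.Normal]
    (h : ProperQuotientsSolvable (G ⧸ K)) : N ≤ K ∨ solvableResidual ⊤ ≤ N ⊔ K := by
  have hn : (N.map (QuotientGroup.mk' K)).Normal :=
    Subgroup.Normal.map ‹_› _ (QuotientGroup.mk'_surjective K)
  by_cases hbot : N.map (QuotientGroup.mk' K) = ⊥
  · left
    rwa [Subgroup.map_eq_bot_iff, QuotientGroup.ker_mk'] at hbot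
  · right
    have := h _ hbot
    rw [isSolvable_quotient_iff,
      ← Subgroup.map_top_of_surjective (QuotientGroup.mk' K) (QuotientGroup.mk'_surjective K),
      ← map_solvableResidual, Subgroup.map_le_iff_le_comap, QuotientGroup.comap_map_mk'] at this
    rwa [sup_comm]

lemma ProperQuotientsSolvable.mod_top {K : Subgroup G} [K.Normal]
    (h : ProperQuotientsSolvable (G ⧸ K)) : ProperQuotientsSolvableMod ⊤ K := by
  intro L _ hL
  have : L.Normal := Subgroup.normalizer_eq_top_iff.mp (top_le_iff.mp hL)
  exact h.le_or_le_sup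

lemma ProperQuotientsSolvable.mod_relCore {A B : Subgroup G}
    (h : ProperQuotientsSolvable (A ⧸ (B.subgroupOf A).normalCore)) :
    ProperQuotientsSolvableMod A (relCore A B) := by
  intro L hLA hL
  have : (L.subgroupOf A).Normal := (Subgroup.normal_subgroupOf_iff_le_normalizer hLA).mpr hL
  refine (h.le_or_le_sup (N := L.subgroupOf A)).imp (fun h1 => ?_) fun h1 => ?_
  · have := Subgroup.map_mono (f := A.subtype) h1
    rwa [Subgroup.map_subgroupOf_eq_of_le hLA] at this
  · have := Subgroup.map_mono (f := A.subtype) h1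
    rwa [map_solvableResidual, Subgroup.map_sup, Subgroup.map_subgroupOf_eq_of_le hLA,
      ← MonoidHom.range_eq_map, Subgroup.range_subtype] at this

lemma isSolvable_quotient_normalCore_iff {A B : Subgroup G} :
    Group.IsSolvable (A ⧸ (B.subgroupOf A).normalCore) ↔ solvableResidual A ≤ relCore A B := by
  rw [isSolvable_quotient_iff, ← Subgroup.map_le_map_iff_of_injective A.subtype_injective,
    map_solvableResidual, ← MonoidHom.range_eq_map, Subgroup.range_subtype]
  rfl

end Quotients

/-! ### One step of the chain modulo a normal subgroup -/

section Steps

variable {G : Type*} [Group G] {A B K : Subgroup G}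

/-- A group `L` between the two is `(A ⊓ L) ⊔ K` by the modular law, and `A ⊓ L` lies between `B`
and `A`. -/
lemma sup_covBy_sup [K.Normal] (hAB : B ⋖ A) (hne : B ⊔ K ≠ A ⊔ K) : B ⊔ K ⋖ A ⊔ K := by
  refine ⟨lt_of_le_of_ne (sup_le_sup_right hAB.le K) hne, fun L hBL hLA => ?_⟩
  have hKL : K ≤ L := le_sup_right.trans hBL.le
  have hL : (A ⊔ K) ⊓ L ≤ K ⊔ (A ⊓ L) := by
    rw [sup_comm A K]; exact sup_inf_le_of_normal_left hKL
  rw [inf_eq_right.mpr hLA.le] at hL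
  have hB : B ≤ A ⊓ L := le_inf hAB.le (le_sup_left.trans hBL.le)
  rcases hB.eq_or_lt with h | h
  · exact hBL.not_ge (hL.trans (by rw [← h, sup_comm]))
  · have : A ⊓ L = A := by
      by_contra h'
      exact hAB.2 h (lt_of_le_of_ne inf_le_left h')
    exact hLA.not_ge (sup_le (this ▸ inf_le_right) hKL)

lemma sup_inf_eq_of_covBy (hAB : B ⋖ A) (h : ¬ A ≤ B ⊔ K) : (B ⊔ K) ⊓ A = B := by
  by_contra hne
  have h1 : B < (B ⊔ K) ⊓ A := lt_of_le_of_ne (le_inf le_sup_left hAB.le) (Ne.symm hne)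
  refine hAB.2 h1 (lt_of_le_of_ne inf_le_right fun h2 => h ?_)
  exact inf_eq_right.mp h2

/-- A core not inside `K` would cover the residual modulo `K`, and `B ⊔ K` would contain it. This
gives `f'` the same Galois closure as `h`. -/
lemma normalCore_sup_eq [K.Normal] (hK : ProperQuotientsSolvableMod ⊤ K)
    (hB : ¬ solvableResidual ⊤ ≤ B ⊔ K) : (B ⊔ K).normalCore = K := by
  refine le_antisymm ?_ (Subgroup.normal_le_normalCore.mpr le_sup_right)
  have := Subgroup.normalCore_normal (B ⊔ K)
  refine (hK.of_normal (N := (B ⊔ K).normalCore)).resolve_right fun h => hB (h.trans ?_)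
  exact sup_le (Subgroup.normalCore_le _) le_sup_right

lemma not_le_sup_of_sup_eq_top (hA : A ⊔ K = ⊤) (hB : B ⊔ K ≠ ⊤) : ¬ A ≤ B ⊔ K := fun h =>
  hB (top_le_iff.mp (hA ▸ sup_le h le_sup_right))

/-- If `B ⊔ K` were proper, its intersection with `A` would be `B`. Then the residual of `A` would
lie in `B` and, being normal in `A`, in `relCore A B`: the step would be solvable. -/
lemma sup_eq_top_of_residual_le [Finite G] (hAB : B ⋖ A) (hΓ : ¬ solvableResidual A ≤ relCore A B)
    (hA : A ⊔ K = ⊤) (hB : solvableResidual ⊤ ≤ B ⊔ K) : B ⊔ K = ⊤ := by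
  by_contra hne
  refine hΓ (le_relCore (solvableResidual_le A) ?_
    (le_normalizer_solvableResidual Subgroup.le_normalizer))
  rw [← sup_inf_eq_of_covBy hAB (not_le_sup_of_sup_eq_top hA hne)]
  exact le_inf ((solvableResidual_mono le_top).trans hB) (solvableResidual_le A)

/-- The join of `relCore A B` with `K` is normalized by `A` and `K`, so it is normal in `G`; lying
in `B ⊔ K`, it cannot cover the residual, so it is inside `K`. Conversely, `A ⊓ K` is normal in `A`
and lies in `(B ⊔ K) ⊓ A = B`. -/
lemma relCore_eq_inf [K.Normal] (hK : ProperQuotientsSolvableMod ⊤ K) (hAB : B ⋖ A) (hA : A ⊔ K = ⊤)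
    (hB : ¬ solvableResidual ⊤ ≤ B ⊔ K) : relCore A B = A ⊓ K := by
  apply le_antisymm
  · refine le_inf (relCore_le_left A B) ?_
    have hn : (relCore A B ⊔ K).Normal := by
      rw [← Subgroup.normalizer_eq_top_iff, ← top_le_iff, ← hA]
      refine sup_le ?_ (le_sup_right.trans Subgroup.le_normalizer)
      have key : ∀ a ∈ A, ∀ x ∈ relCore A B ⊔ K, a * x * a⁻¹ ∈ relCore A B ⊔ K := by
        intro a ha x hx
        obtain ⟨y, hy, z, hz, rfl⟩ := Subgroup.mem_sup_of_normal_right.mp hx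
        have h1 := (Subgroup.mem_normalizer_iff.mp (le_normalizer_relCore A B ha) y).mp hy
        have h2 := ‹K.Normal›.conj_mem z hz a
        have := mul_mem (Subgroup.mem_sup_left (T := K) h1)
          (Subgroup.mem_sup_right (S := relCore A B) h2)
        simpa [mul_assoc] using this
      intro a ha
      rw [Subgroup.mem_normalizer_iff]
      refine fun x => ⟨key a ha x, fun hx => ?_⟩
      simpa [mul_assoc] using key a⁻¹ (inv_mem ha) _ hx
    refine le_sup_left.trans ((hK.of_normal (N := relCore A B ⊔ K)).resolve_right fun h => hB ?_)
    exact h.trans (sup_le (sup_le_sup_right (relCore_le_right A B) K) le_sup_right)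
  · refine le_relCore inf_le_left ?_
      (inf_le_normalizer Subgroup.le_normalizer le_normalizer_of_normal)
    rw [← sup_inf_eq_of_covBy hAB
      (not_le_sup_of_sup_eq_top hA fun h => hB (le_top.trans h.ge)), inf_comm]
    exact inf_le_inf_right A le_sup_right

/-- A normal subgroup `K` as in `inf_normalCore_le_and_not_le_sup` is determined by the step
`B ⋖ A`. -/
lemma le_of_inf_normalCore_le [Finite G] [K.Normal] {K' : Subgroup G} [K'.Normal]
    (hK : ProperQuotientsSolvableMod ⊤ K)
    (hKns : ¬ solvableResidual ⊤ ≤ K) (hB : B.normalCore ≤ K) (hA : ¬ A.normalCore ≤ K)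
    (hinf : K' ⊓ A.normalCore ≤ B.normalCore) : K' ≤ K := by
  have hAn := Subgroup.normalCore_normal A
  refine (hK.of_normal (N := K')).resolve_right fun h => hKns ?_
  have h1 := (hK.of_normal (N := A.normalCore)).resolve_left hA
  -- Modulo `K`, both `K'` and the core of `A` cover the perfect residual, but their commutator lies
  -- in their intersection, hence in `K`.
  calc solvableResidual ⊤ = ⁅solvableResidual ⊤, solvableResidual ⊤⁆ :=
        (solvableResidual_perfect _).symm
    _ ≤ ⁅K ⊔ K', K ⊔ A.normalCore⁆ := by
        rw [sup_comm K, sup_comm K]; exact Subgroup.commutator_mono h h1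
    _ ≤ K ⊔ ⁅K', A.normalCore⁆ := commutator_sup_le _ _
    _ ≤ K := sup_le le_rfl ((Subgroup.commutator_le_inf _ _).trans (hinf.trans hB))

/-- The quotient of `A` by the core of `B` is `G ⧸ K`. -/
lemma nonempty_quotient_mulEquiv [K.Normal] (h : relCore A B = A ⊓ K) (hA : A ⊔ K = ⊤) :
    Nonempty (G ⧸ K ≃* A ⧸ (B.subgroupOf A).normalCore) := by
  have h1 : (B.subgroupOf A).normalCore = ((QuotientGroup.mk' K).comp A.subtype).ker := by
    apply Subgroup.map_injective A.subtype_injective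
    rw [← MonoidHom.comap_ker, QuotientGroup.ker_mk']
    refine h.trans ?_
    rw [inf_comm]
    exact (Subgroup.subgroupOf_map_subtype K A).symm
  have h2 : Function.Surjective ((QuotientGroup.mk' K).comp A.subtype) := by
    intro x
    obtain ⟨g, rfl⟩ := QuotientGroup.mk'_surjective K x
    obtain ⟨a, ha, k, hk, rfl⟩ := Subgroup.mem_sup_of_normal_right.mp (hA ▸ Subgroup.mem_top g)
    refine ⟨⟨a, ha⟩, ?_⟩
    change QuotientGroup.mk' K a = QuotientGroup.mk' K (a * k)
    rw [map_mul, show QuotientGroup.mk' K k = 1 from (QuotientGroup.eq_one_iff k).mpr hk, mul_one]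
  exact ⟨((QuotientGroup.quotientMulEquivOfEq h1).trans
    (QuotientGroup.quotientKerEquivOfSurjective _ h2)).symm⟩

lemma exists_injective_quotient_prod {D E K : Subgroup G} [D.Normal] [E.Normal] [K.Normal]
    (hDE : D ≤ E) (hDK : D ≤ K) (h : K ⊓ E ≤ D) :
    ∃ φ : G ⧸ D →* (G ⧸ E) × (G ⧸ K), Function.Injective φ := by
  refine ⟨(QuotientGroup.map D E (MonoidHom.id G) hDE).prod
    (QuotientGroup.map D K (MonoidHom.id G) hDK), ?_⟩
  rw [injective_iff_map_eq_one]
  intro x hx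
  obtain ⟨g, rfl⟩ := QuotientGroup.mk'_surjective D x
  rw [Prod.ext_iff] at hx
  exact (QuotientGroup.eq_one_iff g).mpr (h ⟨(QuotientGroup.eq_one_iff g).mp hx.2,
    (QuotientGroup.eq_one_iff g).mp hx.1⟩)

end Steps

/-! ### Locating the step at which the normal subgroup appears -/

section Tower

variable {G : Type*} [Group G] [Finite G] {r : ℕ} {H : Fin (r + 1) → Subgroup G}
  {K : Subgroup G}

lemma Fin.exists_castSucc_and_not_succ {r : ℕ} {p : Fin (r + 1) → Prop} (h0 : p 0)
    {m : Fin (r + 1)} (hm : ¬ p m) : ∃ i : Fin r, p i.castSucc ∧ ¬ p i.succ := by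
  by_contra! h
  exact hm (Fin.induction (motive := p) h0 h m)

/-- The core of `H i` is not in `K` for `i = 0` and is in `K` at the end. Where it falls into `K`,
the key step shows that `H i.succ ⊔ K` does not contain the residual; since `H 0 ⊔ K` does, the
containment fails for the first time at some step. -/
lemma exists_residual_le_sup_and_not [K.Normal] (h0 : H 0 = ⊤) (hH : ∀ i : Fin r, H i.succ ⋖ H i.castSucc)
    (hΓ : ∀ i : Fin r, ProperQuotientsSolvableMod (H i.castSucc)
      (relCore (H i.castSucc) (H i.succ)))
    (hK : ProperQuotientsSolvableMod ⊤ K) (hKns : ¬ solvableResidual ⊤ ≤ K)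
    (hlast : (H (Fin.last r)).normalCore ≤ K) :
    ∃ i : Fin r, solvableResidual ⊤ ≤ H i.castSucc ⊔ K ∧ ¬ solvableResidual ⊤ ≤ H i.succ ⊔ K := by
  have htop : ¬ (H 0).normalCore ≤ K := by
    intro h
    refine hKns (le_top.trans (le_trans ?_ h))
    rw [h0]; exact (Subgroup.normalCore_eq_self _).ge
  obtain ⟨i, hi, hi'⟩ := Fin.exists_castSucc_and_not_succ (p := fun i => ¬ (H i).normalCore ≤ K)
    htop (not_not.mpr hlast)
  refine Fin.exists_castSucc_and_not_succ (p := fun i => solvableResidual ⊤ ≤ H i ⊔ K)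
    (by rw [h0, top_sup_eq]; exact le_top) (m := i.succ) ?_
  exact (inf_normalCore_le_and_not_le_sup hK hKns (hH i) (hΓ i) (not_not.mp hi') hi).2

lemma sup_eq_top_of_residual_le_sup (h0 : H 0 = ⊤) (hH : ∀ i : Fin r, H i.succ ⋖ H i.castSucc)
    (hΓ : ∀ i : Fin r, ¬ solvableResidual (H i.castSucc) ≤ relCore (H i.castSucc) (H i.succ))
    (i : Fin (r + 1)) (h : solvableResidual ⊤ ≤ H i ⊔ K) : H i ⊔ K = ⊤ := by
  induction i using Fin.induction with
  | zero => rw [h0, top_sup_eq]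
  | succ i ih =>
    exact sup_eq_top_of_residual_le (hH i) (hΓ i)
      (ih (h.trans (sup_le_sup_right (hH i).le K))) h

end Tower

/-! ### Local structure of curves -/

section Schemes

lemma AlgebraicGeometry.exists_nonempty_isAffineOpen (X : Scheme.{u}) (x : X) :
    ∃ U : X.Opens, IsAffineOpen U ∧ x ∈ U := by
  obtain ⟨_, ⟨U, hU, rfl⟩, hx, -⟩ :=
    X.isBasis_affineOpens.exists_subset_of_mem_open (Set.mem_univ x) isOpen_univ
  exact ⟨U, hU, hx⟩

/-- An integral scheme with integrally closed rings of sections is its own normalization in its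
function field. -/
lemma AlgebraicGeometry.isIso_fromNormalization_fromSpecStalk (X : Scheme.{u}) [IsIntegral X]
    [QuasiCompact (X.fromSpecStalk (genericPoint X))]
    [QuasiSeparated (X.fromSpecStalk (genericPoint X))]
    (h : ∀ U : X.Opens, IsAffineOpen U → Nonempty U → IsIntegrallyClosed Γ(X, U)) :
    IsIso (X.fromSpecStalk (genericPoint X)).fromNormalization := by
  rw [← MorphismProperty.isomorphisms.iff,
    IsZariskiLocalAtTarget.iff_of_iSup_eq_top (P := .isomorphisms Scheme)
      (fun U : X.affineOpens => (U : X.Opens)) (iSup_affineOpens_eq_top X)]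
  rintro ⟨U, hU⟩
  rw [MorphismProperty.isomorphisms.iff, isIso_morphismRestrict_iff_isIso_app _ hU,
    Scheme.Hom.fromNormalization_app _ hU]
  let _ := ((X.fromSpecStalk (genericPoint X)).app U).hom.toAlgebra
  suffices hbij : Function.Bijective (algebraMap Γ(X, U) (integralClosure Γ(X, U)
      Γ(Spec (X.presheaf.stalk (genericPoint X)), X.fromSpecStalk (genericPoint X) ⁻¹ᵁ U))) by
    have : IsIso (CommRingCat.ofHom (algebraMap Γ(X, U) (integralClosure Γ(X, U)
      Γ(Spec (X.presheaf.stalk (genericPoint X)), X.fromSpecStalk (genericPoint X) ⁻¹ᵁ U)))) :=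
      (ConcreteCategory.isIso_iff_bijective _).mpr hbij
    infer_instance
  rcases isEmpty_or_nonempty U with hemp | hne
  · have hU' : U = ⊥ := by
      ext x
      simp only [TopologicalSpace.Opens.coe_bot, Set.mem_empty_iff_false, iff_false]
      exact fun hx => hemp.false ⟨x, hx⟩
    have : Subsingleton Γ(X, U) := by subst hU'; infer_instance
    have := Module.subsingleton Γ(X, U) (integralClosure Γ(X, U)
      Γ(Spec (X.presheaf.stalk (genericPoint X)), X.fromSpecStalk (genericPoint X) ⁻¹ᵁ U))
    exact ⟨fun _ _ _ => Subsingleton.elim _ _, fun y => ⟨0, Subsingleton.elim _ _⟩⟩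
  · have hgU : genericPoint X ∈ U :=
      ((genericPoint_spec X).mem_open_set_iff U.isOpen).mpr (by simpa using hne)
    have := h U hU hne
    have := functionField_isFractionRing_of_isAffineOpen X U hU
    have htop : X.fromSpecStalk (genericPoint X) ⁻¹ᵁ U = ⊤ :=
      Scheme.preimage_eq_top_of_closedPoint_mem _ (by rwa [Scheme.fromSpecStalk_closedPoint])
    -- The preimage of `U` is the whole one-point spectrum, but only up to a propositional equality
    -- of open sets; `θ` identifies its sections with the function field.
    let θ : X.functionField ⟶
        Γ(Spec (X.presheaf.stalk (genericPoint X)), X.fromSpecStalk (genericPoint X) ⁻¹ᵁ U) :=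
      (Scheme.ΓSpecIso (X.presheaf.stalk (genericPoint X))).inv ≫
        (Spec (X.presheaf.stalk (genericPoint X))).presheaf.map (homOfLE le_top).op
    have hθ : IsIso θ := by
      have : IsIso (homOfLE (le_top : X.fromSpecStalk (genericPoint X) ⁻¹ᵁ U ≤ ⊤)) := by
        rw [Subsingleton.elim (homOfLE (le_top : X.fromSpecStalk (genericPoint X) ⁻¹ᵁ U ≤ ⊤))
          (eqToHom htop)]
        infer_instance
      infer_instance
    have hθb := (ConcreteCategory.isIso_iff_bijective θ).mp hθ
    have halg : ∀ a : Γ(X, U), algebraMap Γ(X, U) Γ(Spec (X.presheaf.stalk (genericPoint X)),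
        X.fromSpecStalk (genericPoint X) ⁻¹ᵁ U) a = θ (algebraMap Γ(X, U) X.functionField a) := by
      intro a
      change ((X.fromSpecStalk (genericPoint X)).app U).hom a = _
      rw [Scheme.fromSpecStalk_app hgU]
      rfl
    constructor
    · intro a b hab
      have h1 := congrArg Subtype.val hab
      change algebraMap Γ(X, U) Γ(Spec (X.presheaf.stalk (genericPoint X)),
        X.fromSpecStalk (genericPoint X) ⁻¹ᵁ U) a = algebraMap Γ(X, U) _ b at h1
      rw [halg, halg] at h1
      exact IsFractionRing.injective Γ(X, U) X.functionField (hθb.1 h1)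
    · rintro ⟨y, p, hp, hpy⟩
      obtain ⟨x, rfl⟩ := hθb.2 y
      have hx : _root_.IsIntegral Γ(X, U) x := by
        refine ⟨p, hp, hθb.1 ?_⟩
        have h1 : algebraMap Γ(X, U) Γ(Spec (X.presheaf.stalk (genericPoint X)),
          X.fromSpecStalk (genericPoint X) ⁻¹ᵁ U) =
          θ.hom.comp (algebraMap Γ(X, U) X.functionField) := RingHom.ext halg
        change θ.hom _ = θ.hom 0
        rw [Polynomial.hom_eval₂, ← h1, map_zero]
        exact hpy
      obtain ⟨a, ha⟩ := IsIntegrallyClosed.isIntegral_iff.mp hx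
      refine ⟨a, Subtype.ext ?_⟩
      change algebraMap Γ(X, U) Γ(Spec (X.presheaf.stalk (genericPoint X)),
        X.fromSpecStalk (genericPoint X) ⁻¹ᵁ U) a = _
      rw [halg, ha]

end Schemes

namespace CurveOver

variable {k : Type u} [Field k] (X : CurveOver k)

instance : IsLocallyNoetherian X.scheme := by
  have : IsLocallyNoetherian (Spec (.of k)) := inferInstance
  exact LocallyOfFiniteType.isLocallyNoetherian X.str

instance : CompactSpace X.scheme := by
  exact QuasiCompact.compactSpace_of_compactSpace X.str

/-- By compactness `y` specializes to a closed point `z`, so it is one of the two primes of the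
discrete valuation ring at `z`. -/
lemma eq_genericPoint_or_isClosed (y : X.scheme) :
    y = genericPoint X.scheme ∨ IsClosed ({y} : Set X.scheme) := by
  obtain ⟨z, hz, hzc⟩ := (isClosed_closure (s := ({y} : Set X.scheme))).exists_closed_singleton
    (Set.singleton_nonempty y).closure
  have hyz : y ⤳ z := specializes_iff_mem_closure.mpr hz
  have hdvr := X.isDVR z hzc
  obtain ⟨p, hp⟩ : y ∈ Set.range (X.scheme.fromSpecStalk z) := by
    rw [Scheme.range_fromSpecStalk]; exact hyz
  by_cases hbot : p.asIdeal = ⊥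
  · left
    have hg : genericPoint X.scheme ⤳ z := genericPoint_specializes z
    obtain ⟨q, hq⟩ : genericPoint X.scheme ∈ Set.range (X.scheme.fromSpecStalk z) := by
      rw [Scheme.range_fromSpecStalk]; exact hg
    have hpq : p ⤳ q := by
      refine (PrimeSpectrum.le_iff_specializes p q).mp ?_
      change p.asIdeal ≤ q.asIdeal
      rw [hbot]; exact bot_le
    have h1 : y ⤳ genericPoint X.scheme := by
      rw [← hp, ← hq]
      exact hpq.map (X.scheme.fromSpecStalk z).continuous
    exact (h1.antisymm (genericPoint_specializes y)).eq
  · right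
    have := p.isPrime
    have hmax : p.asIdeal.IsMaximal := IsPrime.to_maximal_ideal hbot
    have : p = IsLocalRing.closedPoint _ := PrimeSpectrum.ext (IsLocalRing.eq_maximalIdeal hmax)
    rw [this, Scheme.fromSpecStalk_closedPoint] at hp
    rwa [← hp]

lemma isDedekindDomain {U : X.scheme.Opens} (hU : IsAffineOpen U) [Nonempty U] :
    IsDedekindDomain Γ(X.scheme, U) := by
  have hN : IsNoetherianRing Γ(X.scheme, U) := IsLocallyNoetherian.component_noetherian ⟨U, hU⟩
  have : IsDedekindDomainDvr Γ(X.scheme, U) := by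
    refine { hN with is_dvr_at_nonzero_prime := ?_ }
    intro P hP hPp
    let p : PrimeSpectrum Γ(X.scheme, U) := ⟨P, hPp⟩
    have hpU : hU.fromSpec p ∈ U := by
      have : hU.fromSpec p ∈ Set.range hU.fromSpec := ⟨p, rfl⟩
      rwa [hU.range_fromSpec] at this
    have hne : hU.fromSpec p ≠ genericPoint X.scheme := by
      intro h
      have h1 := hU.fromSpec_primeIdealOf ⟨genericPoint X.scheme,
        ((genericPoint_spec X.scheme).mem_open_set_iff U.isOpen).mpr (by simpa using ‹Nonempty U›)⟩
      rw [hU.primeIdealOf_genericPoint, genericPoint_eq_bot_of_affine] at h1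
      have h2 : p = ⊥ := hU.fromSpec.isOpenEmbedding.injective (h.trans h1.symm)
      exact hP (congrArg PrimeSpectrum.asIdeal h2)
    have hdvr := X.isDVR _ ((X.eq_genericPoint_or_isClosed _).resolve_left hne)
    let _ : Algebra Γ(X.scheme, U) (X.scheme.presheaf.stalk (hU.fromSpec p)) :=
      TopCat.Presheaf.algebra_section_stalk X.scheme.presheaf ⟨_, hpU⟩
    have hloc : IsLocalization P.primeCompl (X.scheme.presheaf.stalk (hU.fromSpec p)) :=
      hU.isLocalization_stalk' p hpU
    exact IsDiscreteValuationRing.RingEquivClass.isDiscreteValuationRing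
      (IsLocalization.algEquiv P.primeCompl (X.scheme.presheaf.stalk (hU.fromSpec p))
        (Localization.AtPrime P))
  infer_instance

instance isIso_fromNormalization :
    IsIso (X.scheme.fromSpecStalk (genericPoint X.scheme)).fromNormalization :=
  isIso_fromNormalization_fromSpecStalk X.scheme fun _ hU _ =>
    have := X.isDedekindDomain hU
    inferInstance

/-- A curve is its own normalization in its function field, so by the universal property of
normalization a lift of the generic point to an integral `X`-scheme spreads out to a section. -/
lemma exists_section {T : Scheme.{u}} (π : T ⟶ X.scheme) [IsIntegralHom π]
    (t : Spec X.scheme.functionField ⟶ T)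
    (ht : t ≫ π = X.scheme.fromSpecStalk (genericPoint X.scheme)) :
    ∃ s : X.scheme ⟶ T, s ≫ π = 𝟙 _ ∧ X.scheme.fromSpecStalk (genericPoint X.scheme) ≫ s = t := by
  let η := X.scheme.fromSpecStalk (genericPoint X.scheme)
  refine ⟨inv η.fromNormalization ≫ η.normalizationDesc t π ht.symm, ?_, ?_⟩
  · rw [Category.assoc, Scheme.Hom.normalizationDesc_comp, IsIso.inv_hom_id]
  · have h : η ≫ inv η.fromNormalization = η.toNormalization := by
      rw [IsIso.comp_inv_eq, Scheme.Hom.toNormalization_fromNormalization]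
    rw [← Category.assoc, h, Scheme.Hom.toNormalization_normalizationDesc]

/-- The function field of a curve over `k` is an extension of `k`. -/
lemma charZero_functionField [CharZero k] : CharZero X.scheme.functionField := by
  exact charZero_of_injective_ringHom (Spec.preimage (R := .of k)
    (X.scheme.fromSpecStalk (genericPoint X.scheme) ≫ X.str)).hom.injective

end CurveOver

namespace BranchedCovering

variable {k : Type u} [Field k] {X Y Z : CurveOver k}

lemma SpecMap_functionFieldMap (f : BranchedCovering X Y) :
    Spec.map (CommRingCat.ofHom f.functionFieldMap) ≫
      Y.scheme.fromSpecStalk (genericPoint Y.scheme) =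
    X.scheme.fromSpecStalk (genericPoint X.scheme) ≫ f.hom := by
  have : CommRingCat.ofHom f.functionFieldMap =
    Y.scheme.presheaf.stalkSpecializes (specializes_of_eq f.map_genericPoint) ≫
      f.hom.stalkMap (genericPoint X.scheme) := CommRingCat.ofHom_hom _
  rw [this, Spec.map_comp, Category.assoc, Scheme.SpecMap_stalkSpecializes_fromSpecStalk,
    Scheme.SpecMap_stalkMap_fromSpecStalk]

/-- The inclusion of the generic point is a monomorphism, so the square determines the field map.
Functoriality is deduced from this. -/
lemma functionFieldMap_unique (f : BranchedCovering X Y)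
    {ψ : Y.scheme.functionField →+* X.scheme.functionField}
    (h : Spec.map (CommRingCat.ofHom ψ) ≫ Y.scheme.fromSpecStalk (genericPoint Y.scheme) =
      X.scheme.fromSpecStalk (genericPoint X.scheme) ≫ f.hom) : f.functionFieldMap = ψ := by
  rw [← SpecMap_functionFieldMap, cancel_mono] at h
  exact (congrArg CommRingCat.Hom.hom (Spec.map_injective h)).symm

lemma functionFieldMap_refl : (refl X).functionFieldMap = RingHom.id _ := by
  apply functionFieldMap_unique
  change Spec.map (𝟙 _) ≫ _ = _ ≫ 𝟙 _
  simp

lemma functionFieldMap_comp (f : BranchedCovering Y Z) (g : BranchedCovering X Y) :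
    (f.comp g).functionFieldMap = g.functionFieldMap.comp f.functionFieldMap := by
  apply functionFieldMap_unique
  rw [CommRingCat.ofHom_comp, Spec.map_comp, Category.assoc, SpecMap_functionFieldMap,
    ← Category.assoc, SpecMap_functionFieldMap, Category.assoc]
  rfl

/-- Every embedding of function fields over `k(Y)` comes from a morphism of coverings of `Y`. -/
lemma exists_comp_eq (f : BranchedCovering X Y) (g : BranchedCovering Z Y)
    (ψ : Z.scheme.functionField →+* X.scheme.functionField)
    (h : ψ.comp g.functionFieldMap = f.functionFieldMap) :
    ∃ h' : BranchedCovering X Z, f = g.comp h' ∧ h'.functionFieldMap = ψ := by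
  have hsq : (Spec.map (CommRingCat.ofHom ψ) ≫ Z.scheme.fromSpecStalk (genericPoint Z.scheme)) ≫
      g.hom = X.scheme.fromSpecStalk (genericPoint X.scheme) ≫ f.hom := by
    rw [Category.assoc, ← SpecMap_functionFieldMap, ← Category.assoc, ← Spec.map_comp,
      ← CommRingCat.ofHom_comp, h, SpecMap_functionFieldMap]
  -- The projection of the fiber product to `X` is finite, and `ψ` provides its section over the
  -- generic point.
  obtain ⟨s, hs1, hs2⟩ := X.exists_section (pullback.snd g.hom f.hom)
    (pullback.lift _ _ hsq) (pullback.lift_snd _ _ _)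
  let a := s ≫ pullback.fst g.hom f.hom
  have ha : a ≫ g.hom = f.hom := by
    rw [Category.assoc, pullback.condition, ← Category.assoc, hs1, Category.id_comp]
  have hgen : X.scheme.fromSpecStalk (genericPoint X.scheme) ≫ a =
      Spec.map (CommRingCat.ofHom ψ) ≫ Z.scheme.fromSpecStalk (genericPoint Z.scheme) := by
    rw [← Category.assoc, hs2, pullback.lift_fst]
  have hfin : IsFinite a := by
    have : IsFinite (a ≫ g.hom) := ha ▸ f.isFinite
    exact IsFinite.of_comp a g.hom
  have hsurj : Surjective a := by
    have hcl : IsClosed (Set.range a) := a.isClosedMap.isClosed_range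
    have hmem : genericPoint Z.scheme ∈ Set.range a := by
      let pt : Spec X.scheme.functionField :=
        (IsLocalRing.closedPoint X.scheme.functionField : PrimeSpectrum X.scheme.functionField)
      have h1 : Spec.map (CommRingCat.ofHom ψ) pt =
        IsLocalRing.closedPoint Z.scheme.functionField :=
          Subsingleton.elim (α := PrimeSpectrum Z.scheme.functionField) _ _
      have h2 : a (X.scheme.fromSpecStalk (genericPoint X.scheme) pt) =
        Z.scheme.fromSpecStalk (genericPoint Z.scheme) (Spec.map (CommRingCat.ofHom ψ) pt) :=
        congrArg (fun m : Spec X.scheme.functionField ⟶ Z.scheme => m pt) hgen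
      refine ⟨X.scheme.fromSpecStalk (genericPoint X.scheme) pt, h2.trans ?_⟩
      rw [h1]
      exact Scheme.fromSpecStalk_closedPoint
    refine ⟨fun z => ?_⟩
    exact hcl.closure_subset_iff.mpr (Set.singleton_subset_iff.mpr hmem)
      (genericPoint_specializes z).mem_closure
  let h' : BranchedCovering X Z :=
    { hom := a
      hom_str := by rw [← g.hom_str, ← Category.assoc, ha, f.hom_str]
      isFinite := hfin
      surjective := hsurj }
  exact ⟨h', BranchedCovering.ext ha.symm, functionFieldMap_unique h' hgen.symm⟩

lemma isIso_iff (f : BranchedCovering X Y) :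
    IsIso f.hom ↔ Function.Bijective f.functionFieldMap := by
  constructor
  · intro h
    let g : BranchedCovering Y X :=
      { hom := inv f.hom
        hom_str := by rw [IsIso.inv_comp_eq, f.hom_str]
        isFinite := inferInstance
        surjective := inferInstance }
    have h1 : f.comp g = refl Y := BranchedCovering.ext (IsIso.inv_hom_id f.hom)
    have h2 : g.comp f = refl X := BranchedCovering.ext (IsIso.hom_inv_id f.hom)
    have h3 := functionFieldMap_comp f g
    have h4 := functionFieldMap_comp g f
    rw [h1, functionFieldMap_refl] at h3
    rw [h2, functionFieldMap_refl] at h4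
    exact Function.bijective_iff_has_inverse.mpr ⟨g.functionFieldMap,
      fun x => (RingHom.congr_fun h3 x).symm, fun x => (RingHom.congr_fun h4 x).symm⟩
  -- A one-sided inverse whose field map is again bijective; applying this twice makes it two-sided.
  · have key : ∀ {X Y : CurveOver k} (f : BranchedCovering X Y),
        Function.Bijective f.functionFieldMap → ∃ h : BranchedCovering Y X,
          refl Y = f.comp h ∧ Function.Bijective h.functionFieldMap := by
      intro X Y f hf
      let e := RingEquiv.ofBijective f.functionFieldMap hf
      obtain ⟨h, h1, h2⟩ := exists_comp_eq (refl Y) f e.symm.toRingHom (by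
        rw [functionFieldMap_refl]
        ext x
        exact e.symm_apply_apply x)
      exact ⟨h, h1, h2 ▸ e.symm.bijective⟩
    intro hf
    obtain ⟨h, h1, h2⟩ := key f hf
    obtain ⟨f', h3, -⟩ := key h h2
    have e1 : h.hom ≫ f.hom = 𝟙 _ := (congrArg BranchedCovering.hom h1).symm
    have e2 : f'.hom ≫ h.hom = 𝟙 _ := (congrArg BranchedCovering.hom h3).symm
    have e3 : f' = f := by
      refine BranchedCovering.ext ?_
      calc f'.hom = f'.hom ≫ h.hom ≫ f.hom := by rw [e1, Category.comp_id]
        _ = f.hom := by rw [← Category.assoc, e2, Category.id_comp]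
    exact ⟨h.hom, e3 ▸ e2, e1⟩

end BranchedCovering

namespace BranchedCovering

variable {k : Type u} [Field k] {X Y Z : CurveOver k}

lemma nonempty_preimage (f : BranchedCovering X Y) (U : Y.scheme.Opens) [hU : Nonempty U] :
    Nonempty (f.hom ⁻¹ᵁ U).toScheme := by
  obtain ⟨y, hy⟩ := hU
  obtain ⟨x, rfl⟩ := f.hom.surjective y
  exact ⟨x, hy⟩

lemma functionFieldMap_algebraMap (f : BranchedCovering X Y) (U : Y.scheme.Opens) [Nonempty U]
    [Nonempty (f.hom ⁻¹ᵁ U).toScheme] (a : Γ(Y.scheme, U)) :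
    f.functionFieldMap (algebraMap Γ(Y.scheme, U) Y.scheme.functionField a) =
      algebraMap Γ(X.scheme, f.hom ⁻¹ᵁ U) X.scheme.functionField (f.hom.app U a) := by
  have hY : genericPoint Y.scheme ∈ U :=
    ((genericPoint_spec Y.scheme).mem_open_set_iff U.isOpen).mpr (by simpa using ‹Nonempty U›)
  have h : Y.scheme.presheaf.germ U _ hY ≫
      Y.scheme.presheaf.stalkSpecializes (specializes_of_eq f.map_genericPoint) ≫
      f.hom.stalkMap (genericPoint X.scheme) =
      f.hom.app U ≫ X.scheme.germToFunctionField (f.hom ⁻¹ᵁ U) := by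
    rw [← Category.assoc, TopCat.Presheaf.germ_stalkSpecializes, Scheme.Hom.germ_stalkMap]
  exact congrArg (fun φ => φ.hom a) h

lemma app_injective (f : BranchedCovering X Y) (U : Y.scheme.Opens) [Nonempty U] :
    Function.Injective (f.hom.app U).hom := by
  have := f.nonempty_preimage U
  intro a b hab
  apply Y.scheme.germToFunctionField_injective U
  apply f.functionFieldMap.injective
  have h1 := f.functionFieldMap_algebraMap U a
  have h2 := f.functionFieldMap_algebraMap U b
  rw [hab] at h1
  exact h1.trans h2.symm

/-- Over an affine open set the sections form a finite module, and the function fields are obtained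
by inverting the nonzero elements of the base ring. -/
lemma functionFieldMap_finite (f : BranchedCovering X Y) : f.functionFieldMap.Finite := by
  obtain ⟨U, hU, hη⟩ := exists_nonempty_isAffineOpen Y.scheme (genericPoint Y.scheme)
  have : Nonempty U := ⟨_, hη⟩
  have := f.nonempty_preimage U
  have hV : IsAffineOpen (f.hom ⁻¹ᵁ U) := hU.preimage f.hom
  have := functionField_isFractionRing_of_isAffineOpen Y.scheme U hU
  have := functionField_isFractionRing_of_isAffineOpen X.scheme _ hV
  let _ : Algebra Γ(Y.scheme, U) Γ(X.scheme, f.hom ⁻¹ᵁ U) := (f.hom.app U).hom.toAlgebra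
  let _ : Algebra Y.scheme.functionField X.scheme.functionField := f.functionFieldMap.toAlgebra
  let _ : Algebra Γ(Y.scheme, U) X.scheme.functionField :=
    ((algebraMap Γ(X.scheme, f.hom ⁻¹ᵁ U) X.scheme.functionField).comp
      (f.hom.app U).hom).toAlgebra
  have : IsScalarTower Γ(Y.scheme, U) Γ(X.scheme, f.hom ⁻¹ᵁ U) X.scheme.functionField :=
    .of_algebraMap_eq' rfl
  have : IsScalarTower Γ(Y.scheme, U) Y.scheme.functionField X.scheme.functionField :=
    .of_algebraMap_eq fun a => (f.functionFieldMap_algebraMap U a).symm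
  have : Module.Finite Γ(Y.scheme, U) Γ(X.scheme, f.hom ⁻¹ᵁ U) := f.hom.finite_app U hU
  have : FaithfulSMul Γ(Y.scheme, U) Γ(X.scheme, f.hom ⁻¹ᵁ U) :=
    (faithfulSMul_iff_algebraMap_injective _ _).mpr (f.app_injective U)
  exact Module.Finite.of_isLocalization Γ(Y.scheme, U) Γ(X.scheme, f.hom ⁻¹ᵁ U)
    (nonZeroDivisors Γ(Y.scheme, U))

instance flat (f : BranchedCovering X Y) : Flat f.hom := by
  refine ⟨fun {U} hU {V} hV e => ?_⟩
  let _ : Algebra Γ(Y.scheme, U) Γ(X.scheme, V) := (f.hom.appLE U V e).hom.toAlgebra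
  change Module.Flat Γ(Y.scheme, U) Γ(X.scheme, V)
  rcases isEmpty_or_nonempty V with hemp | hne
  · have hV' : V = ⊥ := by
      ext x
      simp only [TopologicalSpace.Opens.coe_bot, Set.mem_empty_iff_false, iff_false]
      exact fun hx => hemp.false ⟨x, hx⟩
    have : Subsingleton Γ(X.scheme, V) := by subst hV'; infer_instance
    infer_instance
  · have hU' : Nonempty U := ⟨⟨_, e hne.some.2⟩⟩
    have := f.nonempty_preimage U
    have := Y.isDedekindDomain hU
    have hinj : Function.Injective (algebraMap Γ(Y.scheme, U) Γ(X.scheme, V)) := by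
      have h1 := map_injective_of_isIntegral X.scheme (homOfLE e)
      exact h1.comp (f.app_injective U)
    have := (Module.isTorsionFree_iff_algebraMap_injective
      (R := Γ(Y.scheme, U)) (A := Γ(X.scheme, V))).mpr hinj
    infer_instance

end BranchedCovering

/-! ### Constructing coverings from field extensions -/

section Evaluation

variable {M : Type u} [Field M] {S T : Scheme.{u}}

/-- The value of a section at a point with values in a field. -/
noncomputable def evalAt (t : Spec (.of M) ⟶ S) (W : S.Opens)
    (h : t (IsLocalRing.closedPoint M : PrimeSpectrum M) ∈ W) : Γ(S, W) →+* M :=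
  (S.presheaf.germ W _ h ≫ Scheme.stalkClosedPointTo t).hom

lemma evalAt_fromSpecStalk [IsIntegral S] (ψ : S.functionField →+* M) (W : S.Opens) [Nonempty W]
    (h) (a : Γ(S, W)) :
    evalAt (Spec.map (CommRingCat.ofHom ψ) ≫ S.fromSpecStalk (genericPoint S)) W h a =
      ψ (algebraMap Γ(S, W) S.functionField a) := by
  have hloc : IsLocalHom (CommRingCat.ofHom ψ).hom := inferInstanceAs (IsLocalHom ψ)
  exact congrArg (fun φ => φ.hom a)
    (Scheme.germ_stalkClosedPointTo_Spec_fromSpecStalk (R := .of M) (CommRingCat.ofHom ψ) W h)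

/-- The open set `O` is a variable, because preimages under `t` are equal to `⊤` only
propositionally. -/
lemma evalAt_eq (t : Spec (.of M) ⟶ S) (W : S.Opens) (h)
    (O : (Spec (.of M)).Opens) (hO : O = ⊤) (hW : O ≤ t ⁻¹ᵁ W) (a : Γ(S, W)) :
    evalAt t W h a = ((Spec (.of M)).presheaf.mapIso (eqToIso hO.symm).op ≪≫
        Scheme.ΓSpecIso (.of M)).hom (t.appLE W O hW a) := by
  have h1 := Scheme.germ_stalkClosedPointTo (R := .of M) t W h
  have h2 := congrArg (fun φ => φ.hom a) h1
  refine h2.trans ?_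
  have h3 : t.app W ≫ ((Spec (.of M)).presheaf.mapIso (eqToIso
      (Scheme.preimage_eq_top_of_closedPoint_mem (R := .of M) t h).symm).op ≪≫
        Scheme.ΓSpecIso (.of M)).hom =
      t.appLE W O hW ≫ ((Spec (.of M)).presheaf.mapIso (eqToIso hO.symm).op ≪≫
        Scheme.ΓSpecIso (.of M)).hom := by
    subst hO
    simp [Scheme.Hom.appLE]
    rfl
  exact congrArg (fun φ => φ.hom a) h3

lemma evalAt_comp (t : Spec (.of M) ⟶ S) (n : S ⟶ T) (W : T.Opens) (h) (h') (a : Γ(T, W)) :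
    evalAt (t ≫ n) W h a = evalAt t (n ⁻¹ᵁ W) h' (n.app W a) := by
  have htop : (⊤ : (Spec (.of M)).Opens) ≤ t ⁻¹ᵁ (n ⁻¹ᵁ W) :=
    (Scheme.preimage_eq_top_of_closedPoint_mem (R := .of M) t h').ge
  rw [evalAt_eq (t ≫ n) W h ⊤ rfl htop, evalAt_eq t (n ⁻¹ᵁ W) h' ⊤ rfl htop]
  have h1 : (t ≫ n).appLE W ⊤ htop = n.app W ≫ t.appLE (n ⁻¹ᵁ W) ⊤ htop :=
    Scheme.Hom.comp_appLE ..
  exact congrArg (fun φ => ((Spec (.of M)).presheaf.mapIso (eqToIso rfl).op ≪≫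
    Scheme.ΓSpecIso (.of M)).hom (φ.hom a)) h1

lemma exists_SpecMap_comp_fromSpecStalk [IsIntegral S] (t : Spec (.of M) ⟶ S)
    (ht : t (IsLocalRing.closedPoint M : PrimeSpectrum M) = genericPoint S) :
    ∃ ψ : S.functionField →+* M,
      Spec.map (CommRingCat.ofHom ψ) ≫ S.fromSpecStalk (genericPoint S) = t := by
  refine ⟨(S.presheaf.stalkSpecializes (specializes_of_eq ht) ≫
    Scheme.stalkClosedPointTo (R := .of M) t).hom, ?_⟩
  rw [CommRingCat.ofHom_hom, Spec.map_comp, Category.assoc,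
    Scheme.SpecMap_stalkSpecializes_fromSpecStalk, Scheme.Spec_stalkClosedPointTo_fromSpecStalk]

end Evaluation

section Normalization

variable {M : Type u} [Field M] {S : Scheme.{u}}

lemma SpecMap_comp_fromSpecStalk_apply [IsIntegral S] (φ : S.functionField →+* M) :
    (Spec.map (CommRingCat.ofHom φ) ≫ S.fromSpecStalk (genericPoint S))
      (IsLocalRing.closedPoint M : PrimeSpectrum M) = genericPoint S := by
  have h1 : Spec.map (CommRingCat.ofHom φ) (IsLocalRing.closedPoint M : PrimeSpectrum M) =
    IsLocalRing.closedPoint S.functionField :=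
      Subsingleton.elim (α := PrimeSpectrum S.functionField) _ _
  refine (congrArg (S.fromSpecStalk (genericPoint S)) h1).trans ?_
  exact Scheme.fromSpecStalk_closedPoint

variable (q : Spec (.of M) ⟶ S) [QuasiCompact q] [QuasiSeparated q]

lemma toNormalization_apply_mem {U : S.Opens}
    (h : q (IsLocalRing.closedPoint M : PrimeSpectrum M) ∈ U) :
    q.toNormalization (IsLocalRing.closedPoint M : PrimeSpectrum M) ∈
      q.fromNormalization ⁻¹ᵁ U := by
  have h1 := congrArg (fun m : Spec (.of M) ⟶ S =>
    m (IsLocalRing.closedPoint M : PrimeSpectrum M)) q.toNormalization_fromNormalization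
  exact Eq.subst (motive := (· ∈ U)) h1.symm h

lemma evalAt_toNormalization {U : S.Opens}
    (h : q (IsLocalRing.closedPoint M : PrimeSpectrum M) ∈ U) (a : Γ(S, U)) :
    evalAt q.toNormalization (q.fromNormalization ⁻¹ᵁ U) (toNormalization_apply_mem q h)
      (q.fromNormalization.app U a) = evalAt q U h a := by
  rw [← evalAt_comp q.toNormalization q.fromNormalization U
    (by rw [q.toNormalization_fromNormalization]; exact h)]
  congr 1
  simp only [q.toNormalization_fromNormalization]

lemma evalAt_toNormalization_surjective {U : S.Opens} (hU : IsAffineOpen U)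
    (h : q (IsLocalRing.closedPoint M : PrimeSpectrum M) ∈ U) (m : M)
    (hm : (evalAt q U h).IsIntegralElem m) :
    ∃ b, evalAt q.toNormalization (q.fromNormalization ⁻¹ᵁ U)
      (toNormalization_apply_mem q h) b = m := by
  have htop : q ⁻¹ᵁ U = ⊤ := Scheme.preimage_eq_top_of_closedPoint_mem (R := .of M) q h
  have hle : q ⁻¹ᵁ U ≤ q.toNormalization ⁻¹ᵁ (q.fromNormalization ⁻¹ᵁ U) := by
    rw [← Scheme.Hom.comp_preimage, q.toNormalization_fromNormalization]
  let i := (Spec (.of M)).presheaf.mapIso (eqToIso htop.symm).op ≪≫ Scheme.ΓSpecIso (.of M)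
  have hi : Function.Bijective i.hom.hom :=
    (ConcreteCategory.isIso_iff_bijective i.hom).mp inferInstance
  obtain ⟨x, rfl⟩ := hi.2 m
  let _ := (q.app U).hom.toAlgebra
  have hev : evalAt q U h = i.hom.hom.comp (q.app U).hom := by
    ext a
    rw [evalAt_eq q U h _ htop le_rfl, ← Scheme.Hom.app_eq_appLE]
    rfl
  have hx : x ∈ integralClosure Γ(S, U) Γ(Spec (.of M), q ⁻¹ᵁ U) := by
    obtain ⟨p, hp, hpx⟩ := hm
    refine ⟨p, hp, hi.1 ?_⟩
    rw [hev] at hpx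
    rw [Polynomial.hom_eval₂, map_zero]
    exact hpx
  refine ⟨(q.normalizationObjIso hU).inv ⟨x, hx⟩, ?_⟩
  rw [evalAt_eq q.toNormalization _ _ _ htop hle]
  have h1 := q.normalizationObjIso_hom_val hU
  rw [← Iso.eq_inv_comp] at h1
  have h2 := congrArg (fun φ => φ.hom (⟨x, hx⟩ : integralClosure Γ(S, U) _)) h1
  exact congrArg i.hom.hom h2.symm

end Normalization

namespace CurveOver

variable {k : Type u} [Field k] (Y : CurveOver k) {M : Type u} [Field M]

section Normalization

variable (φ : Y.scheme.functionField →+* M)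

/-- The composition of the spectrum of an extension of the function field with the generic
point of the curve. -/
noncomputable abbrev pointOfExtension : Spec (.of M) ⟶ Y.scheme :=
  Spec.map (CommRingCat.ofHom φ) ≫ Y.scheme.fromSpecStalk (genericPoint Y.scheme)

lemma pointOfExtension_mem (U : Y.scheme.Opens) [hU : Nonempty U] :
    Y.pointOfExtension φ (IsLocalRing.closedPoint M : PrimeSpectrum M) ∈ U := by
  rw [SpecMap_comp_fromSpecStalk_apply φ]
  exact ((genericPoint_spec Y.scheme).mem_open_set_iff U.isOpen).mpr (by simpa using hU)

lemma toNormalization_closedPoint :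
    (Y.pointOfExtension φ).toNormalization (IsLocalRing.closedPoint M : PrimeSpectrum M) =
      genericPoint (Y.pointOfExtension φ).normalization := by
  refine ((genericPoint_spec _).eq ?_).symm
  have hd := (Y.pointOfExtension φ).toNormalization.denseRange
  have h1 : Set.range (Y.pointOfExtension φ).toNormalization =
      {(Y.pointOfExtension φ).toNormalization
        (IsLocalRing.closedPoint M : PrimeSpectrum M)} := by
    refine Set.eq_singleton_iff_unique_mem.mpr ⟨⟨_, rfl⟩, ?_⟩
    rintro _ ⟨x, rfl⟩
    exact congrArg _ (Subsingleton.elim (α := PrimeSpectrum M) _ _)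
  rw [DenseRange, h1] at hd
  exact hd.closure_eq

/-- Sections of the normalization over an affine open are the integral closure in `M`. -/
lemma exists_isIntegralClosure [CharZero k] (hφ : φ.Finite) {U : Y.scheme.Opens} (hU : IsAffineOpen U)
    [Nonempty U] :
    ((Y.pointOfExtension φ).fromNormalization.app U).hom.Finite ∧
    IsDedekindDomain Γ((Y.pointOfExtension φ).normalization,
      (Y.pointOfExtension φ).fromNormalization ⁻¹ᵁ U) ∧
    ∀ m : M, ∃ a : Y.scheme.functionField, a ≠ 0 ∧
      ∃ b, φ a * m = evalAt (Y.pointOfExtension φ).toNormalization _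
        (toNormalization_apply_mem _ (Y.pointOfExtension_mem φ U)) b := by
  have hdisj : Nonempty ((Y.pointOfExtension φ).fromNormalization ⁻¹ᵁ U).toScheme :=
    ⟨⟨_, toNormalization_apply_mem _ (Y.pointOfExtension_mem φ U)⟩⟩
  have := Y.isDedekindDomain hU
  have := functionField_isFractionRing_of_isAffineOpen Y.scheme U hU
  have := Y.charZero_functionField
  let A := Γ(Y.scheme, U)
  let B := Γ((Y.pointOfExtension φ).normalization, (Y.pointOfExtension φ).fromNormalization ⁻¹ᵁ U)
  let K := Y.scheme.functionField
  let ρ : B →+* M := evalAt (Y.pointOfExtension φ).toNormalization _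
    (toNormalization_apply_mem _ (Y.pointOfExtension_mem φ U))
  have hev : ∀ a : A, evalAt (Y.pointOfExtension φ) U (Y.pointOfExtension_mem φ U) a =
      φ (algebraMap A K a) := fun a => evalAt_fromSpecStalk φ U _ a
  let _ : Algebra A B := ((Y.pointOfExtension φ).fromNormalization.app U).hom.toAlgebra
  let _ : Algebra K M := φ.toAlgebra
  let _ : Algebra B M := ρ.toAlgebra
  let _ : Algebra A M := (φ.comp (algebraMap A K)).toAlgebra
  have : IsScalarTower A K M := .of_algebraMap_eq' rfl
  have : IsScalarTower A B M := .of_algebraMap_eq fun a =>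
    ((evalAt_toNormalization _ (Y.pointOfExtension_mem φ U) a).trans (hev a)).symm
  have hfin : FiniteDimensional K M := hφ
  obtain ⟨ψ, hψ⟩ := exists_SpecMap_comp_fromSpecStalk (Y.pointOfExtension φ).toNormalization
    (Y.toNormalization_closedPoint φ)
  -- The point with values in `M` lies over the generic point of the normalization, so evaluation
  -- factors through its function field.
  have hρinj : Function.Injective ρ := by
    have h1 : ∀ b : B, ρ b = ψ (algebraMap B _ b) := by
      intro b
      rw [← evalAt_fromSpecStalk ψ _ (by
        rw [hψ]; exact toNormalization_apply_mem _ (Y.pointOfExtension_mem φ U))]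
      simp only [hψ]
      rfl
    intro b b' hbb
    rw [h1, h1] at hbb
    exact Scheme.germToFunctionField_injective _ _ (ψ.injective hbb)
  have hcl : IsIntegralClosure B A M := by
    refine ⟨hρinj, fun {m} => ⟨fun hm => ?_, ?_⟩⟩
    · refine evalAt_toNormalization_surjective (Y.pointOfExtension φ) hU
        (Y.pointOfExtension_mem φ U) m ?_
      obtain ⟨p, hp, hpm⟩ := hm
      refine ⟨p, hp, ?_⟩
      rw [← hpm]
      congr 1
      ext a
      exact hev a
    · rintro ⟨b, rfl⟩
      have h1 : _root_.IsIntegral A b :=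
        IsIntegralHom.isIntegral_app (Y.pointOfExtension φ).fromNormalization U hU b
      exact h1.algebraMap
  have hdom : IsDomain B := inferInstance
  -- Finiteness of the integral closure uses that the extension is separable, as the characteristic
  -- is `0`.
  refine ⟨IsIntegralClosure.finite A K M B, IsIntegralClosure.isDedekindDomain A K M B, fun m => ?_⟩
  have hm : IsAlgebraic A m := (IsFractionRing.isAlgebraic_iff A K M).mpr
    (Algebra.IsAlgebraic.isAlgebraic m)
  obtain ⟨a, ha, hint⟩ := hm.exists_integral_multiple
  obtain ⟨b, hb⟩ := hcl.isIntegral_iff.mp hint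
  refine ⟨algebraMap A K a, ?_, b, ?_⟩
  · exact (map_ne_zero_iff _ (IsFractionRing.injective A K)).mpr ha
  · rw [Algebra.smul_def] at hb
    exact hb.symm

end Normalization

end CurveOver

namespace CurveOver

variable {k : Type u} [Field k] (Y : CurveOver k) {M : Type u} [Field M]
  (φ : Y.scheme.functionField →+* M)

instance surjective_fromNormalization :
    Surjective (Y.pointOfExtension φ).fromNormalization := by
  have hcl : IsClosed (Set.range (Y.pointOfExtension φ).fromNormalization) :=
    (Y.pointOfExtension φ).fromNormalization.isClosedMap.isClosed_range
  have hmem : genericPoint Y.scheme ∈ Set.range (Y.pointOfExtension φ).fromNormalization := by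
    refine ⟨(Y.pointOfExtension φ).toNormalization
      (IsLocalRing.closedPoint M : PrimeSpectrum M), ?_⟩
    refine Eq.trans ?_ (SpecMap_comp_fromSpecStalk_apply φ)
    exact congrArg (fun m : Spec (.of M) ⟶ Y.scheme =>
      m (IsLocalRing.closedPoint M : PrimeSpectrum M))
      (Y.pointOfExtension φ).toNormalization_fromNormalization
  refine ⟨fun z => ?_⟩
  exact hcl.closure_subset_iff.mpr (Set.singleton_subset_iff.mpr hmem)
    (genericPoint_specializes z).mem_closure

lemma fromNormalization_genericPoint :
    (Y.pointOfExtension φ).fromNormalization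
      (genericPoint (Y.pointOfExtension φ).normalization) = genericPoint Y.scheme := by
  apply ((genericPoint_spec Y.scheme).eq _).symm
  have h := (genericPoint_spec (Y.pointOfExtension φ).normalization).image
    (Y.pointOfExtension φ).fromNormalization.continuous
  rwa [Set.image_univ, (Y.pointOfExtension φ).fromNormalization.surjective.range_eq,
    closure_univ] at h

variable {φ}

lemma isFinite_fromNormalization [CharZero k] (hφ : φ.Finite) :
    IsFinite (Y.pointOfExtension φ).fromNormalization := by
  rw [isFinite_iff]
  refine ⟨inferInstance, fun U hU => ?_⟩
  rcases isEmpty_or_nonempty U with hemp | hne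
  · have hU' : U = ⊥ := by
      ext x
      simp only [TopologicalSpace.Opens.coe_bot, Set.mem_empty_iff_false, iff_false]
      exact fun hx => hemp.false ⟨x, hx⟩
    subst hU'
    have : Subsingleton Γ((Y.pointOfExtension φ).normalization,
      (Y.pointOfExtension φ).fromNormalization ⁻¹ᵁ ⊥) := by
        rw [Scheme.Hom.preimage_bot]; infer_instance
    exact RingHom.Finite.of_surjective _ fun y => ⟨0, Subsingleton.elim _ _⟩
  · exact (Y.exists_isIntegralClosure φ hφ hU).1

lemma isDiscreteValuationRing_stalk_normalization [CharZero k] (hφ : φ.Finite)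
    (x : (Y.pointOfExtension φ).normalization)
    (hx : IsClosed ({x} : Set (Y.pointOfExtension φ).normalization)) :
    IsDiscreteValuationRing ((Y.pointOfExtension φ).normalization.presheaf.stalk x) := by
  let n := (Y.pointOfExtension φ).fromNormalization
  obtain ⟨U, hU, hxU⟩ := exists_nonempty_isAffineOpen Y.scheme (n x)
  have : Nonempty U := ⟨_, hxU⟩
  have : Nonempty (n ⁻¹ᵁ U).toScheme := ⟨⟨x, hxU⟩⟩
  have hD := (Y.exists_isIntegralClosure φ hφ hU).2.1
  have hV : IsAffineOpen (n ⁻¹ᵁ U) := hU.preimage n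
  let _ : Algebra Γ((Y.pointOfExtension φ).normalization, n ⁻¹ᵁ U)
      ((Y.pointOfExtension φ).normalization.presheaf.stalk x) :=
    TopCat.Presheaf.algebra_section_stalk _ ⟨x, hxU⟩
  have hloc : IsLocalization.AtPrime ((Y.pointOfExtension φ).normalization.presheaf.stalk x)
    (hV.primeIdealOf ⟨x, hxU⟩).asIdeal := hV.isLocalization_stalk ⟨x, hxU⟩
  refine @IsLocalization.AtPrime.isDiscreteValuationRing_of_dedekind_domain _ _ _ hD
    (hV.primeIdealOf ⟨x, hxU⟩).asIdeal ?_ _ _ _ _ _ hloc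
  -- If the prime were zero, `x` would be the generic point, and its closed image would be the
  -- generic point of `Y`; the function field of `Y` would then be a discrete valuation ring.
  intro hbot
  have h1 : x = genericPoint (Y.pointOfExtension φ).normalization := by
    have hη : genericPoint (Y.pointOfExtension φ).normalization ∈ n ⁻¹ᵁ U :=
      ((genericPoint_spec _).mem_open_set_iff (n ⁻¹ᵁ U).isOpen).mpr (by simpa using ⟨x, hxU⟩)
    have h2 : hV.primeIdealOf ⟨x, hxU⟩ = hV.primeIdealOf ⟨_, hη⟩ := by
      rw [hV.primeIdealOf_genericPoint, genericPoint_eq_bot_of_affine]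
      exact PrimeSpectrum.ext hbot
    have h3 := congrArg hV.fromSpec h2
    rwa [hV.fromSpec_primeIdealOf, hV.fromSpec_primeIdealOf] at h3
  have h2 : IsClosed ({genericPoint Y.scheme} : Set Y.scheme) := by
    have h3 := n.isClosedMap _ hx
    rw [Set.image_singleton, h1] at h3
    rwa [← Y.fromNormalization_genericPoint φ]
  have h3 := Y.isDVR _ h2
  exact IsDiscreteValuationRing.not_isField Y.scheme.functionField (Field.toIsField _)

/-- Every finite extension of the function field of a curve comes from a covering. -/
theorem exists_covering [CharZero k] (hφ : φ.Finite) :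
    ∃ (Z : CurveOver k) (g : BranchedCovering Z Y) (e : Z.scheme.functionField ≃+* M),
      e.toRingHom.comp g.functionFieldMap = φ := by
  have := Y.isFinite_fromNormalization hφ
  let Z : CurveOver k :=
    { scheme := (Y.pointOfExtension φ).normalization
      str := (Y.pointOfExtension φ).fromNormalization ≫ Y.str
      isIntegral := inferInstance
      isProper := inferInstance
      isDVR := Y.isDiscreteValuationRing_stalk_normalization hφ }
  let g : BranchedCovering Z Y :=
    { hom := (Y.pointOfExtension φ).fromNormalization
      hom_str := rfl
      isFinite := inferInstance
      surjective := inferInstance }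
  obtain ⟨ψ, hψ⟩ := exists_SpecMap_comp_fromSpecStalk (Y.pointOfExtension φ).toNormalization
    (Y.toNormalization_closedPoint φ)
  have hcomp : RingHom.comp (ψ : Z.scheme.functionField →+* M) g.functionFieldMap = φ := by
    have h1 : Spec.map (CommRingCat.ofHom (RingHom.comp (ψ : Z.scheme.functionField →+* M)
        g.functionFieldMap)) ≫ Y.scheme.fromSpecStalk (genericPoint Y.scheme) =
        Spec.map (CommRingCat.ofHom φ) ≫ Y.scheme.fromSpecStalk (genericPoint Y.scheme) := by
      rw [CommRingCat.ofHom_comp, Spec.map_comp, Category.assoc,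
        BranchedCovering.SpecMap_functionFieldMap]
      refine (Category.assoc _ _ _).symm.trans ?_
      refine (congrArg (· ≫ g.hom) hψ).trans ?_
      exact (Y.pointOfExtension φ).toNormalization_fromNormalization
    rw [cancel_mono] at h1
    exact congrArg CommRingCat.Hom.hom (Spec.map_injective h1)
  -- For surjectivity, each element of `M` is a section of the normalization divided by a nonzero
  -- function on `Y`.
  refine ⟨Z, g, RingEquiv.ofBijective ψ ⟨ψ.injective, fun m => ?_⟩, hcomp⟩
  obtain ⟨U, hU, hη⟩ := exists_nonempty_isAffineOpen Y.scheme (genericPoint Y.scheme)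
  have : Nonempty U := ⟨_, hη⟩
  have hmem := toNormalization_apply_mem _ (Y.pointOfExtension_mem φ U)
  have : Nonempty ((Y.pointOfExtension φ).fromNormalization ⁻¹ᵁ U).toScheme := ⟨⟨_, hmem⟩⟩
  obtain ⟨a, ha, b, hb⟩ := (Y.exists_isIntegralClosure φ hφ hU).2.2 m
  have h1 : evalAt (Y.pointOfExtension φ).toNormalization _ hmem b = ψ (algebraMap _ _ b) := by
    rw [← evalAt_fromSpecStalk ψ _ (by rw [hψ]; exact hmem)]
    simp only [hψ]
  refine ⟨(g.functionFieldMap a)⁻¹ * algebraMap _ _ b, ?_⟩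
  have h2 : ψ (g.functionFieldMap a) = φ a := RingHom.congr_fun hcomp a
  have h3 : φ a ≠ 0 := (map_ne_zero φ).mpr ha
  have h4 : ψ ((g.functionFieldMap a)⁻¹ * algebraMap _ _ b) =
    (ψ (g.functionFieldMap a))⁻¹ * ψ (algebraMap _ _ b) := by
      rw [map_mul]; congr 1; exact map_inv₀ ψ _
  rw [h4, h2, ← h1, ← hb, inv_mul_cancel_left₀ h3]

end CurveOver

/-! ### Pullbacks of coverings and pushouts of function fields -/

namespace BranchedCovering

variable {k : Type u} [Field k] {W X Y Z : CurveOver k}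

/-- Coverings are flat and finitely presented, so the fiber product maps openly to `Y`, and dense
sets have dense preimages under open maps. -/
lemma dense_preimage_pullback (f : BranchedCovering X Y) (g : BranchedCovering Z Y)
    (U : Y.scheme.Opens) [hU : Nonempty U] :
    Dense ((pullback.fst f.hom g.hom ⁻¹ᵁ (f.hom ⁻¹ᵁ U) : (pullback f.hom g.hom).Opens) :
      Set ↥(pullback f.hom g.hom)) := by
  have hfp (X : CurveOver k) (f : BranchedCovering X Y) :
      LocallyOfFinitePresentation f.hom :=
    LocallyOfFinitePresentation.iff_locallyOfFiniteType.mpr inferInstance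
  have := hfp X f
  have := hfp Z g
  have hopen : IsOpenMap (pullback.fst f.hom g.hom ≫ f.hom) :=
    (pullback.fst f.hom g.hom ≫ f.hom).isOpenMap
  have hd : Dense (U : Set Y.scheme) := U.isOpen.dense (by simpa using hU)
  exact hd.preimage hopen

/-- Over an affine open set the sections of the fiber product are a pushout of sections, so the
comparison map is an isomorphism there. It is finite everywhere by cancellation. -/
lemma isPullbackAlong_of_isPushout (w : BranchedCovering W Z) (f : BranchedCovering X Y)
    (g : BranchedCovering Z Y) (p : BranchedCovering W X) (comm : f.comp p = g.comp w)
    {U : Y.scheme.Opens} (hU : IsAffineOpen U) [Nonempty U]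
    (hle : p.hom ⁻¹ᵁ (f.hom ⁻¹ᵁ U) ≤ w.hom ⁻¹ᵁ (g.hom ⁻¹ᵁ U))
    (hpush : IsPushout (f.hom.app U) (g.hom.app U) (p.hom.app (f.hom ⁻¹ᵁ U))
      (w.hom.appLE (g.hom ⁻¹ᵁ U) (p.hom ⁻¹ᵁ (f.hom ⁻¹ᵁ U)) hle)) :
    w.IsPullbackAlong f g := by
  have hcomm : p.hom ≫ f.hom = w.hom ≫ g.hom := congrArg BranchedCovering.hom comm
  let l := pullback.lift p.hom w.hom hcomm
  have hl1 : l ≫ pullback.fst f.hom g.hom = p.hom := pullback.lift_fst ..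
  have hl2 : l ≫ pullback.snd f.hom g.hom = w.hom := pullback.lift_snd ..
  have hfin : IsFinite l := by
    have : IsFinite (l ≫ pullback.snd f.hom g.hom) := hl2 ▸ w.isFinite
    exact IsFinite.of_comp l (pullback.snd f.hom g.hom)
  refine ⟨p.hom, hcomm, inferInstanceAs (IsIntegralHom l),
    pullback.fst f.hom g.hom ⁻¹ᵁ (f.hom ⁻¹ᵁ U), dense_preimage_pullback f g U, ?_⟩
  have hV : IsAffineOpen (pullback.fst f.hom g.hom ⁻¹ᵁ (f.hom ⁻¹ᵁ U)) :=
    (hU.preimage f.hom).preimage _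
  rw [isIso_morphismRestrict_iff_isIso_app _ hV]
  have hVeq : pullback.fst f.hom g.hom ⁻¹ᵁ (f.hom ⁻¹ᵁ U) =
      pullback.fst f.hom g.hom ⁻¹ᵁ (f.hom ⁻¹ᵁ U) ⊓ pullback.snd f.hom g.hom ⁻¹ᵁ (g.hom ⁻¹ᵁ U) := by
    rw [← Scheme.Hom.comp_preimage, ← Scheme.Hom.comp_preimage, pullback.condition, inf_idem]
  have hP := (isIso_pushoutSection_iff (IsPullback.of_hasPullback f.hom g.hom)
    (US := U) (UT := g.hom ⁻¹ᵁ U) (UX := f.hom ⁻¹ᵁ U) le_rfl le_rfl hVeq).mp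
    (isIso_pushoutSection_of_isAffineOpen _ _ _ _ hU (hU.preimage _) (hU.preimage _))
  have hO : p.hom ⁻¹ᵁ (f.hom ⁻¹ᵁ U) = l ⁻¹ᵁ (pullback.fst f.hom g.hom ⁻¹ᵁ (f.hom ⁻¹ᵁ U)) :=
    congrArg (fun m : W.scheme ⟶ X.scheme => m ⁻¹ᵁ (f.hom ⁻¹ᵁ U)) hl1.symm
  have hiso : IsIso (l.appLE _ _ hO.le) := by
    simp only [← Scheme.Hom.app_eq_appLE] at hP
    have h : l.appLE _ _ hO.le = (hP.isoIsPushout _ _ hpush).hom := by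
      refine hP.hom_ext ?_ ?_
      · rw [IsPushout.inl_isoIsPushout_hom, Scheme.Hom.app_eq_appLE, Scheme.Hom.appLE_comp_appLE,
          Scheme.Hom.app_eq_appLE]
        simp only [hl1]
      · rw [IsPushout.inr_isoIsPushout_hom, Scheme.Hom.appLE_comp_appLE]
        simp only [hl2]
    rw [h]
    infer_instance
  have h2 : l.appLE _ _ hO.le = l.app _ ≫ W.scheme.presheaf.map (eqToHom hO).op := by
    rw [Scheme.Hom.appLE]
    congr 2
  rw [h2] at hiso
  exact IsIso.of_isIso_comp_right _ (W.scheme.presheaf.map (eqToHom hO).op)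

end BranchedCovering

open scoped TensorProduct

section TensorProduct

/-- By flatness `B ⊗[A] C` embeds in `L ⊗[A] E`, which equals `L ⊗[F] E` because `F` is a
localization of `A`, and this is `D`. -/
lemma Algebra.TensorProduct.injective_of_isPushout_fractionRing {A B C F L E D : Type*}
    [CommRing A] [CommRing B] [CommRing C] [Field F] [Field L] [Field E] [Field D]
    [Algebra A B] [Algebra A C] [Algebra A F] [IsFractionRing A F] [IsDomain A]
    [Algebra F L] [Algebra F E] [Algebra F D] [Algebra L D] [Algebra E D]
    [IsScalarTower F L D] [IsScalarTower F E D] [Algebra.IsPushout F L E D]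
    [Module.Flat A C] (β : B →+* L) (γ : C →+* E) (hβ : Function.Injective β)
    (hγ : Function.Injective γ)
    (hβA : ∀ a, β (algebraMap A B a) = algebraMap F L (algebraMap A F a))
    (hγA : ∀ a, γ (algebraMap A C a) = algebraMap F E (algebraMap A F a))
    (ψ : B ⊗[A] C →+* D) (hψ : ∀ b c, ψ (b ⊗ₜ c) = algebraMap L D (β b) * algebraMap E D (γ c)) :
    Function.Injective ψ := by
  let _ : Algebra A L := ((algebraMap F L).comp (algebraMap A F)).toAlgebra
  let _ : Algebra A E := ((algebraMap F E).comp (algebraMap A F)).toAlgebra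
  have : IsScalarTower A F L := .of_algebraMap_eq' rfl
  have : IsScalarTower A F E := .of_algebraMap_eq' rfl
  have : Module.Flat A F := IsLocalization.flat F (nonZeroDivisors A)
  have : Module.Flat A L := Module.Flat.trans A F L
  let β' : B →ₐ[A] L := { β with commutes' := hβA }
  let γ' : C →ₐ[A] E := { γ with commutes' := hγA }
  have h1 : Function.Injective (_root_.TensorProduct.map β'.toLinearMap γ'.toLinearMap) :=
    _root_.TensorProduct.map_injective_of_flat_flat _ _ hβ hγ
  have := IsLocalization.tensorProduct_compatibleSMul (nonZeroDivisors A) F L E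
  let e1 := _root_.TensorProduct.equivOfCompatibleSMul F A F L E
  let e2 := Algebra.IsPushout.equiv F L E D
  have h2 : ∀ x, ψ x = e2 (e1 (_root_.TensorProduct.map β'.toLinearMap γ'.toLinearMap x)) := by
    intro x
    induction x with
    | zero => simp
    | add x y hx hy => simp only [map_add, hx, hy]
    | tmul b c =>
      rw [hψ, _root_.TensorProduct.map_tmul]
      have : e1 (β b ⊗ₜ γ c) = β b ⊗ₜ γ c := rfl
      refine Eq.trans ?_ (congrArg e2 this.symm)
      rw [Algebra.IsPushout.equiv_tmul]
  intro x y hxy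
  rw [h2, h2] at hxy
  exact h1 (e1.injective (e2.injective hxy))

lemma Algebra.IsPushout.of_bijective {A B C R : Type*} [CommRing A] [CommRing B] [CommRing C]
    [CommRing R] [Algebra A B] [Algebra A C] [Algebra A R] [Algebra B R] [Algebra C R]
    [IsScalarTower A B R] [IsScalarTower A C R]
    (h : Function.Bijective (Algebra.TensorProduct.lift (Algebra.ofId B R)
      (IsScalarTower.toAlgHom A C R) fun _ _ => Commute.all _ _)) : Algebra.IsPushout A B C R := by
  let _ : Algebra C (B ⊗[A] C) := Algebra.TensorProduct.rightAlgebra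
  have he := Algebra.IsPushout.of_equiv (R := A) (S := C) (R' := B) (AlgEquiv.ofBijective _ h) (by
    ext c
    have hc : Algebra.TensorProduct.lift (Algebra.ofId B R) (IsScalarTower.toAlgHom A C R)
        (fun _ _ => Commute.all _ _) (1 ⊗ₜ c) = algebraMap C R c := by simp
    exact hc)
  exact he

end TensorProduct

namespace BranchedCovering

variable {k : Type u} [Field k] {W X Y Z : CurveOver k}

/-- The subring of `k(X)` of functions regular above the open set `U`. -/
noncomputable def regularAbove (f : BranchedCovering X Y) (U : Y.scheme.Opens) [Nonempty U] :
    Subring X.scheme.functionField :=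
  have := f.nonempty_preimage U
  (algebraMap Γ(X.scheme, f.hom ⁻¹ᵁ U) X.scheme.functionField).range

lemma functionFieldMap_mem_regularAbove (f : BranchedCovering X Y) (U : Y.scheme.Opens)
    [Nonempty U] (a : Γ(Y.scheme, U)) :
    f.functionFieldMap (algebraMap _ _ a) ∈ f.regularAbove U := by
  have := f.nonempty_preimage U
  exact ⟨f.hom.app U a, (f.functionFieldMap_algebraMap U a).symm⟩

lemma regularAbove_mono (f : BranchedCovering X Y) {U V : Y.scheme.Opens} [Nonempty U]
    [Nonempty V] (h : V ≤ U) : f.regularAbove U ≤ f.regularAbove V := by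
  have := f.nonempty_preimage U
  have := f.nonempty_preimage V
  rintro _ ⟨b, rfl⟩
  refine ⟨X.scheme.presheaf.map (homOfLE (f.hom.preimage_mono h)).op b, ?_⟩
  exact TopCat.Presheaf.germ_res_apply X.scheme.presheaf _ _ _ b

/-- Every function is regular above `U` up to a denominator from the base. -/
lemma exists_mul_mem_regularAbove (f : BranchedCovering X Y) {U : Y.scheme.Opens}
    (hU : IsAffineOpen U) [Nonempty U] (x : X.scheme.functionField) :
    ∃ a : Γ(Y.scheme, U), a ≠ 0 ∧ f.functionFieldMap (algebraMap _ _ a) * x ∈ f.regularAbove U := by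
  have := f.nonempty_preimage U
  have hV : IsAffineOpen (f.hom ⁻¹ᵁ U) := hU.preimage f.hom
  have := functionField_isFractionRing_of_isAffineOpen Y.scheme U hU
  have := functionField_isFractionRing_of_isAffineOpen X.scheme _ hV
  have := X.isDedekindDomain hV
  let _ : Algebra Γ(Y.scheme, U) Γ(X.scheme, f.hom ⁻¹ᵁ U) := (f.hom.app U).hom.toAlgebra
  let _ : Algebra Y.scheme.functionField X.scheme.functionField := f.functionFieldMap.toAlgebra
  let _ : Algebra Γ(Y.scheme, U) X.scheme.functionField :=
    ((algebraMap Γ(X.scheme, f.hom ⁻¹ᵁ U) X.scheme.functionField).comp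
      (f.hom.app U).hom).toAlgebra
  have : IsScalarTower Γ(Y.scheme, U) Γ(X.scheme, f.hom ⁻¹ᵁ U) X.scheme.functionField :=
    .of_algebraMap_eq' rfl
  have : IsScalarTower Γ(Y.scheme, U) Y.scheme.functionField X.scheme.functionField :=
    .of_algebraMap_eq fun a => (f.functionFieldMap_algebraMap U a).symm
  have : Module.Finite Y.scheme.functionField X.scheme.functionField := f.functionFieldMap_finite
  have hx : IsAlgebraic Γ(Y.scheme, U) x :=
    (IsFractionRing.isAlgebraic_iff _ Y.scheme.functionField _).mpr
      (Algebra.IsAlgebraic.isAlgebraic x)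
  obtain ⟨a, ha, hint⟩ := hx.exists_integral_multiple
  obtain ⟨b, hb⟩ := IsIntegrallyClosed.isIntegral_iff.mp
    (hint.tower_top (A := Γ(X.scheme, f.hom ⁻¹ᵁ U)))
  refine ⟨a, ha, b, hb.trans ?_⟩
  rw [Algebra.smul_def, IsScalarTower.algebraMap_apply _ Y.scheme.functionField]
  rfl

lemma exists_pow_mul_mem_regularAbove (f : BranchedCovering X Y) {U : Y.scheme.Opens}
    (hU : IsAffineOpen U) [Nonempty U] (a : Γ(Y.scheme, U)) [Nonempty (Y.scheme.basicOpen a)]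
    {x : X.scheme.functionField} (hx : x ∈ f.regularAbove (Y.scheme.basicOpen a)) :
    ∃ n : ℕ, f.functionFieldMap (algebraMap _ _ a) ^ n * x ∈ f.regularAbove U := by
  have := f.nonempty_preimage U
  have := f.nonempty_preimage (Y.scheme.basicOpen a)
  obtain ⟨b, rfl⟩ := hx
  have hloc := (hU.preimage f.hom).isLocalization_of_eq_basicOpen (f.hom.app U a)
    (homOfLE (f.hom.preimage_mono (Y.scheme.basicOpen_le a))) (f.hom.preimage_basicOpen a)
  let _ := (X.scheme.presheaf.map
    (homOfLE (f.hom.preimage_mono (Y.scheme.basicOpen_le a))).op).hom.toAlgebra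
  obtain ⟨⟨c, ⟨_, n, rfl⟩⟩, hc⟩ := IsLocalization.surj (Submonoid.powers (f.hom.app U a)) b
  refine ⟨n, c, ?_⟩
  have hres : ∀ c : Γ(X.scheme, f.hom ⁻¹ᵁ U), algebraMap Γ(X.scheme, f.hom ⁻¹ᵁ Y.scheme.basicOpen a)
      X.scheme.functionField (algebraMap _ _ c) = algebraMap _ X.scheme.functionField c :=
    fun c => TopCat.Presheaf.germ_res_apply X.scheme.presheaf _ _ _ c
  have h1 := congrArg (algebraMap Γ(X.scheme, f.hom ⁻¹ᵁ Y.scheme.basicOpen a)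
      X.scheme.functionField) hc
  rw [map_mul, hres, hres, map_pow, ← f.functionFieldMap_algebraMap U a] at h1
  rw [← h1, mul_comm]

/-- The sections above a nonempty affine open subset are finite over the base. -/
lemma exists_forall_mul_mem (f : BranchedCovering X Y) {U : Y.scheme.Opens}
    (hU : IsAffineOpen U) [Nonempty U] (S : Subring X.scheme.functionField)
    (hS : ∀ a : Γ(Y.scheme, U), f.functionFieldMap (algebraMap _ _ a) ∈ S)
    (h : ∀ x, ∃ a : Γ(Y.scheme, U), a ≠ 0 ∧ f.functionFieldMap (algebraMap _ _ a) * x ∈ S) :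
    ∃ a : Γ(Y.scheme, U), a ≠ 0 ∧ ∀ x ∈ f.regularAbove U,
      f.functionFieldMap (algebraMap _ _ a) * x ∈ S := by
  have := f.nonempty_preimage U
  let _ : Algebra Γ(Y.scheme, U) Γ(X.scheme, f.hom ⁻¹ᵁ U) := (f.hom.app U).hom.toAlgebra
  have hfin : Module.Finite Γ(Y.scheme, U) Γ(X.scheme, f.hom ⁻¹ᵁ U) := f.hom.finite_app U hU
  obtain ⟨s, hs⟩ := hfin.fg_top
  choose d hd0 hd using h
  -- A common denominator: the product of the denominators of a finite set of module generators.
  refine ⟨∏ b ∈ s, d (algebraMap _ _ b), Finset.prod_ne_zero_iff.mpr fun b _ => hd0 _, ?_⟩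
  rintro _ ⟨b, rfl⟩
  classical
  have hb : b ∈ Submodule.span Γ(Y.scheme, U) (s : Set Γ(X.scheme, f.hom ⁻¹ᵁ U)) :=
    hs ▸ Submodule.mem_top
  induction hb using Submodule.span_induction with
  | zero => simp [S.zero_mem]
  | add x y _ _ hx hy => rw [map_add, mul_add]; exact S.add_mem hx hy
  | smul c x _ hx =>
    have : algebraMap _ X.scheme.functionField (c • x) =
        f.functionFieldMap (algebraMap _ _ c) * algebraMap _ X.scheme.functionField x := by
      rw [Algebra.smul_def, map_mul, f.functionFieldMap_algebraMap U c]
      rfl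
    rw [this, mul_left_comm]
    exact S.mul_mem (hS c) hx
  | mem x hx =>
    rw [← Finset.prod_erase_mul s _ hx, map_mul, map_mul, mul_assoc]
    exact S.mul_mem (hS _) (hd _)

/-- A square of coverings is a pullback as soon as the square of function fields is a pushout. -/
theorem isPullbackAlong_of_isPushout_functionFieldMap (w : BranchedCovering W Z)
    (f : BranchedCovering X Y) (g : BranchedCovering Z Y) (p : BranchedCovering W X)
    (comm : f.comp p = g.comp w)
    (h : IsPushout (CommRingCat.ofHom f.functionFieldMap) (CommRingCat.ofHom g.functionFieldMap)
      (CommRingCat.ofHom p.functionFieldMap) (CommRingCat.ofHom w.functionFieldMap)) :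
    w.IsPullbackAlong f g := by
  obtain ⟨U, hU, hη⟩ := exists_nonempty_isAffineOpen Y.scheme (genericPoint Y.scheme)
  have hUne : Nonempty U := ⟨_, hη⟩
  have hcomm : p.functionFieldMap.comp f.functionFieldMap =
      w.functionFieldMap.comp g.functionFieldMap := by
    rw [← functionFieldMap_comp, comm, functionFieldMap_comp]
  let _ : Algebra Y.scheme.functionField X.scheme.functionField := f.functionFieldMap.toAlgebra
  let _ : Algebra Y.scheme.functionField Z.scheme.functionField := g.functionFieldMap.toAlgebra
  let _ : Algebra X.scheme.functionField W.scheme.functionField := p.functionFieldMap.toAlgebra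
  let _ : Algebra Z.scheme.functionField W.scheme.functionField := w.functionFieldMap.toAlgebra
  let _ : Algebra Y.scheme.functionField W.scheme.functionField :=
    (p.functionFieldMap.comp f.functionFieldMap).toAlgebra
  have : IsScalarTower Y.scheme.functionField X.scheme.functionField W.scheme.functionField :=
    .of_algebraMap_eq' rfl
  have : IsScalarTower Y.scheme.functionField Z.scheme.functionField W.scheme.functionField :=
    .of_algebraMap_eq' hcomm
  have hp := CommRingCat.isPushout_iff_isPushout.mp h
  -- The subring generated by the functions coming from `X` and from `Z`. It is contained in the
  -- functions of `W` regular above `V`; the aim is to shrink `U` until the two agree.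
  let S (V : Y.scheme.Opens) [Nonempty V] : Subring W.scheme.functionField :=
    (f.regularAbove V).map p.functionFieldMap ⊔ (g.regularAbove V).map w.functionFieldMap
  have hSA (V : Y.scheme.Opens) [Nonempty V] (a : Γ(Y.scheme, V)) :
      (f.comp p).functionFieldMap (algebraMap _ _ a) ∈ S V := by
    refine le_sup_left (a := (f.regularAbove V).map p.functionFieldMap)
      ⟨_, f.functionFieldMap_mem_regularAbove V a, ?_⟩
    rw [functionFieldMap_comp]; rfl
  have hgen : ∀ x, ∃ a : Γ(Y.scheme, U), a ≠ 0 ∧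
      (f.comp p).functionFieldMap (algebraMap _ _ a) * x ∈ S U := by
    intro x
    obtain ⟨t, rfl⟩ := (Algebra.IsPushout.equiv Y.scheme.functionField X.scheme.functionField
      Z.scheme.functionField W.scheme.functionField).surjective x
    induction t with
    | zero => exact ⟨1, one_ne_zero, by simp [(S U).zero_mem]⟩
    | add x y hx hy =>
      obtain ⟨a, ha, hax⟩ := hx
      obtain ⟨b, hb, hby⟩ := hy
      refine ⟨a * b, mul_ne_zero ha hb, ?_⟩
      rw [map_add, mul_add, map_mul, map_mul]
      refine (S U).add_mem ?_ ?_
      · rw [mul_right_comm]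
        exact (S U).mul_mem hax (hSA U b)
      · rw [mul_assoc]
        exact (S U).mul_mem (hSA U a) hby
    | tmul l e =>
      obtain ⟨a, ha, hal⟩ := f.exists_mul_mem_regularAbove hU l
      obtain ⟨b, hb, hbe⟩ := g.exists_mul_mem_regularAbove hU e
      refine ⟨a * b, mul_ne_zero ha hb, ?_⟩
      have h1 : (f.comp p).functionFieldMap (algebraMap _ _ (a * b)) *
          Algebra.IsPushout.equiv Y.scheme.functionField X.scheme.functionField
            Z.scheme.functionField W.scheme.functionField (l ⊗ₜ e) =
          p.functionFieldMap (f.functionFieldMap (algebraMap _ _ a) * l) *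
            w.functionFieldMap (g.functionFieldMap (algebraMap _ _ b) * e) := by
        have h2 : w.functionFieldMap (g.functionFieldMap (algebraMap _ _ b)) =
          p.functionFieldMap (f.functionFieldMap (algebraMap _ _ b)) :=
            (RingHom.congr_fun hcomm _).symm
        rw [Algebra.IsPushout.equiv_tmul, functionFieldMap_comp]
        simp only [map_mul, h2]
        change p.functionFieldMap (f.functionFieldMap _) * p.functionFieldMap (f.functionFieldMap _)
          * (p.functionFieldMap l * w.functionFieldMap e) = _
        ring
      rw [h1]
      exact (S U).mul_mem (le_sup_left (a := (f.regularAbove U).map p.functionFieldMap)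
        ⟨_, hal, rfl⟩) (le_sup_right (b := (g.regularAbove U).map w.functionFieldMap) ⟨_, hbe, rfl⟩)
  -- By finiteness one denominator `a` serves for all functions of `W` regular above `U`; it becomes
  -- invertible on the basic open set `V`.
  obtain ⟨a, ha, haS⟩ := (f.comp p).exists_forall_mul_mem hU (S U) (hSA U) hgen
  let V := Y.scheme.basicOpen a
  have hV : IsAffineOpen V := hU.basicOpen a
  have hVU : V ≤ U := Y.scheme.basicOpen_le a
  have hVne : Nonempty V := by
    by_contra hemp
    refine ha ((basicOpen_eq_bot_iff a).mp ?_)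
    ext x
    simp only [TopologicalSpace.Opens.coe_bot, Set.mem_empty_iff_false, iff_false]
    exact fun hx => hemp ⟨⟨x, hx⟩⟩
  have hUV : S U ≤ S V := sup_le_sup ((Subring.gc_map_comap _).monotone_l (f.regularAbove_mono hVU))
    ((Subring.gc_map_comap _).monotone_l (g.regularAbove_mono hVU))
  have hsurj : (f.comp p).regularAbove V ≤ S V := by
    intro x hx
    obtain ⟨n, hn⟩ := (f.comp p).exists_pow_mul_mem_regularAbove hU a hx
    have h1 := hUV (haS _ hn)
    obtain ⟨b, hb⟩ : ∃ b : Γ(Y.scheme, V), b * Y.scheme.presheaf.map (homOfLE hVU).op a = 1 :=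
      (RingedSpace.isUnit_res_basicOpen Y.scheme.toRingedSpace a).exists_left_inv
    have h2 : algebraMap Γ(Y.scheme, V) Y.scheme.functionField b *
        algebraMap Γ(Y.scheme, U) Y.scheme.functionField a = 1 := by
      have h3 := congrArg (algebraMap Γ(Y.scheme, V) Y.scheme.functionField) hb
      rw [map_mul, map_one] at h3
      rw [← h3]
      congr 1
      exact (TopCat.Presheaf.germ_res_apply Y.scheme.presheaf _ _ _ a).symm
    have h4 := (S V).mul_mem (Subring.pow_mem _ (hSA V b) (n + 1)) h1
    rw [← mul_assoc, ← mul_assoc, mul_assoc (_ ^ _), ← pow_succ', ← mul_pow, ← map_mul, h2, map_one,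
      one_pow, one_mul] at h4
    exact h4
  have hle : p.hom ⁻¹ᵁ (f.hom ⁻¹ᵁ V) ≤ w.hom ⁻¹ᵁ (g.hom ⁻¹ᵁ V) :=
    (congrArg (fun m : W.scheme ⟶ Y.scheme => m ⁻¹ᵁ V) (congrArg BranchedCovering.hom comm)).le
  refine isPullbackAlong_of_isPushout w f g p comm hV hle ?_
  have := f.nonempty_preimage V
  have := g.nonempty_preimage V
  have := p.nonempty_preimage (f.hom ⁻¹ᵁ V)
  have := w.nonempty_preimage (g.hom ⁻¹ᵁ V)
  have hres : ∀ c, algebraMap Γ(W.scheme, p.hom ⁻¹ᵁ (f.hom ⁻¹ᵁ V)) W.scheme.functionField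
      (w.hom.appLE (g.hom ⁻¹ᵁ V) _ hle c) =
      w.functionFieldMap (algebraMap Γ(Z.scheme, g.hom ⁻¹ᵁ V) Z.scheme.functionField c) := by
    intro c
    rw [w.functionFieldMap_algebraMap]
    exact TopCat.Presheaf.germ_res_apply W.scheme.presheaf _ _ _ (w.hom.app (g.hom ⁻¹ᵁ V) c)
  let _ : Algebra Γ(Y.scheme, V) Γ(X.scheme, f.hom ⁻¹ᵁ V) := (f.hom.app V).hom.toAlgebra
  let _ : Algebra Γ(Y.scheme, V) Γ(Z.scheme, g.hom ⁻¹ᵁ V) := (g.hom.app V).hom.toAlgebra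
  let _ : Algebra Γ(X.scheme, f.hom ⁻¹ᵁ V) Γ(W.scheme, p.hom ⁻¹ᵁ (f.hom ⁻¹ᵁ V)) :=
    (p.hom.app (f.hom ⁻¹ᵁ V)).hom.toAlgebra
  let _ : Algebra Γ(Z.scheme, g.hom ⁻¹ᵁ V) Γ(W.scheme, p.hom ⁻¹ᵁ (f.hom ⁻¹ᵁ V)) :=
    (w.hom.appLE (g.hom ⁻¹ᵁ V) _ hle).hom.toAlgebra
  let _ : Algebra Γ(Y.scheme, V) Γ(W.scheme, p.hom ⁻¹ᵁ (f.hom ⁻¹ᵁ V)) :=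
    (f.hom.app V ≫ p.hom.app (f.hom ⁻¹ᵁ V)).hom.toAlgebra
  have : IsScalarTower Γ(Y.scheme, V) Γ(X.scheme, f.hom ⁻¹ᵁ V)
    Γ(W.scheme, p.hom ⁻¹ᵁ (f.hom ⁻¹ᵁ V)) := .of_algebraMap_eq' rfl
  have : IsScalarTower Γ(Y.scheme, V) Γ(Z.scheme, g.hom ⁻¹ᵁ V)
    Γ(W.scheme, p.hom ⁻¹ᵁ (f.hom ⁻¹ᵁ V)) := by
      refine .of_algebraMap_eq' (congrArg CommRingCat.Hom.hom
        (?_ : f.hom.app V ≫ p.hom.app _ = g.hom.app V ≫ w.hom.appLE (g.hom ⁻¹ᵁ V) _ hle))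
      rw [Scheme.Hom.app_eq_appLE, Scheme.Hom.app_eq_appLE, Scheme.Hom.app_eq_appLE,
        Scheme.Hom.appLE_comp_appLE, Scheme.Hom.appLE_comp_appLE]
      have h1 : p.hom ≫ f.hom = w.hom ≫ g.hom := congrArg BranchedCovering.hom comm
      simp only [h1]
  suffices hp : Algebra.IsPushout Γ(Y.scheme, V) Γ(X.scheme, f.hom ⁻¹ᵁ V)
    Γ(Z.scheme, g.hom ⁻¹ᵁ V) Γ(W.scheme, p.hom ⁻¹ᵁ (f.hom ⁻¹ᵁ V)) from
      CommRingCat.isPushout_of_isPushout Γ(Y.scheme, V) Γ(X.scheme, f.hom ⁻¹ᵁ V)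
        Γ(Z.scheme, g.hom ⁻¹ᵁ V) Γ(W.scheme, p.hom ⁻¹ᵁ (f.hom ⁻¹ᵁ V))
  let ψ : Γ(X.scheme, f.hom ⁻¹ᵁ V) ⊗[Γ(Y.scheme, V)] Γ(Z.scheme, g.hom ⁻¹ᵁ V) →ₐ[Γ(X.scheme, f.hom ⁻¹ᵁ V)]
      Γ(W.scheme, p.hom ⁻¹ᵁ (f.hom ⁻¹ᵁ V)) :=
    Algebra.TensorProduct.lift (Algebra.ofId _ _) (IsScalarTower.toAlgHom _ _ _)
      fun _ _ => Commute.all _ _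
  have hψ : ∀ b c, ψ (b ⊗ₜ c) = algebraMap _ _ b * algebraMap _ _ c := fun b c =>
    Algebra.TensorProduct.lift_tmul ..
  let ι := algebraMap Γ(W.scheme, p.hom ⁻¹ᵁ (f.hom ⁻¹ᵁ V)) W.scheme.functionField
  have hιψ : ∀ b c, ι (ψ (b ⊗ₜ c)) = p.functionFieldMap (algebraMap _ _ b) *
      w.functionFieldMap (algebraMap _ _ c) := by
    intro b c
    rw [hψ, map_mul]
    congr 1
    · exact (p.functionFieldMap_algebraMap _ b).symm
    · exact hres c
  have hι : Function.Injective ι := W.scheme.germToFunctionField_injective _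
  have hinj : Function.Injective ψ := by
    have := functionField_isFractionRing_of_isAffineOpen Y.scheme V hV
    have : Module.Flat Γ(Y.scheme, V) Γ(Z.scheme, g.hom ⁻¹ᵁ V) := by
      have h1 := g.hom.flat_appLE hV (hV.preimage g.hom) le_rfl
      rw [← Scheme.Hom.app_eq_appLE] at h1
      exact h1
    refine Function.Injective.of_comp (f := ι) ?_
    exact Algebra.TensorProduct.injective_of_isPushout_fractionRing
      (F := Y.scheme.functionField)
      (algebraMap Γ(X.scheme, f.hom ⁻¹ᵁ V) X.scheme.functionField)
      (algebraMap Γ(Z.scheme, g.hom ⁻¹ᵁ V) Z.scheme.functionField)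
      (X.scheme.germToFunctionField_injective _) (Z.scheme.germToFunctionField_injective _)
      (fun a => (f.functionFieldMap_algebraMap V a).symm)
      (fun a => (g.functionFieldMap_algebraMap V a).symm) (ι.comp ψ.toRingHom) hιψ
  have hsur : Function.Surjective ψ := by
    intro r
    have hr : ι r ∈ S V := hsurj ⟨r, rfl⟩
    have hle2 : S V ≤ (ι.comp ψ.toRingHom).range := by
      refine sup_le ?_ ?_
      · rintro _ ⟨_, ⟨b, rfl⟩, rfl⟩
        refine ⟨b ⊗ₜ 1, (hιψ b 1).trans ?_⟩
        rw [map_one, map_one, mul_one]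
      · rintro _ ⟨_, ⟨c, rfl⟩, rfl⟩
        refine ⟨1 ⊗ₜ c, (hιψ 1 c).trans ?_⟩
        rw [map_one, map_one, one_mul]
    obtain ⟨t, ht⟩ := hle2 hr
    exact ⟨t, hι ht⟩
  exact Algebra.IsPushout.of_bijective ⟨hinj, hsur⟩

end BranchedCovering

/-! ### Galois theory with embeddings and stabilizers -/

section Galois

open IntermediateField

lemma Subgroup.map_normalCore_mulEquiv {G G' : Type*} [Group G] [Group G'] (e : G ≃* G')
    (H : Subgroup G) : H.normalCore.map e.toMonoidHom = (H.map e.toMonoidHom).normalCore := by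
  ext x
  constructor
  · rintro ⟨a, ha, rfl⟩ b
    obtain ⟨c, rfl⟩ := e.surjective b
    exact ⟨c * a * c⁻¹, ha c, by simp⟩
  · intro hx
    refine ⟨e.symm x, fun b => ?_, by simp⟩
    obtain ⟨a, ha, hab⟩ := hx (e b)
    have : a = b * e.symm x * b⁻¹ := e.injective (hab.trans (by simp))
    exact this ▸ ha

section NormalClosure

variable {K E Ω : Type*} [Field K] [Field E] [Field Ω] [Algebra K E] [Algebra K Ω]

lemma AlgHom.exists_gal_apply_eq [Normal K Ω] (σ f : E →ₐ[K] Ω) :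
    ∃ τ : Gal(Ω/K), ∀ x, τ (σ x) = f x := by
  let _ : Algebra E Ω := σ.toRingHom.toAlgebra
  have : IsScalarTower K E Ω := .of_algebraMap_eq fun a => (σ.commutes a).symm
  let τ : Ω →ₐ[K] Ω := f.liftNormal Ω
  refine ⟨(Algebra.IsAlgebraic.algEquivEquivAlgHom K Ω).symm τ, fun x => ?_⟩
  have h := f.liftNormal_commutes Ω x
  exact h

/-- The normal closure is generated by the images of `E` under all embeddings; these are the
translates of `σ` by automorphisms of `Ω`, so their common stabilizer is the intersection of
conjugates. -/
lemma fixingSubgroup_normalClosure [Normal K Ω] (σ : E →ₐ[K] Ω) :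
    (normalClosure K E Ω).fixingSubgroup = σ.fieldRange.fixingSubgroup.normalCore := by
  have : Algebra.IsAlgebraic K E := Algebra.IsAlgebraic.of_injective σ σ.injective
  ext g
  constructor
  · rintro hg τ
    rintro ⟨_, ⟨x, rfl⟩⟩
    have h1 : τ⁻¹ (σ x) ∈ normalClosure K E Ω :=
      ((τ⁻¹ : Gal(Ω/K)).toAlgHom.comp σ).fieldRange_le_normalClosure ⟨x, rfl⟩
    have h2 : g (τ⁻¹ (σ x)) = τ⁻¹ (σ x) := hg ⟨_, h1⟩
    change τ (g (τ⁻¹ (σ x))) = σ x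
    rw [h2]
    exact τ.apply_symm_apply _
  · intro hg
    have h : normalClosure K E Ω ≤ fixedField (Subgroup.zpowers g) := by
      rw [normalClosure_le_iff]
      rintro f _ ⟨x, rfl⟩
      obtain ⟨τ, hτ⟩ := σ.exists_gal_apply_eq f
      have h1 : (τ⁻¹ * g * τ) (σ x) = σ x := by
        have := hg τ⁻¹
        rw [inv_inv] at this
        exact this ⟨σ x, x, rfl⟩
      have h2 : g (f x) = f x := by
        rw [← hτ]
        exact (τ.symm_apply_eq).mp h1
      rintro ⟨_, n, rfl⟩
      exact (Subgroup.zpow_mem (MulAction.stabilizer Gal(Ω/K) (f x)) h2 n : _)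
    rw [le_iff_le] at h
    exact h (Subgroup.mem_zpowers g)

lemma nonempty_gal_normalClosure_mulEquiv [Normal K Ω] (σ : E →ₐ[K] Ω) :
    Nonempty (Gal(normalClosure K E (AlgebraicClosure E) / K) ≃*
      Gal(Ω/K) ⧸ σ.fieldRange.fixingSubgroup.normalCore) := by
  have : Algebra.IsAlgebraic K E := Algebra.IsAlgebraic.of_injective σ σ.injective
  have : Algebra.IsAlgebraic K (AlgebraicClosure E) := Algebra.IsAlgebraic.trans K E _
  have : IsAlgClosure K (AlgebraicClosure E) := ⟨inferInstance, inferInstance⟩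
  have : Normal K (AlgebraicClosure E) := IsAlgClosure.normal K _
  have : Nonempty (E →ₐ[K] AlgebraicClosure E) := ⟨IsScalarTower.toAlgHom _ _ _⟩
  have : Nonempty (E →ₐ[K] Ω) := ⟨σ⟩
  let e : normalClosure K E (AlgebraicClosure E) ≃ₐ[K] normalClosure K E Ω :=
    IsNormalClosure.equiv (K := E)
  let φ := AlgEquiv.restrictNormalHom (F := K) (K₁ := Ω) (normalClosure K E Ω)
  have hφ : Function.Surjective φ := AlgEquiv.restrictNormalHom_surjective Ω
  have hker : φ.ker = σ.fieldRange.fixingSubgroup.normalCore :=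
    (restrictNormalHom_ker _).trans (fixingSubgroup_normalClosure σ)
  exact ⟨(AlgEquiv.autCongr e).trans ((QuotientGroup.quotientKerEquivOfSurjective φ hφ).symm.trans
    (QuotientGroup.quotientMulEquivOfEq hker))⟩

end NormalClosure

section Fixer

variable (F : Type*) {E L Ω : Type*} [Field F] [Field E] [Field L] [Field Ω] [Algebra F Ω]

/-- The automorphisms of `Ω / F` fixing the image of an embedding into `Ω`. -/
def RingHom.fixer (σ : E →+* Ω) : Subgroup Gal(Ω/F) where
  carrier := {g | ∀ x, g (σ x) = σ x}
  mul_mem' {g h} hg hh x := by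
    change g (h (σ x)) = σ x
    rw [hh x, hg x]
  one_mem' _ := rfl
  inv_mem' {g} hg x := by
    change g.symm (σ x) = σ x
    rw [AlgEquiv.symm_apply_eq, hg x]

variable {F}

lemma RingHom.fixer_algebraMap : (algebraMap F Ω).fixer F = ⊤ :=
  top_unique fun g _ x => g.commutes x

lemma RingHom.fixer_le_fixer_comp (σ : E →+* Ω) (τ : L →+* E) : σ.fixer F ≤ (σ.comp τ).fixer F :=
  fun _ hg x => hg (τ x)

/-- The image of an embedding over `F` as an intermediate field. -/
def RingHom.imageField (σ : E →+* Ω) (hσ : ∀ a, algebraMap F Ω a ∈ σ.fieldRange) :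
    IntermediateField F Ω :=
  { σ.fieldRange with algebraMap_mem' := hσ }

lemma RingHom.fixingSubgroup_imageField (σ : E →+* Ω) (hσ) :
    (σ.imageField (F := F) hσ).fixingSubgroup = σ.fixer F := by
  ext g
  exact ⟨fun h x => h ⟨σ x, x, rfl⟩, by rintro h ⟨_, x, rfl⟩; exact h x⟩

lemma AlgHom.fixingSubgroup_fieldRange [Algebra F E] (σ : E →ₐ[F] Ω) :
    σ.fieldRange.fixingSubgroup = σ.toRingHom.fixer F :=
  σ.toRingHom.fixingSubgroup_imageField fun a => ⟨algebraMap F E a, σ.commutes a⟩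

/-- By the Galois correspondence the image of `τ` lies in the image of `σ`, so `τ` can be lifted
through `σ`. -/
lemma RingHom.exists_comp_eq_of_fixer_le [FiniteDimensional F Ω] [IsGalois F Ω] (σ : E →+* Ω)
    (τ : L →+* Ω) (hσ : ∀ a, algebraMap F Ω a ∈ σ.fieldRange)
    (hτ : ∀ a, algebraMap F Ω a ∈ τ.fieldRange) (h : σ.fixer F ≤ τ.fixer F) :
    ∃ ψ : L →+* E, σ.comp ψ = τ := by
  rw [← σ.fixingSubgroup_imageField hσ, ← τ.fixingSubgroup_imageField hτ] at h
  have h1 : τ.imageField hτ ≤ σ.imageField hσ := by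
    rw [← IsGalois.fixedField_fixingSubgroup (τ.imageField hτ),
      ← IsGalois.fixedField_fixingSubgroup (σ.imageField hσ)]
    exact fixedField_antitone h
  have h2 : ∀ x, τ x ∈ σ.fieldRange := fun x => h1 (show τ x ∈ τ.imageField hτ from ⟨x, rfl⟩)
  let e : E ≃+* σ.fieldRange := RingEquiv.ofBijective σ.rangeRestrictField
    ⟨σ.rangeRestrictField.injective, σ.rangeRestrictField_bijective.2⟩
  refine ⟨e.symm.toRingHom.comp (τ.codRestrict σ.fieldRange h2), ?_⟩
  ext x
  exact congrArg Subtype.val (e.apply_symm_apply ⟨τ x, h2 x⟩)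

/-- Automorphisms over an intermediate field, as automorphisms over the base. -/
def RingHom.galEquivFixer {K : Type*} [Field K] [Algebra K Ω]
    (hK : ∀ a, algebraMap F Ω a ∈ (algebraMap K Ω).fieldRange) :
    Gal(Ω/K) ≃* (algebraMap K Ω).fixer F where
  toFun g := ⟨AlgEquiv.ofRingEquiv (f := g.toRingEquiv) fun a => by
    obtain ⟨b, hb⟩ := hK a
    rw [← hb]
    exact g.commutes b, g.commutes⟩
  invFun g := AlgEquiv.ofRingEquiv (f := g.1.toRingEquiv) g.2
  left_inv _ := rfl
  right_inv _ := rfl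
  map_mul' _ _ := rfl

lemma RingHom.map_galEquivFixer_fixer {K : Type*} [Field K] [Algebra K Ω]
    (hK : ∀ a, algebraMap F Ω a ∈ (algebraMap K Ω).fieldRange) (σ : E →+* Ω) :
    (σ.fixer K).map (RingHom.galEquivFixer hK).toMonoidHom =
      (σ.fixer F).subgroupOf ((algebraMap K Ω).fixer F) := by
  ext g
  constructor
  · rintro ⟨g, hg, rfl⟩ x
    exact hg x
  · intro hg
    exact ⟨(RingHom.galEquivFixer hK).symm g, hg, by simp⟩

end Fixer

end Galois

lemma IsNormalClosure.of_algEquiv {F K L L' : Type*} [Field F] [Field K] [Field L] [Field L']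
    [Algebra F K] [Algebra F L] [Algebra F L'] [Algebra.IsAlgebraic F K] [IsNormalClosure F K L]
    (e : L ≃ₐ[F] L') : IsNormalClosure F K L' := by
  rw [Algebra.IsAlgebraic.isNormalClosure_iff]
  obtain ⟨h1, h2⟩ := Algebra.IsAlgebraic.isNormalClosure_iff.mp ‹IsNormalClosure F K L›
  refine ⟨fun x => ?_, top_unique fun y _ => ?_⟩
  · have h3 := (h1 x).map e.toRingEquiv.toRingHom
    rw [Polynomial.map_map] at h3
    convert h3
    exact (e.toAlgHom.comp_algebraMap).symm
  · obtain ⟨x, rfl⟩ := e.surjective y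
    have h3 : IntermediateField.normalClosure F K L ≤
        (IntermediateField.normalClosure F K L').comap e.toAlgHom := by
      rw [normalClosure_le_iff]
      rintro f _ ⟨a, rfl⟩
      exact (e.toAlgHom.comp f).fieldRange_le_normalClosure ⟨a, rfl⟩
    exact h3 (h2 ▸ IntermediateField.mem_top)

/-! ### The dictionary between coverings and subgroups -/

namespace BranchedCovering

variable {k : Type u} [Field k] {B X Y Z : CurveOver k} {Ω : Type u} [Field Ω]
  [Algebra B.scheme.functionField Ω]

/-- An embedding of the function field of a covering of `B` into an extension of `k(B)`, over
`k(B)`. -/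
def IsEmbedding (c : BranchedCovering X B) (σ : X.scheme.functionField →+* Ω) : Prop :=
  σ.comp c.functionFieldMap = algebraMap B.scheme.functionField Ω

lemma IsEmbedding.mem_fieldRange {c : BranchedCovering X B} {σ : X.scheme.functionField →+* Ω}
    (h : c.IsEmbedding σ) (a : B.scheme.functionField) : algebraMap _ Ω a ∈ σ.fieldRange :=
  ⟨c.functionFieldMap a, RingHom.congr_fun h a⟩

lemma IsEmbedding.comp {c : BranchedCovering Y B} {f : BranchedCovering X Y}
    {σ : X.scheme.functionField →+* Ω} (h : (c.comp f).IsEmbedding σ) :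
    c.IsEmbedding (σ.comp f.functionFieldMap) := by
  rw [IsEmbedding, functionFieldMap_comp, ← RingHom.comp_assoc] at h
  exact h

lemma IsEmbedding.of_comp {c : BranchedCovering Y B} {f : BranchedCovering X Y}
    {σ : X.scheme.functionField →+* Ω} (h : c.IsEmbedding (σ.comp f.functionFieldMap)) :
    (c.comp f).IsEmbedding σ := by
  rw [IsEmbedding, functionFieldMap_comp, ← RingHom.comp_assoc]
  exact h

lemma refl_comp (c : BranchedCovering X Y) : (refl Y).comp c = c :=
  BranchedCovering.ext (Category.comp_id _)

/-- The Galois correspondence: every subgroup of the Galois group is given by a covering. -/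
lemma exists_isEmbedding_fixer_eq [CharZero k] [FiniteDimensional B.scheme.functionField Ω]
    (V : Subgroup Gal(Ω/B.scheme.functionField)) :
    ∃ (Z : CurveOver k) (c : BranchedCovering Z B) (σ : Z.scheme.functionField →+* Ω),
      c.IsEmbedding σ ∧ σ.fixer B.scheme.functionField = V := by
  obtain ⟨Z, c, e, he⟩ := B.exists_covering (M := IntermediateField.fixedField V)
    (φ := algebraMap _ _) (RingHom.finite_algebraMap.mpr inferInstance)
  refine ⟨Z, c, (IntermediateField.val _).toRingHom.comp e.toRingHom, ?_, ?_⟩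
  · rw [IsEmbedding, RingHom.comp_assoc, he]
    rfl
  · refine Eq.trans ?_ (IntermediateField.fixingSubgroup_fixedField V)
    ext g
    constructor
    · intro hg y
      obtain ⟨x, hx⟩ := e.surjective y
      rw [← hx]
      exact hg x
    · exact fun hg x => hg (e x)

variable [IsGalois B.scheme.functionField Ω]

lemma IsEmbedding.nonempty_mon_mulEquiv {c : BranchedCovering X B}
    {σ : X.scheme.functionField →+* Ω} (h : c.IsEmbedding σ) :
    Nonempty (c.Mon ≃* Gal(Ω/B.scheme.functionField) ⧸
      (σ.fixer B.scheme.functionField).normalCore) := by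
  let _ : Algebra B.scheme.functionField X.scheme.functionField := c.functionFieldMap.toAlgebra
  let σ' : X.scheme.functionField →ₐ[B.scheme.functionField] Ω :=
    { σ with commutes' := RingHom.congr_fun h }
  have h1 : σ'.fieldRange.fixingSubgroup = σ.fixer B.scheme.functionField :=
    σ'.fixingSubgroup_fieldRange
  obtain ⟨e⟩ := nonempty_gal_normalClosure_mulEquiv σ'
  rw [h1] at e
  exact ⟨e⟩

/-- Through `σ`, the field `Ω` is also Galois over the function field of `Y`, with group the
stabilizer of that field. -/
lemma IsEmbedding.nonempty_mon_mulEquiv_of_comp {c : BranchedCovering Y B}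
    {f : BranchedCovering X Y} {σ : X.scheme.functionField →+* Ω} (h : (c.comp f).IsEmbedding σ) :
    Nonempty (f.Mon ≃* (σ.comp f.functionFieldMap).fixer B.scheme.functionField ⧸
      ((σ.fixer B.scheme.functionField).subgroupOf
        ((σ.comp f.functionFieldMap).fixer B.scheme.functionField)).normalCore) := by
  let _ : Algebra B.scheme.functionField Y.scheme.functionField := c.functionFieldMap.toAlgebra
  let _ : Algebra Y.scheme.functionField Ω := (σ.comp f.functionFieldMap).toAlgebra
  have : IsScalarTower B.scheme.functionField Y.scheme.functionField Ω :=
    .of_algebraMap_eq' h.comp.symm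
  have : IsGalois Y.scheme.functionField Ω :=
    IsGalois.tower_top_of_isGalois B.scheme.functionField _ _
  obtain ⟨e⟩ := IsEmbedding.nonempty_mon_mulEquiv (c := f) (σ := σ) rfl
  let e' := RingHom.galEquivFixer (F := B.scheme.functionField) (Ω := Ω)
    (K := Y.scheme.functionField) h.comp.mem_fieldRange
  refine ⟨e.trans (QuotientGroup.congr _ _ e' ?_)⟩
  refine (Subgroup.map_normalCore_mulEquiv e' _).trans (congrArg Subgroup.normalCore ?_)
  exact RingHom.map_galEquivFixer_fixer _ σ

lemma IsEmbedding.exists_of_isGaloisClosure {c : BranchedCovering X B}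
    {σ : X.scheme.functionField →+* Ω} (h : c.IsEmbedding σ) {c' : BranchedCovering Y B}
    (hc' : c'.IsGaloisClosure c) :
    ∃ σ' : Y.scheme.functionField →+* Ω, c'.IsEmbedding σ' ∧
      σ'.fixer B.scheme.functionField = (σ.fixer B.scheme.functionField).normalCore := by
  let _ : Algebra B.scheme.functionField X.scheme.functionField := c.functionFieldMap.toAlgebra
  let _ : Algebra B.scheme.functionField Y.scheme.functionField := c'.functionFieldMap.toAlgebra
  have hc' : IsNormalClosure B.scheme.functionField X.scheme.functionField
    Y.scheme.functionField := hc'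
  let σ' : X.scheme.functionField →ₐ[B.scheme.functionField] Ω :=
    { σ with commutes' := RingHom.congr_fun h }
  have : Nonempty (X.scheme.functionField →ₐ[B.scheme.functionField] Ω) := ⟨σ'⟩
  have h1 : σ'.fieldRange.fixingSubgroup = σ.fixer B.scheme.functionField :=
    σ'.fixingSubgroup_fieldRange
  let e : Y.scheme.functionField ≃ₐ[B.scheme.functionField]
      IntermediateField.normalClosure B.scheme.functionField X.scheme.functionField Ω :=
    IsNormalClosure.equiv (K := X.scheme.functionField)
  refine ⟨(IntermediateField.val _).toRingHom.comp e.toAlgHom.toRingHom, ?_, ?_⟩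
  · ext a
    exact congrArg Subtype.val (e.commutes a)
  · rw [← h1, ← fixingSubgroup_normalClosure]
    ext g
    constructor
    · intro hg y
      obtain ⟨x, rfl⟩ := e.surjective y
      exact hg x
    · exact fun hg x => hg (e x)

/-- Two embeddings differ by an automorphism of `Ω`, so their stabilizers are conjugate. -/
lemma IsEmbedding.le_fixer {c : BranchedCovering X B} {σ σ' : X.scheme.functionField →+* Ω}
    (hσ : c.IsEmbedding σ) (hσ' : c.IsEmbedding σ') {N : Subgroup Gal(Ω/B.scheme.functionField)}
    [hN : N.Normal] (hle : N ≤ σ.fixer B.scheme.functionField) :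
    N ≤ σ'.fixer B.scheme.functionField := by
  let _ : Algebra B.scheme.functionField X.scheme.functionField := c.functionFieldMap.toAlgebra
  let σ₁ : X.scheme.functionField →ₐ[B.scheme.functionField] Ω :=
    { σ with commutes' := RingHom.congr_fun hσ }
  let σ₂ : X.scheme.functionField →ₐ[B.scheme.functionField] Ω :=
    { σ' with commutes' := RingHom.congr_fun hσ' }
  obtain ⟨τ, hτ⟩ := σ₁.exists_gal_apply_eq σ₂
  intro g hg x
  have h1 := hle (hN.conj_mem g hg τ⁻¹) x
  have h2 : τ (σ x) = σ' x := hτ x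
  rw [← h2]
  rw [inv_inv] at h1
  exact τ.symm_apply_eq.mp h1

variable [FiniteDimensional B.scheme.functionField Ω]

lemma IsEmbedding.isGaloisClosure {c : BranchedCovering X B}
    {σ : X.scheme.functionField →+* Ω} (h : c.IsEmbedding σ) {c' : BranchedCovering Y B}
    {σ' : Y.scheme.functionField →+* Ω} (h' : c'.IsEmbedding σ')
    (heq : σ'.fixer B.scheme.functionField = (σ.fixer B.scheme.functionField).normalCore) :
    c'.IsGaloisClosure c := by
  let _ : Algebra B.scheme.functionField X.scheme.functionField := c.functionFieldMap.toAlgebra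
  let _ : Algebra B.scheme.functionField Y.scheme.functionField := c'.functionFieldMap.toAlgebra
  let σ₁ : X.scheme.functionField →ₐ[B.scheme.functionField] Ω :=
    { σ with commutes' := RingHom.congr_fun h }
  let σ₂ : Y.scheme.functionField →ₐ[B.scheme.functionField] Ω :=
    { σ' with commutes' := RingHom.congr_fun h' }
  have : Nonempty (X.scheme.functionField →ₐ[B.scheme.functionField] Ω) := ⟨σ₁⟩
  have h1 : σ₁.fieldRange.fixingSubgroup = σ.fixer B.scheme.functionField :=
    σ₁.fixingSubgroup_fieldRange
  have h2 : σ₂.fieldRange.fixingSubgroup = σ'.fixer B.scheme.functionField :=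
    σ₂.fixingSubgroup_fieldRange
  have h3 : IntermediateField.normalClosure B.scheme.functionField X.scheme.functionField Ω =
      σ₂.fieldRange := by
    rw [← IsGalois.fixedField_fixingSubgroup σ₂.fieldRange, h2, heq, ← h1,
      ← fixingSubgroup_normalClosure, IsGalois.fixedField_fixingSubgroup]
  have : Algebra.IsAlgebraic B.scheme.functionField X.scheme.functionField :=
    Algebra.IsAlgebraic.of_injective σ₁ σ₁.injective
  exact IsNormalClosure.of_algEquiv (K := X.scheme.functionField)
    ((IntermediateField.equivOfEq h3).trans (AlgEquiv.ofInjectiveField σ₂).symm)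

/-- An inclusion of stabilizers gives a factorization of coverings. -/
lemma IsEmbedding.exists_comp_eq {c : BranchedCovering Y B} {f : BranchedCovering X Y}
    {g : BranchedCovering Z Y} {σ : X.scheme.functionField →+* Ω}
    {τ : Z.scheme.functionField →+* Ω} (hσ : (c.comp f).IsEmbedding σ)
    (hστ : σ.comp f.functionFieldMap = τ.comp g.functionFieldMap)
    (hle : σ.fixer B.scheme.functionField ≤ τ.fixer B.scheme.functionField) :
    ∃ h : BranchedCovering X Z, f = g.comp h ∧ σ.comp h.functionFieldMap = τ := by
  have hτ : (c.comp g).IsEmbedding τ := IsEmbedding.of_comp (hστ ▸ hσ.comp)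
  obtain ⟨ψ, hψ⟩ := σ.exists_comp_eq_of_fixer_le τ hσ.mem_fieldRange hτ.mem_fieldRange hle
  obtain ⟨h, h1, h2⟩ := BranchedCovering.exists_comp_eq f g ψ (by
    ext x
    apply σ.injective
    exact (RingHom.congr_fun hψ _).trans (RingHom.congr_fun hστ x).symm)
  exact ⟨h, h1, h2 ▸ hψ⟩

lemma IsEmbedding.exists_eq_comp {c : BranchedCovering X B} {d : BranchedCovering Z B}
    {σ : X.scheme.functionField →+* Ω} {τ : Z.scheme.functionField →+* Ω}
    (hσ : c.IsEmbedding σ) (hτ : d.IsEmbedding τ)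
    (hle : σ.fixer B.scheme.functionField ≤ τ.fixer B.scheme.functionField) :
    ∃ h : BranchedCovering X Z, c = d.comp h ∧ σ.comp h.functionFieldMap = τ :=
  IsEmbedding.exists_comp_eq (c := refl B) ((refl_comp c).symm ▸ hσ)
    (RingHom.ext fun x => (RingHom.congr_fun hσ x).trans (RingHom.congr_fun hτ x).symm) hle

/-- The Galois closure embeds with stabilizer the core. The embedding it induces on `Z` may differ
from `τ`, which is harmless because the core is normal. -/
lemma IsEmbedding.isSubcoverOfGaloisClosure_iff [CharZero k] {c : BranchedCovering X B}
    {d : BranchedCovering Z B} {σ : X.scheme.functionField →+* Ω}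
    {τ : Z.scheme.functionField →+* Ω} (hσ : c.IsEmbedding σ) (hτ : d.IsEmbedding τ) :
    d.IsSubcoverOfGaloisClosure c ↔
      (σ.fixer B.scheme.functionField).normalCore ≤ τ.fixer B.scheme.functionField := by
  constructor
  · rintro ⟨X', c', hc', e, rfl⟩
    obtain ⟨σ', h1, h2⟩ := hσ.exists_of_isGaloisClosure hc'
    rw [← h2]
    have : (σ'.fixer B.scheme.functionField).Normal := h2 ▸ Subgroup.normalCore_normal _
    exact h1.comp.le_fixer hτ (RingHom.fixer_le_fixer_comp _ _)
  · intro h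
    obtain ⟨X', c', σ', h1, h2⟩ := exists_isEmbedding_fixer_eq
      (σ.fixer B.scheme.functionField).normalCore
    obtain ⟨e, he, -⟩ := h1.exists_eq_comp hτ (h2 ▸ h)
    exact ⟨X', c', hσ.isGaloisClosure h1 h2, e, he⟩

lemma IsEmbedding.sameGaloisClosure [CharZero k] {c : BranchedCovering X B}
    {d : BranchedCovering Z B} {σ : X.scheme.functionField →+* Ω}
    {τ : Z.scheme.functionField →+* Ω} (hσ : c.IsEmbedding σ) (hτ : d.IsEmbedding τ)
    (h : (σ.fixer B.scheme.functionField).normalCore =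
      (τ.fixer B.scheme.functionField).normalCore) : c.SameGaloisClosure d := by
  obtain ⟨W, c', σ', h1, h2⟩ := exists_isEmbedding_fixer_eq
    (σ.fixer B.scheme.functionField).normalCore
  exact ⟨W, c', hσ.isGaloisClosure h1 h2, hτ.isGaloisClosure h1 (h2.trans h)⟩

lemma IsEmbedding.isIso_iff {c : BranchedCovering Y B} {f : BranchedCovering X Y}
    {σ : X.scheme.functionField →+* Ω} (hσ : (c.comp f).IsEmbedding σ) :
    IsIso f.hom ↔ (σ.comp f.functionFieldMap).fixer B.scheme.functionField =
      σ.fixer B.scheme.functionField := by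
  rw [BranchedCovering.isIso_iff]
  constructor
  · intro hf
    refine le_antisymm (fun g hg x => ?_) (RingHom.fixer_le_fixer_comp _ _)
    obtain ⟨y, rfl⟩ := hf.2 x
    exact hg y
  · intro h
    obtain ⟨ψ, hψ⟩ := (σ.comp f.functionFieldMap).exists_comp_eq_of_fixer_le σ
      hσ.comp.mem_fieldRange hσ.mem_fieldRange h.le
    exact ⟨f.functionFieldMap.injective, fun x => ⟨ψ x, σ.injective (RingHom.congr_fun hψ x)⟩⟩

lemma IsEmbedding.indecomposable_iff [CharZero k] {c : BranchedCovering Y B}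
    {f : BranchedCovering X Y} {σ : X.scheme.functionField →+* Ω}
    (hσ : (c.comp f).IsEmbedding σ) :
    f.Indecomposable ↔ σ.fixer B.scheme.functionField ⋖
      (σ.comp f.functionFieldMap).fixer B.scheme.functionField := by
  constructor
  · rintro ⟨h1, h2⟩
    rw [hσ.isIso_iff] at h1
    refine ⟨lt_of_le_of_ne (RingHom.fixer_le_fixer_comp _ _) (Ne.symm h1), fun V hV1 hV2 => ?_⟩
    -- A subgroup strictly between the stabilizers would define a covering through which `f` factors
    -- nontrivially.
    obtain ⟨Z, d, τ, hτ, rfl⟩ := exists_isEmbedding_fixer_eq V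
    obtain ⟨g, rfl, hg⟩ := hτ.exists_eq_comp hσ.comp hV2.le
    obtain ⟨h, rfl, hh⟩ := hσ.exists_comp_eq (g := g) hg.symm hV1.le
    subst hh
    have hσ' : ((c.comp g).comp h).IsEmbedding σ := IsEmbedding.of_comp hτ
    rcases h2 Z g h rfl with h3 | h3
    · rw [hτ.isIso_iff, hg] at h3
      exact hV2.ne h3.symm
    · rw [hσ'.isIso_iff] at h3
      exact hV1.ne h3.symm
  · intro h
    refine ⟨fun h1 => h.lt.ne (hσ.isIso_iff.mp h1).symm, fun Z g e hge => ?_⟩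
    subst hge
    have hσ' : ((c.comp g).comp e).IsEmbedding σ := by
      rw [IsEmbedding, functionFieldMap_comp, functionFieldMap_comp]
      rw [IsEmbedding, functionFieldMap_comp, functionFieldMap_comp] at hσ
      exact hσ
    have hcomp : σ.comp (g.comp e).functionFieldMap =
        (σ.comp e.functionFieldMap).comp g.functionFieldMap := by
      rw [functionFieldMap_comp, RingHom.comp_assoc]
    rw [hcomp] at h
    rw [hσ'.isIso_iff, hσ'.comp.isIso_iff]
    rcases h.eq_or_eq (RingHom.fixer_le_fixer_comp σ e.functionFieldMap)
      (RingHom.fixer_le_fixer_comp _ _) with h1 | h1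
    · exact Or.inr h1
    · exact Or.inl h1.symm

end BranchedCovering

/-! ### Linear disjointness from indices of stabilizers -/

section

/-- Both indices can be computed in the quotient by `K`, of which `V` is a full preimage and onto
which `H` surjects. -/
lemma Subgroup.relIndex_eq_index_of_sup_eq_top {G : Type*} [Group G] {V H K : Subgroup G}
    [K.Normal] (hKV : K ≤ V) (h : H ⊔ K = ⊤) : V.relIndex H = V.index := by
  let φ : H →* G ⧸ K := (QuotientGroup.mk' K).comp H.subtype
  have hφ : Function.Surjective φ := by
    intro x
    obtain ⟨g, rfl⟩ := QuotientGroup.mk'_surjective K x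
    obtain ⟨a, ha, b, hb, rfl⟩ := Subgroup.mem_sup_of_normal_right.mp (show g ∈ H ⊔ K from h ▸ Subgroup.mem_top g)
    refine ⟨⟨a, ha⟩, ?_⟩
    exact (QuotientGroup.eq.mpr (by simpa using hb))
  have hV : (V.map (QuotientGroup.mk' K)).comap (QuotientGroup.mk' K) = V := by
    rw [Subgroup.comap_map_eq, QuotientGroup.ker_mk', sup_eq_left.mpr hKV]
  have h1 : (V.map (QuotientGroup.mk' K)).comap φ = V.subgroupOf H := by
    rw [← Subgroup.comap_comap, hV]
    rfl
  rw [Subgroup.relIndex, ← h1, Subgroup.index_comap_of_surjective _ hφ,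
    ← Subgroup.index_comap_of_surjective _ (QuotientGroup.mk'_surjective K), hV]

variable {F L E D Ω : Type*} [Field F] [Field L] [Field E] [Field D] [Field Ω]
  [Algebra F L] [Algebra F E] [Algebra F D] [Algebra L D] [Algebra E D] [Algebra F Ω]
  [IsScalarTower F L D] [IsScalarTower F E D] [IsGalois F Ω]

lemma AlgHom.finrank_eq_index_fixer (σ : L →ₐ[F] Ω) :
    Module.finrank F L = (σ.toRingHom.fixer F).index := by
  rw [← σ.fixingSubgroup_fieldRange, ← IntermediateField.finrank_eq_fixingSubgroup_index]
  exact (AlgEquiv.ofInjectiveField σ).toLinearEquiv.finrank_eq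

/-- A compositum whose degree is the product of the degrees is a tensor product. -/
lemma Algebra.isPushout_of_fixer [FiniteDimensional F Ω] (σ : D →ₐ[F] Ω)
    (hinf : (σ.toRingHom.comp (algebraMap L D)).fixer F ⊓
      (σ.toRingHom.comp (algebraMap E D)).fixer F = σ.toRingHom.fixer F)
    (hindex : ((σ.toRingHom.comp (algebraMap L D)).fixer F).relIndex
      ((σ.toRingHom.comp (algebraMap E D)).fixer F) =
        ((σ.toRingHom.comp (algebraMap L D)).fixer F).index) :
    Algebra.IsPushout F L E D := by
  let σL : L →ₐ[F] Ω := σ.comp (IsScalarTower.toAlgHom F L D)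
  let σE : E →ₐ[F] Ω := σ.comp (IsScalarTower.toAlgHom F E D)
  let ψ : L ⊗[F] E →ₐ[L] D := Algebra.TensorProduct.lift (Algebra.ofId L D)
    (IsScalarTower.toAlgHom F E D) fun _ _ => Commute.all _ _
  have hψ : ∀ l e, ψ (l ⊗ₜ e) = algebraMap L D l * algebraMap E D e := fun l e =>
    Algebra.TensorProduct.lift_tmul ..
  -- An intersection of stabilizers corresponds to a compositum, so `D` is generated by `L` and `E`;
  -- for algebraic extensions this already holds as algebras.
  have hsup : σL.fieldRange ⊔ σE.fieldRange = σ.fieldRange := by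
    rw [← IsGalois.fixedField_fixingSubgroup (σL.fieldRange ⊔ σE.fieldRange),
      IntermediateField.fixingSubgroup_sup, ← IsGalois.fixedField_fixingSubgroup σ.fieldRange,
      σ.fixingSubgroup_fieldRange, ← hinf,
      σL.fixingSubgroup_fieldRange, σE.fixingSubgroup_fieldRange]
    rfl
  have hsurj : Function.Surjective ψ := by
    intro d
    have h1 : σ d ∈ (σL.fieldRange ⊔ σE.fieldRange).toSubalgebra := by
      rw [hsup]; exact ⟨d, rfl⟩
    rw [IntermediateField.sup_toSubalgebra_of_isAlgebraic_left] at h1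
    have h2 : σL.fieldRange.toSubalgebra ⊔ σE.fieldRange.toSubalgebra ≤
        (σ.comp (ψ.restrictScalars F)).range := by
      refine sup_le ?_ ?_
      · rintro _ ⟨l, rfl⟩
        refine ⟨l ⊗ₜ 1, congrArg σ ((hψ l 1).trans ?_)⟩
        rw [map_one, mul_one]
        rfl
      · rintro _ ⟨e, rfl⟩
        refine ⟨1 ⊗ₜ e, congrArg σ ((hψ 1 e).trans ?_)⟩
        rw [map_one, one_mul]
        rfl
    obtain ⟨t, ht⟩ := h2 h1
    exact ⟨t, σ.injective ht⟩
  have hL : FiniteDimensional F L := FiniteDimensional.of_injective σL.toLinearMap σL.injective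
  have hE : FiniteDimensional F E := FiniteDimensional.of_injective σE.toLinearMap σE.injective
  have hD : FiniteDimensional F D := FiniteDimensional.of_injective σ.toLinearMap σ.injective
  -- The index hypothesis says that the degree of `D` is the product of the degrees of `L` and `E`.
  have hrank : Module.finrank F (L ⊗[F] E) = Module.finrank F D := by
    rw [Module.finrank_tensorProduct, σ.finrank_eq_index_fixer, σL.finrank_eq_index_fixer,
      σE.finrank_eq_index_fixer]
    have h3 : (σL.toRingHom.fixer F).relIndex (σE.toRingHom.fixer F) =
      (σL.toRingHom.fixer F).index := hindex
    have h4 : σL.toRingHom.fixer F ⊓ σE.toRingHom.fixer F = σ.toRingHom.fixer F := hinf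
    rw [← h3, ← h4, ← Subgroup.inf_relIndex_right, Subgroup.relIndex_mul_index inf_le_right]
  have hinj : Function.Injective ψ :=
    (LinearMap.injective_iff_surjective_of_finrank_eq_finrank
      (f := (ψ.restrictScalars F).toLinearMap) hrank).mpr hsurj
  exact Algebra.IsPushout.of_bijective ⟨hinj, hsurj⟩

end

namespace BranchedCovering

variable {k : Type u} [Field k] {B W X Z : CurveOver k} {Ω : Type u} [Field Ω]
  [Algebra B.scheme.functionField Ω] [IsGalois B.scheme.functionField Ω]
  [FiniteDimensional B.scheme.functionField Ω]

lemma IsEmbedding.isPullbackAlong {g : BranchedCovering Z B} {w : BranchedCovering W Z}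
    {u : BranchedCovering X B} {σ : W.scheme.functionField →+* Ω}
    {τ : X.scheme.functionField →+* Ω} (hσ : (g.comp w).IsEmbedding σ) (hτ : u.IsEmbedding τ)
    (hinf : τ.fixer B.scheme.functionField ⊓
      (σ.comp w.functionFieldMap).fixer B.scheme.functionField = σ.fixer B.scheme.functionField)
    (hindex : (τ.fixer B.scheme.functionField).relIndex
      ((σ.comp w.functionFieldMap).fixer B.scheme.functionField) =
        (τ.fixer B.scheme.functionField).index) : w.IsPullbackAlong u g := by
  obtain ⟨p, comm, hp⟩ := hσ.exists_eq_comp hτ (hinf ▸ inf_le_left)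
  subst hp
  refine isPullbackAlong_of_isPushout_functionFieldMap w u g p comm.symm ?_
  have hcomm : p.functionFieldMap.comp u.functionFieldMap =
      w.functionFieldMap.comp g.functionFieldMap := by
    rw [← functionFieldMap_comp, ← comm, functionFieldMap_comp]
  let _ : Algebra B.scheme.functionField X.scheme.functionField := u.functionFieldMap.toAlgebra
  let _ : Algebra B.scheme.functionField Z.scheme.functionField := g.functionFieldMap.toAlgebra
  let _ : Algebra X.scheme.functionField W.scheme.functionField := p.functionFieldMap.toAlgebra
  let _ : Algebra Z.scheme.functionField W.scheme.functionField := w.functionFieldMap.toAlgebra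
  let _ : Algebra B.scheme.functionField W.scheme.functionField :=
    (p.functionFieldMap.comp u.functionFieldMap).toAlgebra
  have : IsScalarTower B.scheme.functionField X.scheme.functionField W.scheme.functionField :=
    .of_algebraMap_eq' rfl
  have : IsScalarTower B.scheme.functionField Z.scheme.functionField W.scheme.functionField :=
    .of_algebraMap_eq' hcomm
  let σ' : W.scheme.functionField →ₐ[B.scheme.functionField] Ω :=
    { σ with commutes' := RingHom.congr_fun hτ }
  have := Algebra.isPushout_of_fixer σ' hinf hindex
  exact CommRingCat.isPushout_of_isPushout B.scheme.functionField X.scheme.functionField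
    Z.scheme.functionField W.scheme.functionField

end BranchedCovering

/-! ### Monodromy hypotheses as conditions on stabilizers of the tower -/

lemma MulEquiv.isSolvable_iff {G G' : Type*} [Group G] [Group G'] (e : G ≃* G') :
    Group.IsSolvable G ↔ Group.IsSolvable G' :=
  ⟨fun _ => Group.isSolvable_of_surjective (f := e.toMonoidHom) e.surjective,
    fun _ => Group.isSolvable_of_surjective (f := e.symm.toMonoidHom) e.symm.surjective⟩

namespace BranchedCovering

section Embedding

variable {k : Type u} [Field k] {B X Y : CurveOver k} {Ω : Type u} [Field Ω]
  [Algebra B.scheme.functionField Ω] [IsGalois B.scheme.functionField Ω]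

lemma IsEmbedding.exists_of_isSubcoverOfGaloisClosure {c : BranchedCovering X B}
    {σ : X.scheme.functionField →+* Ω} (hσ : c.IsEmbedding σ) {h : BranchedCovering Y B}
    (hh : h.IsSubcoverOfGaloisClosure c) :
    ∃ τ : Y.scheme.functionField →+* Ω, h.IsEmbedding τ := by
  obtain ⟨X', c', hc', e, rfl⟩ := hh
  obtain ⟨σ', h1, -⟩ := hσ.exists_of_isGaloisClosure hc'
  exact ⟨_, h1.comp⟩

variable [FiniteDimensional B.scheme.functionField Ω]

lemma IsEmbedding.isSolvable_mon_iff {c : BranchedCovering X B}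
    {σ : X.scheme.functionField →+* Ω} (hσ : c.IsEmbedding σ) :
    Group.IsSolvable c.Mon ↔
      solvableResidual ⊤ ≤ (σ.fixer B.scheme.functionField).normalCore := by
  obtain ⟨e⟩ := hσ.nonempty_mon_mulEquiv
  rw [← isSolvable_quotient_iff, e.isSolvable_iff]

lemma IsEmbedding.properQuotientsSolvableMod {c : BranchedCovering X B}
    {σ : X.scheme.functionField →+* Ω} (hσ : c.IsEmbedding σ) (h : ProperQuotientsSolvable c.Mon) :
    ProperQuotientsSolvableMod ⊤ (σ.fixer B.scheme.functionField).normalCore := by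
  obtain ⟨e⟩ := hσ.nonempty_mon_mulEquiv
  exact (h.of_equiv e).mod_top

lemma IsEmbedding.isSolvable_mon_iff_of_comp {c : BranchedCovering Y B}
    {f : BranchedCovering X Y} {σ : X.scheme.functionField →+* Ω} (hσ : (c.comp f).IsEmbedding σ) :
    Group.IsSolvable f.Mon ↔
      solvableResidual ((σ.comp f.functionFieldMap).fixer B.scheme.functionField) ≤
        relCore ((σ.comp f.functionFieldMap).fixer B.scheme.functionField)
          (σ.fixer B.scheme.functionField) := by
  obtain ⟨e⟩ := hσ.nonempty_mon_mulEquiv_of_comp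
  rw [← isSolvable_quotient_normalCore_iff, e.isSolvable_iff]

lemma IsEmbedding.properQuotientsSolvableMod_of_comp {c : BranchedCovering Y B}
    {f : BranchedCovering X Y} {σ : X.scheme.functionField →+* Ω} (hσ : (c.comp f).IsEmbedding σ)
    (hf : HasUniqueMinimalNormalWithSolvableQuotient f.Mon) :
    ProperQuotientsSolvableMod ((σ.comp f.functionFieldMap).fixer B.scheme.functionField)
      (relCore ((σ.comp f.functionFieldMap).fixer B.scheme.functionField)
        (σ.fixer B.scheme.functionField)) := by
  obtain ⟨e⟩ := hσ.nonempty_mon_mulEquiv_of_comp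
  have : Finite f.Mon := Finite.of_equiv _ e.symm.toEquiv
  exact (hf.properQuotientsSolvable.of_equiv e).mod_relCore

end Embedding

section Tower

variable {k : Type u} [Field k] {r : ℕ} {X : Fin (r + 1) → CurveOver k}
  (f : ∀ i : Fin r, BranchedCovering (X i.succ) (X i.castSucc))

lemma composite_zero : composite f 0 = refl (X 0) := rfl

lemma composite_succ (i : Fin r) :
    composite f i.succ = (composite f i.castSucc).comp (f i) := rfl

/-- A tower of coverings is given by a chain of subgroups of a finite Galois group. -/
lemma exists_isEmbedding_composite [CharZero k] :
    ∃ (Ω : Type u) (_ : Field Ω) (_ : Algebra (X 0).scheme.functionField Ω)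
      (_ : IsGalois (X 0).scheme.functionField Ω)
      (_ : FiniteDimensional (X 0).scheme.functionField Ω)
      (σ : ∀ i, (X i).scheme.functionField →+* Ω), (∀ i, (composite f i).IsEmbedding (σ i)) ∧
      ∀ i : Fin r, (σ i.succ).comp (f i).functionFieldMap = σ i.castSucc := by
  have := (X 0).charZero_functionField
  let F := (X 0).scheme.functionField
  let L := (X (Fin.last r)).scheme.functionField
  let _ : Algebra F L := (composite f (Fin.last r)).functionFieldMap.toAlgebra
  have : FiniteDimensional F L := (composite f (Fin.last r)).functionFieldMap_finite
  let Ω := IntermediateField.normalClosure F L (AlgebraicClosure L)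
  have : IsAlgClosure F (AlgebraicClosure L) :=
    ⟨inferInstance, Algebra.IsAlgebraic.trans F L _⟩
  have : Normal F (AlgebraicClosure L) := IsAlgClosure.normal F _
  have hgal : IsGalois F Ω := ⟨⟩
  let s : L →+* Ω := algebraMap L Ω
  -- Restricting one embedding of the top field downwards makes all the embeddings compatible.
  let σ : ∀ i, (X i).scheme.functionField →+* Ω := fun i =>
    Fin.reverseInduction (motive := fun i => (X i).scheme.functionField →+* Ω) s
      (fun i τ => τ.comp (f i).functionFieldMap) i
  have hlast : σ (Fin.last r) = s := Fin.reverseInduction_last ..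
  have hσ : ∀ i : Fin r, (σ i.succ).comp (f i).functionFieldMap = σ i.castSucc := fun i =>
    (Fin.reverseInduction_castSucc (motive := fun i => (X i).scheme.functionField →+* Ω) (zero := s)
      (succ := fun i τ => τ.comp (f i).functionFieldMap) i).symm
  have h0 : ∀ i, (σ i).comp (composite f i).functionFieldMap = σ 0 := by
    intro i
    induction i using Fin.induction with
    | zero => rw [composite_zero, functionFieldMap_refl]; rfl
    | succ i ih => rw [composite_succ, functionFieldMap_comp, ← RingHom.comp_assoc, hσ, ih]
  have h1 : σ 0 = algebraMap F Ω := by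
    rw [← h0 (Fin.last r), hlast]
    exact (IsScalarTower.algebraMap_eq F L Ω).symm
  exact ⟨Ω, inferInstance, inferInstance, hgal, inferInstance, σ, fun i => (h0 i).trans h1, hσ⟩

end Tower

end BranchedCovering

/-! ### The theorem and its addendum -/

theorem theorem4p1 {k : Type u} [Field k] [CharZero k] {r : ℕ} (X : Fin (r + 1) → CurveOver k)
    (f : ∀ i : Fin r, BranchedCovering (X i.succ) (X i.castSucc))
    (hf : ∀ i, (f i).Indecomposable)
    (hΓ : ∀ i, HasUniqueMinimalNormalWithSolvableQuotient (f i).Mon) :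
    -- parts (1) and (2)
    (∀ (Y : CurveOver k) (h : BranchedCovering Y (X 0)),
      h.IsSubcoverOfGaloisClosure (BranchedCovering.composite f (Fin.last r)) →
      h.IsMinimalNonsolvable → ProperQuotientsSolvable h.Mon →
      ∃ (X' X₁' : CurveOver k) (f' : BranchedCovering X' (X 0))
        (f₁' : BranchedCovering X₁' (X 0)) (f₂' : BranchedCovering X' X₁'),
        f'.IsSubcover (BranchedCovering.composite f (Fin.last r)) ∧ f'.SameGaloisClosure h ∧
        f' = f₁'.comp f₂' ∧ Group.IsSolvable f₁'.Mon ∧ f₂'.Indecomposable ∧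
        ((∀ i, ¬ Group.IsSolvable (f i).Mon) → IsIso f₁'.hom ∧ f'.Indecomposable)) ∧
    -- the addendum
    ((∀ i, ¬ Group.IsSolvable (f i).Mon) →
      -- (a) and (c)
      (∀ (Y : CurveOver k) (h : BranchedCovering Y (X 0)),
        h.IsSubcoverOfGaloisClosure (BranchedCovering.composite f (Fin.last r)) →
        h.IsMinimalNonsolvable → ProperQuotientsSolvable h.Mon →
        ∀ i : Fin r, h.IsSubcoverOfGaloisClosure (BranchedCovering.composite f i.succ) →
          (∀ j : Fin r, j < i → ¬ h.IsSubcoverOfGaloisClosure (BranchedCovering.composite f j.succ)) →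
          (∃ φ : (BranchedCovering.composite f i.succ).Mon →* (BranchedCovering.composite f i.castSucc).Mon × (f i).Mon,
            Function.Injective φ) ∧
          ∃ (Z : CurveOver k) (u : BranchedCovering Z (X 0)),
            u.IsSubcoverOfGaloisClosure h ∧
            (f i).IsPullbackAlong u (BranchedCovering.composite f i.castSucc)) ∧
      -- (b)
      (∀ i : Fin r,
        (∀ (Y : CurveOver k) (h : BranchedCovering Y (X 0)),
          h.IsMinimalNonsolvable → ProperQuotientsSolvable h.Mon →
          h.IsSubcoverOfGaloisClosure (BranchedCovering.composite f i.succ) →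
          ¬ h.IsSubcoverOfGaloisClosure (BranchedCovering.composite f i.castSucc) →
          Nonempty (h.Mon ≃* (f i).Mon)) ∧
        (∀ (Y Y' : CurveOver k) (h : BranchedCovering Y (X 0)) (h' : BranchedCovering Y' (X 0)),
          h.IsMinimalNonsolvable → ProperQuotientsSolvable h.Mon →
          h.IsSubcoverOfGaloisClosure (BranchedCovering.composite f i.succ) →
          ¬ h.IsSubcoverOfGaloisClosure (BranchedCovering.composite f i.castSucc) →
          h'.IsMinimalNonsolvable → ProperQuotientsSolvable h'.Mon →
          h'.IsSubcoverOfGaloisClosure (BranchedCovering.composite f i.succ) →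
          ¬ h'.IsSubcoverOfGaloisClosure (BranchedCovering.composite f i.castSucc) →
          h.SameGaloisClosure h'))) := by
  obtain ⟨Ω, _, _, _, _, σ, hσ, hσf⟩ := BranchedCovering.exists_isEmbedding_composite f
  let G := Gal(Ω/(X 0).scheme.functionField)
  let H : Fin (r + 1) → Subgroup G := fun i => (σ i).fixer (X 0).scheme.functionField
  have hemb : ∀ i : Fin r, ((BranchedCovering.composite f i.castSucc).comp (f i)).IsEmbedding
      (σ i.succ) := fun i => hσ i.succ
  have hH : ∀ i : Fin r, ((σ i.succ).comp (f i).functionFieldMap).fixer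
      (X 0).scheme.functionField = H i.castSucc := fun i => by rw [hσf]
  have hH0 : H 0 = ⊤ := by
    have h0 : σ 0 = algebraMap _ Ω := by
      have h1 := hσ 0
      rwa [BranchedCovering.composite_zero, BranchedCovering.IsEmbedding,
        BranchedCovering.functionFieldMap_refl, RingHom.comp_id] at h1
    change (σ 0).fixer _ = ⊤
    rw [h0, RingHom.fixer_algebraMap]
  have hcov : ∀ i : Fin r, H i.succ ⋖ H i.castSucc := fun i =>
    hH i ▸ (hemb i).indecomposable_iff.mp (hf i)
  have hanti : Antitone H := Fin.antitone_iff_succ_le.mpr fun i => (hcov i).le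
  have hPQ : ∀ i : Fin r, ProperQuotientsSolvableMod (H i.castSucc)
      (relCore (H i.castSucc) (H i.succ)) := fun i =>
    hH i ▸ (hemb i).properQuotientsSolvableMod_of_comp (hΓ i)
  have hns (hΓns : ∀ i, ¬ Group.IsSolvable (f i).Mon) (i : Fin r) :
      ¬ solvableResidual (H i.castSucc) ≤ relCore (H i.castSucc) (H i.succ) := fun h =>
    hΓns i ((hemb i).isSolvable_mon_iff_of_comp.mpr ((hH i).symm ▸ h))
  -- the normal subgroup of `G` given by a minimal nonsolvable covering
  have hcover : ∀ (Y : CurveOver k) (h : BranchedCovering Y (X 0)) (m : Fin (r + 1)),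
      h.IsSubcoverOfGaloisClosure (BranchedCovering.composite f m) →
      h.IsMinimalNonsolvable → ProperQuotientsSolvable h.Mon →
      ∃ τ : Y.scheme.functionField →+* Ω, h.IsEmbedding τ ∧
        ∃ (K : Subgroup G) (_ : K.Normal), (τ.fixer (X 0).scheme.functionField).normalCore = K ∧
        ProperQuotientsSolvableMod ⊤ K ∧ ¬ solvableResidual ⊤ ≤ K ∧
        ∀ j, h.IsSubcoverOfGaloisClosure (BranchedCovering.composite f j) ↔
          (H j).normalCore ≤ K := by
    intro Y h m hm hmin hpq
    obtain ⟨τ, hτ⟩ := (hσ m).exists_of_isSubcoverOfGaloisClosure hm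
    refine ⟨τ, hτ, _, Subgroup.normalCore_normal _, rfl, hτ.properQuotientsSolvableMod hpq,
      fun h => hmin.1 (hτ.isSolvable_mon_iff.mpr h), fun j => ?_⟩
    have := (H j).normalCore_normal
    rw [(hσ j).isSubcoverOfGaloisClosure_iff hτ, Subgroup.normal_le_normalCore]
  -- the step of the tower where the normal subgroup appears
  have hstep (hΓns : ∀ i, ¬ Group.IsSolvable (f i).Mon) (i : Fin r) (K : Subgroup G) [K.Normal]
      (hK : ProperQuotientsSolvableMod ⊤ K) (hKns : ¬ solvableResidual ⊤ ≤ K)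
      (hB : (H i.succ).normalCore ≤ K) (hA : ¬ (H i.castSucc).normalCore ≤ K) :
      K ⊓ (H i.castSucc).normalCore ≤ (H i.succ).normalCore ∧
        H i.castSucc ⊔ K = ⊤ ∧ H i.succ ⊔ K ≠ ⊤ ∧ Nonempty (G ⧸ K ≃* (f i).Mon) := by
    obtain ⟨h1, h2⟩ := inf_normalCore_le_and_not_le_sup hK hKns (hcov i) (hPQ i) hB hA
    have := (H i.castSucc).normalCore_normal
    have htop : H i.castSucc ⊔ K = ⊤ := sup_eq_top_of_residual_le_sup hH0 hcov (hns hΓns) _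
      (((hK.of_normal (N := (H i.castSucc).normalCore)).resolve_left hA).trans
        (sup_le_sup_right (Subgroup.normalCore_le _) K))
    obtain ⟨e⟩ := nonempty_quotient_mulEquiv (relCore_eq_inf hK (hcov i) htop h2) htop
    obtain ⟨e'⟩ := (hemb i).nonempty_mon_mulEquiv_of_comp
    rw [hH i] at e'
    exact ⟨h1, htop, fun h => h2 (by rw [h]; exact le_top), ⟨e.trans e'.symm⟩⟩
  refine ⟨?_, fun hΓns => ⟨?_, fun i => ⟨?_, ?_⟩⟩⟩
  · intro Y h hsub hmin hpq
    obtain ⟨τ, hτ, K, hKn, rfl, hK, hKns, hiff⟩ := hcover Y h _ hsub hmin hpq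
    set K := (τ.fixer (X 0).scheme.functionField).normalCore 
    obtain ⟨j, hj1, hj2⟩ := exists_residual_le_sup_and_not hH0 hcov hPQ hK hKns
      ((hiff _).mp hsub)
    -- The stabilizers `H j.succ ⊔ K` and `H j.castSucc ⊔ K` around the critical step define `f'`
    -- and `f₁'`.
    obtain ⟨X', f', σ', hσ', hfix'⟩ :=
      BranchedCovering.exists_isEmbedding_fixer_eq (Ω := Ω) (H j.succ ⊔ K)
    obtain ⟨X₁, f₁, σ₁, hσ₁, hfix₁⟩ :=
      BranchedCovering.exists_isEmbedding_fixer_eq (Ω := Ω) (H j.castSucc ⊔ K)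
    obtain ⟨f₂, rfl, hf₂⟩ := hσ'.exists_eq_comp hσ₁
      (hfix' ▸ hfix₁ ▸ sup_le_sup_right (hcov j).le K)
    refine ⟨X', X₁, _, f₁, f₂, ?_, ?_, rfl, ?_, ?_, fun hΓns => ?_⟩
    · obtain ⟨e, he, -⟩ := (hσ (Fin.last r)).exists_eq_comp hσ'
        (hfix' ▸ (hanti (Fin.le_last j.succ)).trans le_sup_left)
      exact ⟨e, he⟩
    · exact hσ'.sameGaloisClosure hτ (by rw [hfix', normalCore_sup_eq hK hj2])
    · rw [hσ₁.isSolvable_mon_iff, hfix₁, Subgroup.normal_le_normalCore]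
      exact hj1
    · rw [hσ'.indecomposable_iff, hf₂, hfix', hfix₁]
      exact sup_covBy_sup (hcov j) fun h => hj2 (h ▸ hj1)
    · have htop := sup_eq_top_of_residual_le_sup hH0 hcov (hns hΓns) _ hj1
      have hσ₁' : ((BranchedCovering.refl (X 0)).comp f₁).IsEmbedding σ₁ :=
        (BranchedCovering.refl_comp f₁).symm ▸ hσ₁
      have hσ'' : ((BranchedCovering.refl (X 0)).comp (f₁.comp f₂)).IsEmbedding σ' :=
        (BranchedCovering.refl_comp (f₁.comp f₂)).symm ▸ hσ'
      constructor
      · rw [hσ₁'.isIso_iff, hσ₁, RingHom.fixer_algebraMap, hfix₁, htop]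
      · rw [hσ''.indecomposable_iff, hσ', RingHom.fixer_algebraMap, hfix', ← htop]
        exact sup_covBy_sup (hcov j) fun h => hj2 (h ▸ hj1)
  · intro Y h hsub hmin hpq i hi hnot
    obtain ⟨τ, hτ, K, hKn, hKτ, hK, hKns, hiff⟩ := hcover Y h _ hsub hmin hpq
    have hB := (hiff _).mp hi
    have hA : ¬ (H i.castSucc).normalCore ≤ K := by
      -- Minimality of `i` concerns only nonempty compositions; for the empty one the core is the
      -- whole group, which is not in `K` because `Mon h` is nonsolvable.
      rcases eq_or_ne i.castSucc 0 with h0 | h0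
      · rw [h0, hH0, Subgroup.normalCore_eq_self]
        exact fun h => hKns (le_top.trans h)
      · obtain ⟨j, hj⟩ := Fin.exists_succ_eq.mpr h0
        rw [← hj, ← hiff]
        refine hnot j ?_
        rw [← Fin.castSucc_lt_castSucc_iff, ← hj]
        exact Fin.castSucc_lt_succ
    obtain ⟨hinf, htop, hne, ⟨e⟩⟩ := hstep hΓns i K hK hKns hB hA
    constructor
    · have := (H i.succ).normalCore_normal
      have := (H i.castSucc).normalCore_normal
      obtain ⟨φ, hφ⟩ := exists_injective_quotient_prod
        (Subgroup.normalCore_mono (hcov i).le) hB hinf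
      obtain ⟨e₁⟩ := (hσ i.succ).nonempty_mon_mulEquiv
      obtain ⟨e₂⟩ := (hσ i.castSucc).nonempty_mon_mulEquiv
      refine ⟨((e₂.symm.prodCongr e).toMonoidHom.comp φ).comp e₁.toMonoidHom, ?_⟩
      exact ((e₂.symm.prodCongr e).injective.comp hφ).comp e₁.injective
    -- The covering `u` has stabilizer `H i.succ ⊔ K`: it contains `K`, meets `H i.castSucc` in `H
    -- i.succ`, and has the same index in `G` as `H i.succ` in `H i.castSucc`.
    · obtain ⟨Z, u, τ', hτ', hfix⟩ :=
        BranchedCovering.exists_isEmbedding_fixer_eq (Ω := Ω) (H i.succ ⊔ K)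
      refine ⟨Z, u, (hτ.isSubcoverOfGaloisClosure_iff hτ').mpr ?_,
        (hemb i).isPullbackAlong hτ' ?_ ?_⟩
      · rw [hKτ, hfix]
        exact le_sup_right
      · rw [hfix, hH]
        exact sup_inf_eq_of_covBy (hcov i) (not_le_sup_of_sup_eq_top htop hne)
      · rw [hfix, hH]
        exact Subgroup.relIndex_eq_index_of_sup_eq_top le_sup_right htop
  · intro Y h hmin hpq hi hnot
    obtain ⟨τ, hτ, K, hKn, hKτ, hK, hKns, hiff⟩ := hcover Y h _ hi hmin hpq
    obtain ⟨-, -, -, ⟨e⟩⟩ := hstep hΓns i K hK hKns ((hiff _).mp hi) fun h => hnot ((hiff _).mpr h)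
    obtain ⟨e'⟩ := hτ.nonempty_mon_mulEquiv
    subst hKτ
    exact ⟨e'.trans e⟩
  · intro Y Y' h h' hmin hpq hi hnot hmin' hpq' hi' hnot'
    obtain ⟨τ, hτ, K, hKn, hKτ, hK, hKns, hiff⟩ := hcover Y h _ hi hmin hpq
    obtain ⟨τ', hτ', K', hKn', hKτ', hK', hKns', hiff'⟩ := hcover Y' h' _ hi' hmin' hpq'
    have hA : ¬ (H i.castSucc).normalCore ≤ K := fun h => hnot ((hiff _).mpr h)
    have hA' : ¬ (H i.castSucc).normalCore ≤ K' := fun h => hnot' ((hiff' _).mpr h)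
    obtain ⟨h1, -⟩ := hstep hΓns i K hK hKns ((hiff _).mp hi) hA
    obtain ⟨h1', -⟩ := hstep hΓns i K' hK' hKns' ((hiff' _).mp hi') hA'
    refine hτ.sameGaloisClosure hτ' ?_
    rw [hKτ, hKτ']
    exact le_antisymm (le_of_inf_normalCore_le hK' hKns' ((hiff' _).mp hi') hA' h1)
      (le_of_inf_normalCore_le hK hKns ((hiff _).mp hi) hA h1')
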